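/- There exist absolute constants $a_1,a_2,c,b_1,b_2,b_3,b_4>0$ such that the following holds. Let $m,p\ge1$, $T>p$, $N=T-p$, and let $(X_t)_{t\in\mathbb Z}$ be a stationary process in $\mathbb R^m$ with $$X_t=\Phi_1X_{t-1}+\cdots+\Phi_pX_{t-p}+\varepsilon_t,\qquad \varepsilon_t\ \text{i.i.d.}\ N(0,\Sigma),$$ where $\Sigma$ is positive definite and all roots of $\det\big(I_m-\sum_{l=1}^p\Phi_lz^l\big)$ lie outside the closed unit disc. For matrices $A_1,\dots,A_d$ put $A(z)=I-\sum_{l=1}^dA_lz^l$, $\mu_{\min}(A)=\min_{|z|=1}\Lambda_{\min}(A(z)^HA(z))$ and $\mu_{\max}(A)=\max_{|z|=1}\Lambda_{\max}(A(z)^HA(z))$; write $\mu_{\min}(\Phi),\mu_{\max}(\Phi)$ for $\Phi_1,\dots,\Phi_p$, and $\mu_{\min}(\tilde\Phi)$ for the single $pm\times pm$ companion matrix $\tilde\Phi$ of $\Phi_1,\dots,\Phi_p$, i.e. $\tilde\Phi(z)=I_{pm}-\tilde\Phi z$. Let $$\omega=a_1\frac{\Lambda_{\max}(\Sigma)/\mu_{\min}(\tilde\Phi)}{\Lambda_{\min}(\Sigma)/\mu_{\max}(\Phi)},\qquad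 \alpha=\frac{\Lambda_{\min}(\Sigma)}{2\mu_{\max}(\Phi)},\qquad Q=a_2\Big[\Lambda_{\max}(\Sigma)+\frac{\Lambda_{\max}(\Sigma)}{\mu_{\min}(\Phi)}+\frac{\Lambda_{\max}(\Sigma)\mu_{\max}(\Phi)}{\mu_{\min}(\Phi)}\Big].$$ Let $Y$ be the $N\times m$ matrix with rows $X_T',\dots,X_{p+1}'$, let $\mathcal X$ be the $N\times pm$ matrix whose row corresponding to $X_t'$ is $(X_{t-1}',\dots,X_{t-p}')$, and put $\hat\gamma=(I_m\otimes \mathcal X')\mathrm{vec}(Y)/N$, $\hat\Gamma=(I_m\otimes \mathcal X'\mathcal X)/N$. Let $\beta^*=\mathrm{vec}\big([\Phi_1,\dots,\Phi_p]'\big)\in\mathbb R^{pm^2}$, $J=\mathrm{supp}(\beta^*)$, $k=|J|$, and let $w_j\ge0$ be weights. Assume $J$ and $J^C$ are non-empty, $\min_{j\in J^C}w_j=1$, and put $r_w=\max_{j\in J}w_j$ and $s_0=\min_{j\in J}|\beta^*_j|$. If $$N\ge c\,(1+r_w)^2\max\{\omega^2,1\}\,k\,\log(pm^2)\quad\text{and}\quad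 \lambda_N\ge4Q\sqrt{\log(pm^2)/N},$$ then with probability at least $1-b_1\exp(-b_2N\min\{\omega^{-2},1\})-b_3\exp(-b_4\log(pm^2))$ every minimizer $\hat\beta$ of $-2\beta'\hat\gamma+\beta'\hat\Gamma\beta+\lambda_N\sum_jw_j|\beta_j|$ satisfies $$\|\hat\beta-\beta^*\|_2\le\frac{1+2r_w}{\alpha}\sqrt k\,\lambda_N,\qquad \|\hat\beta-\beta^*\|_1\le\frac{2+6r_w+4r_w^2}{\alpha}k\lambda_N,\qquad (\hat\beta-\beta^*)'\hat\Gamma(\hat\beta-\beta^*)\le\frac{(1+2r_w)^2}{2\alpha}k\lambda_N^2,$$ $$|\mathrm{supp}(\beta^*)\setminus\mathrm{supp}(\hat\beta)|\le\frac{2+6r_w+4r_w^2}{s_0\alpha}k\lambda_N,\qquad |\mathrm{supp}(\tilde\beta)\setminus\mathrm{supp}(\beta^*)|\le(1+2r_w)^2\frac k\alpha,$$ where $\tilde\beta_j=\hat\beta_j\,\mathbf 1(|\hat\beta_j|>\lambda_N)$. -/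

import Mathlib

open MeasureTheory ProbabilityTheory Matrix
open scoped Kronecker

namespace SparseVAR

noncomputable section

/-- Largest eigenvalue of a (nonempty) symmetric or Hermitian matrix. -/
def lambdaMax {𝕜 n : Type*} [RCLike 𝕜] [Fintype n] [DecidableEq n] (A : Matrix n n 𝕜) : ℝ :=
  sSup (spectrum ℝ A)

/-- Smallest eigenvalue of a (nonempty) symmetric or Hermitian matrix. -/
def lambdaMin {𝕜 n : Type*} [RCLike 𝕜] [Fintype n] [DecidableEq n] (A : Matrix n n 𝕜) : ℝ :=
  sInf (spectrum ℝ A)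

/-- The characteristic polynomial `I - ∑_{l=1}^p Φ_l z^l` of a VAR(p) process.
The matrix `Φ_l` of lag `l = 1, …, p` is the value of `Φ` at the index `l - 1` of `Fin p`. -/
def charPoly {n : Type*} [DecidableEq n] {p : ℕ} (Φ : Fin p → Matrix n n ℝ) (z : ℂ) :
    Matrix n n ℂ :=
  1 - ∑ l : Fin p, z ^ ((l : ℕ) + 1) • (Φ l).map Complex.ofReal

/-- All roots of `det (I - ∑ Φ_l z^l)` lie outside the closed unit disc. -/
def IsStable {n : Type*} [Fintype n] [DecidableEq n] {p : ℕ} (Φ : Fin p → Matrix n n ℝ) : Prop :=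
  ∀ z : ℂ, (charPoly Φ z).det = 0 → 1 < ‖z‖

/-- `μ_min = min_{|z| = 1} Λ_min (Φ(z)ᴴ Φ(z))`. -/
def muMin {n : Type*} [Fintype n] [DecidableEq n] {p : ℕ} (Φ : Fin p → Matrix n n ℝ) : ℝ :=
  ⨅ z : Circle, lambdaMin ((charPoly Φ (z : ℂ))ᴴ * charPoly Φ (z : ℂ))

/-- `μ_max = max_{|z| = 1} Λ_max (Φ(z)ᴴ Φ(z))`. -/
def muMax {n : Type*} [Fintype n] [DecidableEq n] {p : ℕ} (Φ : Fin p → Matrix n n ℝ) : ℝ :=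
  ⨆ z : Circle, lambdaMax ((charPoly Φ (z : ℂ))ᴴ * charPoly Φ (z : ℂ))

/-- The `pm × pm` companion matrix: first block row `Φ_1, …, Φ_p`, identity blocks just below
the block diagonal, zero elsewhere. -/
def companion {m p : ℕ} (Φ : Fin p → Matrix (Fin m) (Fin m) ℝ) :
    Matrix (Fin p × Fin m) (Fin p × Fin m) ℝ :=
  fun i j =>
    if (i.1 : ℕ) = 0 then Φ j.1 i.2 j.2
    else if (i.1 : ℕ) = (j.1 : ℕ) + 1 ∧ i.2 = j.2 then 1 else 0

/-- `ω = a₁ (Λ_max(Σ) / μ_min(Φ̃)) / (Λ_min(Σ) / μ_max(Φ))`, where `Φ̃(z) = I - z Φ̃` is the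
characteristic polynomial of the VAR(1) process with the companion matrix. -/
def omegaConst {m p : ℕ} (a₁ : ℝ) (Φ : Fin p → Matrix (Fin m) (Fin m) ℝ)
    (S : Matrix (Fin m) (Fin m) ℝ) : ℝ :=
  a₁ * ((lambdaMax S / muMin (fun _ : Fin 1 => companion Φ)) / (lambdaMin S / muMax Φ))

/-- `α = Λ_min(Σ) / (2 μ_max(Φ))`. -/
def alphaConst {m p : ℕ} (Φ : Fin p → Matrix (Fin m) (Fin m) ℝ)
    (S : Matrix (Fin m) (Fin m) ℝ) : ℝ :=
  lambdaMin S / (2 * muMax Φ)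

/-- `Q = a₂ (Λ_max(Σ) + Λ_max(Σ) / μ_min(Φ) + Λ_max(Σ) μ_max(Φ) / μ_min(Φ))`. -/
def qConst {m p : ℕ} (a₂ : ℝ) (Φ : Fin p → Matrix (Fin m) (Fin m) ℝ)
    (S : Matrix (Fin m) (Fin m) ℝ) : ℝ :=
  a₂ * (lambdaMax S + lambdaMax S / muMin Φ + lambdaMax S * muMax Φ / muMin Φ)

/-- `(X_t)_{t ∈ ℤ}` is a (strictly) stationary solution of
`X_t = Φ_1 X_{t-1} + ⋯ + Φ_p X_{t-p} + ε_t` with `ε_t` i.i.d. `N(0, S)`. -/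
structure IsStationaryVAR {Ω : Type*} [MeasurableSpace Ω] (P : Measure Ω) {m p : ℕ}
    (Φ : Fin p → Matrix (Fin m) (Fin m) ℝ) (S : Matrix (Fin m) (Fin m) ℝ)
    (X ε : ℤ → Ω → EuclideanSpace ℝ (Fin m)) : Prop where
  measurable : ∀ t, Measurable (X t)
  noise_law : ∀ t, HasLaw (ε t) (multivariateGaussian 0 S) P
  noise_indep : iIndepFun ε P
  recursion : ∀ t, ∀ᵐ x ∂P, ∀ s,
    X t x s = ∑ l : Fin p, (Φ l *ᵥ (X (t - ((l : ℤ) + 1)) x).ofLp) s + ε t x s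
  stationary : ∀ h : ℤ, P.map (fun x t => X (t + h) x) = P.map (fun x t => X t x)

/-- Index set of `vec B`, of size `q = m² p`: the entry `(s, (l, s'))` stands for `Φ_{l,ss'}`. -/
abbrev CoefIdx (m p : ℕ) : Type := Fin m × (Fin p × Fin m)

/-- The stacked `pm × m` coefficient matrix `B`, with blocks `Φ_1', …, Φ_p'`. -/
def coefMatrix {m p : ℕ} (Φ : Fin p → Matrix (Fin m) (Fin m) ℝ) :
    Matrix (Fin p × Fin m) (Fin m) ℝ :=
  fun i s => Φ i.1 s i.2

/-- The `N × m` response matrix (`N = T - p`) with rows `X_T', …, X_{p+1}'`. -/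
def response {m : ℕ} (p T : ℕ) (X : ℤ → EuclideanSpace ℝ (Fin m)) :
    Matrix (Fin (T - p)) (Fin m) ℝ :=
  fun i s => X ((T : ℤ) - (i : ℤ)) s

/-- The `N × pm` design matrix, whose row next to the response `X_t'` is
`(X_{t-1}', …, X_{t-p}')`. -/
def design {m : ℕ} (p T : ℕ) (X : ℤ → EuclideanSpace ℝ (Fin m)) :
    Matrix (Fin (T - p)) (Fin p × Fin m) ℝ :=
  fun i j => X ((T : ℤ) - (i : ℤ) - ((j.1 : ℤ) + 1)) j.2

/-- `γ̂ = (I_m ⊗ X') vec(Y) / N`. -/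
def gammaHat {m : ℕ} (p T : ℕ) (X : ℤ → EuclideanSpace ℝ (Fin m)) : CoefIdx m p → ℝ :=
  ((T - p : ℕ) : ℝ)⁻¹ •
    (((1 : Matrix (Fin m) (Fin m) ℝ) ⊗ₖ (design p T X)ᵀ) *ᵥ vec (response p T X))

/-- `Γ̂ = (I_m ⊗ X'X) / N`. -/
def GammaHat {m : ℕ} (p T : ℕ) (X : ℤ → EuclideanSpace ℝ (Fin m)) :
    Matrix (CoefIdx m p) (CoefIdx m p) ℝ :=
  ((T - p : ℕ) : ℝ)⁻¹ •
    ((1 : Matrix (Fin m) (Fin m) ℝ) ⊗ₖ ((design p T X)ᵀ * design p T X))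

/-- The weighted `l₁` penalized least-squares objective
`-2 β'γ̂ + β'Γ̂β + λ ∑_j w_j |β_j|`. -/
def objective {m : ℕ} (p T : ℕ) (X : ℤ → EuclideanSpace ℝ (Fin m)) (w : CoefIdx m p → ℝ)
    (lam : ℝ) (β : CoefIdx m p → ℝ) : ℝ :=
  -2 * (β ⬝ᵥ gammaHat p T X) + β ⬝ᵥ (GammaHat p T X *ᵥ β) + lam * ∑ j, w j * |β j|

/-- `β` is a weighted `l₁`-LS estimate: a global minimizer of the objective. -/
def IsEstimate {m : ℕ} (p T : ℕ) (X : ℤ → EuclideanSpace ℝ (Fin m)) (w : CoefIdx m p → ℝ)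
    (lam : ℝ) (β : CoefIdx m p → ℝ) : Prop :=
  ∀ b : CoefIdx m p → ℝ, objective p T X w lam β ≤ objective p T X w lam b

/-- The `l₁` norm. -/
def l1Norm {ι : Type*} [Fintype ι] (v : ι → ℝ) : ℝ := ∑ i, |v i|

/-- The `l₂` norm. -/
def l2Norm {ι : Type*} [Fintype ι] (v : ι → ℝ) : ℝ := √(∑ i, v i ^ 2)

/-- Hard thresholding: entries with absolute value at most `lam` are replaced by zero. -/
def hardThreshold {ι : Type*} (lam : ℝ) (v : ι → ℝ) : ι → ℝ :=
  fun i => if lam < |v i| then v i else 0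

end

end SparseVAR

/-! The probability enters only through two properties of the observed stretch. One is a restricted
eigenvalue bound for the Gram matrix. The other is a sup-norm bound by `lam / 4` on `gammaHat -
GammaHat *ᵥ βs`. On paths with both (`goodPaths`), `weighted_lasso_bounds` is deterministic:
optimality puts the error in a cone around the support, and curvature on that cone gives the five
inequalities.

To make both properties statements about finitely many independent standard normals `g`, the
stationary process is replaced by a recursion started from zero `n` steps before the window and
driven by `sqrt Σ` times blocks of `g`. Regressors and innovations are then linear in `g`. Their
operator norms are controlled by energy: at roots of unity the autoregressive filter acts as
multiplication by `charPoly`, so Parseval compares path energy with input energy through `muMin` and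
`muMax` (`vfilter_bounds`, `muMin_mul_sum_le`, `regressor_lower`). All these bounds are uniform in
`n`.

`gaussian_quadratic_tail` gives concentration with an exponent proportional to the number of rows,
that is, to the number of observations. For the restricted eigenvalue, nets of sparse vectors are
replaced by Maurey's empirical method: a quadratic form that is nonnegative at all sums of `ν + 1`
signed coordinate vectors is bounded below everywhere up to a multiple of the squared l₁ norm over
`ν` (`quadForm_lower_of_signedSum`), so a union bound over finitely many vectors suffices. For the
deviation bound, causality makes a regressor uncorrelated with the innovation it multiplies, and
polarization reduces their product to quadratic forms (`gaussian_product_tail`).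

Finally, the true path and the one simulated from its own innovations differ by a solution of the
homogeneous recursion, which decays by stability. By stationarity the window may be moved
arbitrarily far to the right, and since the good set is closed its probability bound survives the
limit (`le_measureReal_of_approx`). -/

namespace SparseVAR

/-! ### Rayleigh quotients and extreme eigenvalues. -/

section DotProduct

variable {𝕜 n : Type*} [RCLike 𝕜] [Fintype n]

lemma re_star_dotProduct_self (v : n → 𝕜) :
    RCLike.re (star v ⬝ᵥ v) = ∑ i, ‖v i‖ ^ 2 := by
  simp only [dotProduct, Pi.star_apply, map_sum, RCLike.star_def, RCLike.conj_mul]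
  norm_cast

lemma re_star_dotProduct_conjTranspose_mul_self (B : Matrix n n 𝕜) (v : n → 𝕜) :
    RCLike.re (star v ⬝ᵥ ((Bᴴ * B) *ᵥ v)) = ∑ i, ‖(B *ᵥ v) i‖ ^ 2 := by
  rw [← mulVec_mulVec, dotProduct_mulVec, ← star_mulVec, re_star_dotProduct_self]

end DotProduct

section Spectral

variable {𝕜 n : Type*} [RCLike 𝕜] [Fintype n] [DecidableEq n]

lemma finite_spectrum_of_isHermitian {A : Matrix n n 𝕜} (hA : A.IsHermitian) :
    (spectrum ℝ A).Finite := by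
  rw [hA.spectrum_real_eq_range_eigenvalues]
  exact Set.finite_range _

open scoped MatrixOrder in
lemma lambdaMin_mul_le {A : Matrix n n 𝕜} (hA : A.IsHermitian) (v : n → 𝕜) :
    lambdaMin A * ∑ i, ‖v i‖ ^ 2 ≤ RCLike.re (star v ⬝ᵥ (A *ᵥ v)) := by
  have h : algebraMap ℝ (Matrix n n 𝕜) (lambdaMin A) ≤ A :=
    (algebraMap_le_iff_le_spectrum (a := A) (ha := hA.isSelfAdjoint)).2 fun x hx =>
      csInf_le (finite_spectrum_of_isHermitian hA).bddBelow hx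
  have h2 := (Matrix.le_iff.1 h).re_dotProduct_nonneg v
  rw [sub_mulVec, dotProduct_sub, map_sub, Algebra.algebraMap_eq_smul_one, smul_mulVec,
    one_mulVec, dotProduct_smul, RCLike.smul_re, re_star_dotProduct_self] at h2
  linarith

open scoped MatrixOrder in
lemma le_lambdaMax_mul {A : Matrix n n 𝕜} (hA : A.IsHermitian) (v : n → 𝕜) :
    RCLike.re (star v ⬝ᵥ (A *ᵥ v)) ≤ lambdaMax A * ∑ i, ‖v i‖ ^ 2 := by
  have h : A ≤ algebraMap ℝ (Matrix n n 𝕜) (lambdaMax A) :=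
    (le_algebraMap_iff_spectrum_le (a := A) (ha := hA.isSelfAdjoint)).2 fun x hx =>
      le_csSup (finite_spectrum_of_isHermitian hA).bddAbove hx
  have h2 := (Matrix.le_iff.1 h).re_dotProduct_nonneg v
  rw [sub_mulVec, dotProduct_sub, map_sub, Algebra.algebraMap_eq_smul_one, smul_mulVec,
    one_mulVec, dotProduct_smul, RCLike.smul_re, re_star_dotProduct_self] at h2
  linarith

lemma spectrum_nonempty_of_isHermitian [Nonempty n] {A : Matrix n n 𝕜} (hA : A.IsHermitian) :
    (spectrum ℝ A).Nonempty := by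
  rw [hA.spectrum_real_eq_range_eigenvalues]
  exact Set.range_nonempty _

lemma exists_unit_rayleigh_eq {A : Matrix n n 𝕜} (hA : A.IsHermitian) {x : ℝ}
    (hx : x ∈ spectrum ℝ A) :
    ∃ v : EuclideanSpace 𝕜 n, ‖v‖ = 1 ∧ RCLike.re (star v.ofLp ⬝ᵥ (A *ᵥ v.ofLp)) = x := by
  rw [hA.spectrum_real_eq_range_eigenvalues] at hx
  obtain ⟨i, rfl⟩ := hx
  exact ⟨hA.eigenvectorBasis i, hA.eigenvectorBasis.orthonormal.1 i, (hA.eigenvalues_eq i).symm⟩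

lemma le_lambdaMin [Nonempty n] {A : Matrix n n 𝕜} (hA : A.IsHermitian) {c : ℝ}
    (h : ∀ v : EuclideanSpace 𝕜 n, ‖v‖ = 1 → c ≤ RCLike.re (star v.ofLp ⬝ᵥ (A *ᵥ v.ofLp))) :
    c ≤ lambdaMin A := by
  refine le_csInf (spectrum_nonempty_of_isHermitian hA) fun x hx => ?_
  obtain ⟨v, hv, rfl⟩ := exists_unit_rayleigh_eq hA hx
  exact h v hv

lemma lambdaMax_le [Nonempty n] {A : Matrix n n 𝕜} (hA : A.IsHermitian) {c : ℝ}
    (h : ∀ v : EuclideanSpace 𝕜 n, ‖v‖ = 1 → RCLike.re (star v.ofLp ⬝ᵥ (A *ᵥ v.ofLp)) ≤ c) :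
    lambdaMax A ≤ c := by
  refine csSup_le (spectrum_nonempty_of_isHermitian hA) fun x hx => ?_
  obtain ⟨v, hv, rfl⟩ := exists_unit_rayleigh_eq hA hx
  exact h v hv

lemma lambdaMin_pos [Nonempty n] {S : Matrix n n ℝ} (hS : S.PosDef) : 0 < lambdaMin S := by
  have := (spectrum_nonempty_of_isHermitian hS.1).csInf_mem
    (finite_spectrum_of_isHermitian hS.1)
  obtain ⟨v, hv, hx⟩ := exists_unit_rayleigh_eq hS.1 this
  rw [lambdaMin, ← hx]
  exact hS.re_dotProduct_pos (x := v.ofLp) (by rintro h; simp [(WithLp.ofLp_eq_zero 2).1 h] at hv)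

lemma lambdaMin_le_lambdaMax {A : Matrix n n 𝕜} (hA : A.IsHermitian) :
    lambdaMin A ≤ lambdaMax A := by
  by_cases h : (spectrum ℝ A).Nonempty
  · exact csInf_le_csSup h (finite_spectrum_of_isHermitian hA).bddBelow
      (finite_spectrum_of_isHermitian hA).bddAbove
  · simp [lambdaMin, lambdaMax, Set.not_nonempty_iff_eq_empty.1 h]

lemma lambdaMax_pos [Nonempty n] {S : Matrix n n ℝ} (hS : S.PosDef) : 0 < lambdaMax S :=
  (lambdaMin_pos hS).trans_le (lambdaMin_le_lambdaMax hS.1)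

end Spectral

/-! ### The characteristic polynomial on the unit circle. -/

section CharPoly

lemma continuous_charPoly {n : Type*} [DecidableEq n] {p : ℕ} (Φ : Fin p → Matrix n n ℝ) : Continuous (charPoly Φ) := by
  unfold charPoly
  fun_prop

variable {n : Type*} [Fintype n] [DecidableEq n] {p : ℕ}

/-- Compactness of circle times unit sphere: the constants are the attained extremes of `‖Φ(z) v‖²`.
A zero minimum would be a kernel vector at some `|z| = 1`, which stability forbids. The bounds are
what makes the real infimum and supremum in `muMin` and `muMax` meaningful, since for unbounded
families these take a default value. -/
lemma exists_bounds_spectrum_charPoly [Nonempty n] (Φ : Fin p → Matrix n n ℝ) :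
    ∃ δ C : ℝ, (IsStable Φ → 0 < δ) ∧ 0 ≤ δ ∧ ∀ z : Circle,
      δ ≤ lambdaMin ((charPoly Φ (z : ℂ))ᴴ * charPoly Φ (z : ℂ)) ∧
      lambdaMax ((charPoly Φ (z : ℂ))ᴴ * charPoly Φ (z : ℂ)) ≤ C := by
  let K : Set (Circle × EuclideanSpace ℂ n) := Set.univ ×ˢ Metric.sphere 0 1
  let f : Circle × EuclideanSpace ℂ n → ℝ :=
    fun a => ∑ i, ‖(charPoly Φ (a.1 : ℂ) *ᵥ a.2.ofLp) i‖ ^ 2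
  have hK : IsCompact K := isCompact_univ.prod (isCompact_sphere _ _)
  have hf : Continuous f := by
    have h1 : Continuous fun a : Circle × EuclideanSpace ℂ n => charPoly Φ (a.1 : ℂ) :=
      (continuous_charPoly Φ).comp (by fun_prop)
    have h2 : Continuous fun a : Circle × EuclideanSpace ℂ n => a.2.ofLp := by fun_prop
    have h3 := h1.matrix_mulVec h2
    exact continuous_finsetSum _ fun i _ => ((continuous_apply i).comp h3).norm.pow 2
  have hne : K.Nonempty := by
    obtain ⟨v, hv⟩ := exists_norm_eq (EuclideanSpace ℂ n) (zero_le_one)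
    exact ⟨(1, v), by simp [K, hv]⟩
  obtain ⟨a, ha, hmin⟩ := hK.exists_isMinOn hne hf.continuousOn
  obtain ⟨b, hb, hmax⟩ := hK.exists_isMaxOn hne hf.continuousOn
  refine ⟨f a, f b, fun hs => ?_, Finset.sum_nonneg fun i _ => by positivity, fun z => ?_⟩
  · by_contra hcon
    have h0 : f a = 0 := le_antisymm (not_lt.1 hcon) (Finset.sum_nonneg fun i _ => by positivity)
    have h1 : charPoly Φ (a.1 : ℂ) *ᵥ a.2.ofLp = 0 := by
      ext i
      have := (Finset.sum_eq_zero_iff_of_nonneg (fun i _ => by positivity)).1 h0 i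
        (Finset.mem_univ i)
      simpa using this
    have h2 : (charPoly Φ (a.1 : ℂ)).det = 0 :=
      Matrix.exists_mulVec_eq_zero_iff.1 ⟨a.2.ofLp, fun h => by
        have : ‖a.2‖ = 1 := by simpa [K] using ha
        simp [(WithLp.ofLp_eq_zero 2).1 h] at this, h1⟩
    have h3 := hs (a.1 : ℂ) h2
    rw [Circle.norm_coe] at h3
    exact lt_irrefl _ h3
  · have key : ∀ v : EuclideanSpace ℂ n, ‖v‖ = 1 →
        f a ≤ ∑ i, ‖(charPoly Φ (z : ℂ) *ᵥ v.ofLp) i‖ ^ 2 ∧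
          ∑ i, ‖(charPoly Φ (z : ℂ) *ᵥ v.ofLp) i‖ ^ 2 ≤ f b := fun v hv => by
      have hmem : (z, v) ∈ K := ⟨Set.mem_univ _, mem_sphere_zero_iff_norm.2 hv⟩
      have h1 : f a ≤ f (z, v) := isMinOn_iff.1 hmin _ hmem
      have h2 : f (z, v) ≤ f b := isMaxOn_iff.1 hmax _ hmem
      exact ⟨h1, h2⟩
    refine ⟨le_lambdaMin (isHermitian_conjTranspose_mul_self _) fun v hv => ?_,
      lambdaMax_le (isHermitian_conjTranspose_mul_self _) fun v hv => ?_⟩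
    · rw [re_star_dotProduct_conjTranspose_mul_self]
      exact (key v hv).1
    · rw [re_star_dotProduct_conjTranspose_mul_self]
      exact (key v hv).2

lemma muMin_mul_le [Nonempty n] (Φ : Fin p → Matrix n n ℝ) (z : Circle) (v : n → ℂ) :
    muMin Φ * ∑ i, ‖v i‖ ^ 2 ≤ ∑ i, ‖(charPoly Φ (z : ℂ) *ᵥ v) i‖ ^ 2 := by
  obtain ⟨δ, C, -, hδ, hb⟩ := exists_bounds_spectrum_charPoly Φ
  rw [← re_star_dotProduct_conjTranspose_mul_self]
  refine le_trans (mul_le_mul_of_nonneg_right ?_ (Finset.sum_nonneg fun i _ => by positivity))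
    (lambdaMin_mul_le (isHermitian_conjTranspose_mul_self _) v)
  refine ciInf_le (f := fun z : Circle => lambdaMin ((charPoly Φ (z : ℂ))ᴴ * charPoly Φ (z : ℂ)))
    ⟨δ, ?_⟩ z
  rintro _ ⟨z, rfl⟩
  exact (hb z).1

lemma le_muMax_mul [Nonempty n] (Φ : Fin p → Matrix n n ℝ) (z : Circle) (v : n → ℂ) :
    ∑ i, ‖(charPoly Φ (z : ℂ) *ᵥ v) i‖ ^ 2 ≤ muMax Φ * ∑ i, ‖v i‖ ^ 2 := by
  obtain ⟨δ, C, -, hδ, hb⟩ := exists_bounds_spectrum_charPoly Φ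
  rw [← re_star_dotProduct_conjTranspose_mul_self]
  refine le_trans (le_lambdaMax_mul (isHermitian_conjTranspose_mul_self _) v)
    (mul_le_mul_of_nonneg_right ?_ (Finset.sum_nonneg fun i _ => by positivity))
  refine le_ciSup (f := fun z : Circle => lambdaMax ((charPoly Φ (z : ℂ))ᴴ * charPoly Φ (z : ℂ)))
    ⟨C, ?_⟩ z
  rintro _ ⟨z, rfl⟩
  exact (hb z).2

lemma muMin_pos [Nonempty n] {Φ : Fin p → Matrix n n ℝ} (hΦ : IsStable Φ) : 0 < muMin Φ := by
  obtain ⟨δ, C, hpos, hδ, hb⟩ := exists_bounds_spectrum_charPoly Φ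
  refine (hpos hΦ).trans_le (le_ciInf fun z => ?_)
  exact (hb z).1

lemma muMin_le_muMax [Nonempty n] (Φ : Fin p → Matrix n n ℝ) : muMin Φ ≤ muMax Φ := by
  have h := (muMin_mul_le Φ 1 1).trans (le_muMax_mul Φ 1 1)
  refine le_of_mul_le_mul_right h ?_
  simp [Fintype.card_pos]

lemma muMax_pos [Nonempty n] {Φ : Fin p → Matrix n n ℝ} (hΦ : IsStable Φ) : 0 < muMax Φ :=
  (muMin_pos hΦ).trans_le (muMin_le_muMax Φ)

end CharPoly

end SparseVAR

/-! ### Parseval's identity and the energy of filtered sequences. -/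

namespace SparseVAR

lemma sum_pow_mul_conj_pow {ζ : ℂ} {M : ℕ} (hζ : IsPrimitiveRoot ζ M) (hM : M ≠ 0) {t s : ℕ}
    (ht : t < M) (hs : s < M) :
    ∑ k ∈ Finset.range M, (ζ ^ k) ^ t * (starRingEnd ℂ) ((ζ ^ k) ^ s) =
      if t = s then (M : ℂ) else 0 := by
  have hn : ζ * (starRingEnd ℂ) ζ = 1 := by
    rw [RCLike.mul_conj, hζ.norm'_eq_one hM]
    simp
  have h1 : ∀ k, (ζ ^ k) ^ t * (starRingEnd ℂ) ((ζ ^ k) ^ s) =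
      (ζ ^ t * ((starRingEnd ℂ) ζ) ^ s) ^ k := by
    intro k
    simp only [map_pow]
    ring
  simp only [h1]
  split_ifs with h
  · subst h
    simp [← mul_pow, hn]
  · have hne : ζ ^ t * ((starRingEnd ℂ) ζ) ^ s ≠ 1 := by
      intro h2
      apply h
      apply hζ.pow_inj ht hs
      calc ζ ^ t = ζ ^ t * (ζ * (starRingEnd ℂ) ζ) ^ s := by rw [hn]; simp
        _ = (ζ ^ t * ((starRingEnd ℂ) ζ) ^ s) * ζ ^ s := by ring
        _ = ζ ^ s := by rw [h2, one_mul]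
    have hpow : (ζ ^ t * ((starRingEnd ℂ) ζ) ^ s) ^ M = 1 := by
      rw [mul_pow, ← pow_mul, ← pow_mul, mul_comm t, mul_comm s, pow_mul, pow_mul, ← map_pow,
        hζ.pow_eq_one]
      simp
    have := geom_sum_mul (ζ ^ t * ((starRingEnd ℂ) ζ) ^ s) M
    rw [hpow, sub_self] at this
    exact (mul_eq_zero.1 this).resolve_right (sub_ne_zero.2 hne)

lemma sum_norm_sq_fourier {ζ : ℂ} {M : ℕ} (hζ : IsPrimitiveRoot ζ M) (hM : M ≠ 0) (a : ℕ → ℂ) :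
    ∑ k ∈ Finset.range M, ‖∑ t ∈ Finset.range M, (ζ ^ k) ^ t * a t‖ ^ 2 =
      M * ∑ t ∈ Finset.range M, ‖a t‖ ^ 2 := by
  have hc : ((∑ k ∈ Finset.range M, ‖∑ t ∈ Finset.range M, (ζ ^ k) ^ t * a t‖ ^ 2 : ℝ) : ℂ) =
      ((M * ∑ t ∈ Finset.range M, ‖a t‖ ^ 2 : ℝ) : ℂ) := by
    push_cast
    simp only [← Complex.mul_conj', map_sum, map_mul,
      Finset.sum_mul_sum]
    rw [Finset.sum_comm, Finset.mul_sum]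
    refine Finset.sum_congr rfl fun t ht => ?_
    rw [Finset.sum_comm]
    have : ∀ s ∈ Finset.range M, ∑ k ∈ Finset.range M,
        (ζ ^ k) ^ t * a t * ((starRingEnd ℂ) ((ζ ^ k) ^ s) * (starRingEnd ℂ) (a s)) =
        if t = s then (M : ℂ) * (a t * (starRingEnd ℂ) (a s)) else 0 := by
      intro s hs
      rw [← zero_mul (a t * (starRingEnd ℂ) (a s)), ← ite_mul,
        ← sum_pow_mul_conj_pow hζ hM (Finset.mem_range.1 ht) (Finset.mem_range.1 hs),
        Finset.sum_mul]
      exact Finset.sum_congr rfl fun k _ => by ring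
    rw [Finset.sum_congr rfl this, Finset.sum_ite_eq, if_pos ht]
  exact_mod_cast hc

section Filter

variable {n : Type*} [Fintype n] {p : ℕ}

/-- The one-sided vector autoregressive filter `y_t - ∑ Φ_l y_{t-l}`, where `y` vanishes at
negative times. -/
noncomputable def vfilter (Φ : Fin p → Matrix n n ℝ) (y : ℕ → n → ℝ) (t : ℕ) : n → ℝ :=
  y t - ∑ l : Fin p, if (l : ℕ) + 1 ≤ t then Φ l *ᵥ y (t - (l + 1)) else 0

/-- Reindexing by a lag `d`. The terms pushed past the end of the range start at `s ≥ K`, where they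
vanish, so nothing is lost. -/
lemma sum_range_shift {E : Type*} [AddCommMonoid E] (f : ℕ → ℕ → E) {M K d : ℕ} (hM : K + d ≤ M)
    (hf : ∀ s, K ≤ s → f s (s + d) = 0) :
    ∑ t ∈ Finset.range M, (if d ≤ t then f (t - d) t else 0) =
      ∑ s ∈ Finset.range M, f s (s + d) := by
  obtain ⟨R, rfl⟩ : ∃ R, M = d + R := ⟨M - d, by omega⟩
  rw [Finset.sum_range_add, Finset.sum_eq_zero fun t ht => by
    simp [Nat.not_le.2 (Finset.mem_range.1 ht)], zero_add]
  have h2 : ∑ s ∈ Finset.range (d + R), f s (s + d) = ∑ s ∈ Finset.range R, f s (s + d) := by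
    symm
    apply Finset.sum_subset (by intro x; simp; omega)
    intro s _ hs2
    exact hf s (by simp at hs2; omega)
  rw [h2]
  refine Finset.sum_congr rfl fun s _ => ?_
  simp [Nat.add_comm d s]

variable [DecidableEq n]

/-- A lag of `l + 1` steps multiplies the transform by `z ^ (l + 1)`. The margin of `p` zeros after
time `K` makes this exact on a finite range. -/
lemma charPoly_mulVec_sum (Φ : Fin p → Matrix n n ℝ) (y : ℕ → n → ℝ) {K M : ℕ}
    (hy : ∀ t, K ≤ t → y t = 0) (hM : K + p ≤ M) (z : ℂ) :
    charPoly Φ z *ᵥ (fun i => ∑ t ∈ Finset.range M, z ^ t * (y t i : ℂ)) =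
      fun i => ∑ t ∈ Finset.range M, z ^ t * (vfilter Φ y t i : ℂ) := by
  ext i
  simp only [charPoly, sub_mulVec, one_mulVec, sum_mulVec, Pi.sub_apply, Finset.sum_apply,
    vfilter, Complex.ofReal_sub, mul_sub, Finset.sum_sub_distrib, Complex.ofReal_sum,
    Finset.mul_sum]
  congr 1
  rw [Finset.sum_comm]
  refine Finset.sum_congr rfl fun l _ => ?_
  have := sum_range_shift (fun s t => z ^ t * (((Φ l *ᵥ y s) i : ℝ) : ℂ)) (M := M) (K := K)
    (d := (l : ℕ) + 1) (by have := l.2; omega) (fun s hs => by simp [hy s hs])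
  rw [smul_mulVec, Pi.smul_apply, smul_eq_mul, mulVec, dotProduct, Finset.mul_sum]
  trans ∑ s ∈ Finset.range M, z ^ (s + ((l : ℕ) + 1)) * (((Φ l *ᵥ y s) i : ℝ) : ℂ)
  · simp only [mulVec, dotProduct, Complex.ofReal_sum, Complex.ofReal_mul, Matrix.map_apply,
      Finset.mul_sum]
    rw [Finset.sum_comm]
    refine Finset.sum_congr rfl fun s _ => Finset.sum_congr rfl fun j _ => by ring
  · rw [← this]
    refine Finset.sum_congr rfl fun t _ => ?_
    split_ifs <;> simp

lemma sum_fourier_dotProduct {ζ : ℂ} {M : ℕ} (hζ : IsPrimitiveRoot ζ M) (hM : M ≠ 0)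
    (y : ℕ → n → ℝ) :
    ∑ k ∈ Finset.range M, ∑ i, ‖∑ t ∈ Finset.range M, (ζ ^ k) ^ t * (y t i : ℂ)‖ ^ 2 =
      M * ∑ t ∈ Finset.range M, y t ⬝ᵥ y t := by
  rw [Finset.sum_comm]
  simp only [sum_norm_sq_fourier hζ hM, dotProduct]
  rw [← Finset.mul_sum, Finset.sum_comm]
  simp [sq]

/-- Parseval at the `M`-th roots of unity turns both energies into sums over frequencies, where the
comparison holds term by term by the definition of `muMin` and `muMax`. -/
lemma vfilter_bounds [Nonempty n] (Φ : Fin p → Matrix n n ℝ) (y : ℕ → n → ℝ) {K M : ℕ}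
    (hy : ∀ t, K ≤ t → y t = 0) (hM : K + p ≤ M) :
    muMin Φ * ∑ t ∈ Finset.range M, y t ⬝ᵥ y t ≤
        ∑ t ∈ Finset.range M, vfilter Φ y t ⬝ᵥ vfilter Φ y t ∧
      ∑ t ∈ Finset.range M, vfilter Φ y t ⬝ᵥ vfilter Φ y t ≤
        muMax Φ * ∑ t ∈ Finset.range M, y t ⬝ᵥ y t := by
  rcases eq_or_ne M 0 with rfl | hM0
  · simp
  have hζ := Complex.isPrimitiveRoot_exp M hM0
  set ζ := Complex.exp (2 * Real.pi * Complex.I / M)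
  have hz : ∀ k : ℕ, ∃ z : Circle, (z : ℂ) = ζ ^ k := fun k =>
    ⟨⟨ζ ^ k, mem_sphere_zero_iff_norm.2 (by rw [norm_pow, hζ.norm'_eq_one hM0, one_pow])⟩, rfl⟩
  have hMpos : (0 : ℝ) < M := by positivity
  constructor
  · refine le_of_mul_le_mul_left ?_ hMpos
    rw [mul_left_comm, ← sum_fourier_dotProduct hζ hM0, ← sum_fourier_dotProduct hζ hM0,
      Finset.mul_sum]
    refine Finset.sum_le_sum fun k _ => ?_
    obtain ⟨z, hz⟩ := hz k
    have h := muMin_mul_le Φ z (fun i => ∑ t ∈ Finset.range M, (z : ℂ) ^ t * (y t i : ℂ))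
    rwa [charPoly_mulVec_sum Φ y hy hM, hz] at h
  · refine le_of_mul_le_mul_left ?_ hMpos
    rw [mul_left_comm (M : ℝ) (muMax Φ), ← sum_fourier_dotProduct hζ hM0,
      ← sum_fourier_dotProduct hζ hM0, Finset.mul_sum]
    refine Finset.sum_le_sum fun k _ => ?_
    obtain ⟨z, hz⟩ := hz k
    have h := le_muMax_mul Φ z (fun i => ∑ t ∈ Finset.range M, (z : ℂ) ^ t * (y t i : ℂ))
    rwa [charPoly_mulVec_sum Φ y hy hM, hz] at h

end Filter

end SparseVAR

/-! ### Inverting the filter: decay and energy of solutions, and the companion form. -/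

namespace SparseVAR

open Filter Topology

section FilterAlgebra

variable {n : Type*} [Fintype n] {p : ℕ}

lemma vfilter_add (Φ : Fin p → Matrix n n ℝ) (y z : ℕ → n → ℝ) (t : ℕ) :
    vfilter Φ (y + z) t = vfilter Φ y t + vfilter Φ z t := by
  have h : ∀ l : Fin p, (if (l : ℕ) + 1 ≤ t then Φ l *ᵥ (y + z) (t - (l + 1)) else 0) =
      (if (l : ℕ) + 1 ≤ t then Φ l *ᵥ y (t - (l + 1)) else 0) +
      (if (l : ℕ) + 1 ≤ t then Φ l *ᵥ z (t - (l + 1)) else 0) := fun l => by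
    split_ifs <;> simp [mulVec_add]
  rw [vfilter, Finset.sum_congr rfl fun l _ => h l, Finset.sum_add_distrib, Pi.add_apply, vfilter,
    vfilter, add_sub_add_comm]

lemma vfilter_smul (Φ : Fin p → Matrix n n ℝ) (c : ℝ) (y : ℕ → n → ℝ) (t : ℕ) :
    vfilter Φ (c • y) t = c • vfilter Φ y t := by
  have h : ∀ l : Fin p, (if (l : ℕ) + 1 ≤ t then Φ l *ᵥ (c • y) (t - (l + 1)) else 0) =
      c • (if (l : ℕ) + 1 ≤ t then Φ l *ᵥ y (t - (l + 1)) else 0) := fun l => by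
    split_ifs <;> simp [mulVec_smul]
  rw [vfilter, Finset.sum_congr rfl fun l _ => h l, ← Finset.smul_sum, Pi.smul_apply, vfilter,
    smul_sub]

/-- The filter is causal with identity leading coefficient, so its outputs up to time `t` determine
its inputs recursively. -/
lemma eq_of_vfilter_eq {Φ : Fin p → Matrix n n ℝ} {y z : ℕ → n → ℝ} {t : ℕ}
    (h : ∀ s ≤ t, vfilter Φ y s = vfilter Φ z s) : y t = z t := by
  induction t using Nat.strong_induction_on with
  | _ t ih =>
    have h1 := h t le_rfl
    have h2 : (∑ l : Fin p, if (l : ℕ) + 1 ≤ t then Φ l *ᵥ y (t - (l + 1)) else 0) =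
        ∑ l : Fin p, if (l : ℕ) + 1 ≤ t then Φ l *ᵥ z (t - (l + 1)) else 0 := by
      refine Finset.sum_congr rfl fun l _ => ?_
      split_ifs with hl
      · rw [ih _ (by omega) fun s hs => h s (by omega)]
      · rfl
    simp only [vfilter, h2] at h1
    exact sub_left_injective h1

/-- The solution of the autoregression with inputs `e`, started from zero. -/
noncomputable def solve (Φ : Fin p → Matrix n n ℝ) (e : ℕ → n → ℝ) (t : ℕ) : n → ℝ :=
  e t + ∑ l : Fin p, if (l : ℕ) + 1 ≤ t then Φ l *ᵥ solve Φ e (t - (l + 1)) else 0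
termination_by t
decreasing_by omega

lemma vfilter_solve (Φ : Fin p → Matrix n n ℝ) (e : ℕ → n → ℝ) (t : ℕ) :
    vfilter Φ (solve Φ e) t = e t := by
  rw [vfilter, solve]
  exact add_sub_cancel_right _ _

lemma solve_congr (Φ : Fin p → Matrix n n ℝ) {e e' : ℕ → n → ℝ} {t : ℕ}
    (h : ∀ s ≤ t, e s = e' s) : solve Φ e t = solve Φ e' t :=
  eq_of_vfilter_eq fun s hs => by rw [vfilter_solve, vfilter_solve, h s hs]

lemma solve_vfilter (Φ : Fin p → Matrix n n ℝ) (y : ℕ → n → ℝ) (t : ℕ) :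
    solve Φ (vfilter Φ y) t = y t :=
  eq_of_vfilter_eq fun s _ => by rw [vfilter_solve]

/-- `solve` as a linear map in the inputs. -/
noncomputable def solveLin (Φ : Fin p → Matrix n n ℝ) : (ℕ → n → ℝ) →ₗ[ℝ] (ℕ → n → ℝ) where
  toFun := solve Φ
  map_add' e f := funext fun t => eq_of_vfilter_eq (Φ := Φ) fun s _ => by
    rw [vfilter_add, vfilter_solve, vfilter_solve, vfilter_solve]; rfl
  map_smul' c e := funext fun t => eq_of_vfilter_eq (Φ := Φ) fun s _ => by
    rw [RingHom.id_apply, vfilter_smul, vfilter_solve, vfilter_solve]; rfl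

end FilterAlgebra

section Energy

variable {n : Type*} [Fintype n] [DecidableEq n] [Nonempty n] {p : ℕ}

/-- A solution of the autoregression which decays at infinity has energy at most the energy of
its inputs over `μ_min`. -/
lemma muMin_mul_sum_le (Φ : Fin p → Matrix n n ℝ) {y : ℕ → n → ℝ} {K : ℕ}
    (hK : ∀ t, K ≤ t → vfilter Φ y t = 0) (hy : Tendsto y atTop (𝓝 0)) (hμ : 0 ≤ muMin Φ)
    (M : ℕ) :
    muMin Φ * ∑ t ∈ Finset.range M, y t ⬝ᵥ y t ≤
      ∑ t ∈ Finset.range K, vfilter Φ y t ⬝ᵥ vfilter Φ y t := by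
  -- Cutting `y` off at time `R` makes the finite-support bound applicable. The cost is `g R`, the
  -- energy of the `p` filter outputs from time `R` on, which involve only the last values before
  -- the cut and hence vanish as `R → ∞`.
  let tr : ℕ → ℕ → n → ℝ := fun R t => if t < R then y t else 0
  let g : ℕ → ℝ := fun R => ∑ i ∈ Finset.range p, vfilter Φ (tr R) (R + i) ⬝ᵥ
    vfilter Φ (tr R) (R + i)
  have htr : ∀ i : ℕ, ∀ l : Fin p, Tendsto (fun R => if (l : ℕ) + 1 ≤ R + i then
      Φ l *ᵥ tr R (R + i - (l + 1)) else 0) atTop (𝓝 0) := by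
    intro i l
    by_cases hil : i < (l : ℕ) + 1
    · have h1 : Tendsto (fun R => Φ l *ᵥ y (R + i - (l + 1))) atTop (𝓝 (Φ l *ᵥ 0)) := by
        have h2 : Tendsto (fun R : ℕ => R + i - ((l : ℕ) + 1)) atTop atTop :=
          tendsto_atTop.2 fun b => eventually_atTop.2 ⟨b + l + 1, fun R hR => by omega⟩
        exact ((continuous_const.matrix_mulVec continuous_id).tendsto (0 : n → ℝ)).comp
          (hy.comp h2)
      rw [mulVec_zero] at h1
      refine h1.congr' (eventually_atTop.2 ⟨(l : ℕ) + 1, fun R hR => ?_⟩)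
      simp only [tr]
      rw [if_pos (by omega), if_pos (by omega)]
    · refine tendsto_const_nhds.congr fun R => ?_
      simp only [tr]
      rw [if_neg (show ¬ R + i - ((l : ℕ) + 1) < R by omega), mulVec_zero, ite_self]
  have hg : Tendsto g atTop (𝓝 0) := by
    have h1 : ∀ i, Tendsto (fun R => vfilter Φ (tr R) (R + i)) atTop (𝓝 0) := by
      intro i
      have h2 : Tendsto (fun R => (0 : n → ℝ) - ∑ l : Fin p, if (l : ℕ) + 1 ≤ R + i then
          Φ l *ᵥ tr R (R + i - (l + 1)) else 0) atTop (𝓝 (0 - ∑ l : Fin p, 0)) :=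
        tendsto_const_nhds.sub (tendsto_finsetSum _ fun l _ => htr i l)
      rw [Finset.sum_const_zero, sub_zero] at h2
      refine h2.congr fun R => ?_
      simp [vfilter, tr]
    have h3 : Tendsto g atTop (𝓝 (∑ i ∈ Finset.range p, (0 : n → ℝ) ⬝ᵥ 0)) :=
      tendsto_finsetSum _ fun i _ =>
        ((continuous_id.dotProduct continuous_id).tendsto (0 : n → ℝ)).comp (h1 i)
    simpa using h3
  have hmain : ∀ R, max M K ≤ R → muMin Φ * ∑ t ∈ Finset.range M, y t ⬝ᵥ y t ≤
      ∑ t ∈ Finset.range K, vfilter Φ y t ⬝ᵥ vfilter Φ y t + g R := by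
    intro R hR
    have hRM : M ≤ R := le_trans (le_max_left _ _) hR
    have hRK : K ≤ R := le_trans (le_max_right _ _) hR
    have h1 := (vfilter_bounds Φ (tr R) (K := R) (M := R + p)
      (fun t ht => by simp [tr, not_lt.2 ht]) le_rfl).1
    rw [Finset.sum_range_add, Finset.sum_range_add] at h1
    have h2 : ∀ t, t < R → vfilter Φ (tr R) t = vfilter Φ y t := by
      intro t ht
      simp only [vfilter, tr]
      rw [if_pos ht]
      congr 1
      refine Finset.sum_congr rfl fun l _ => ?_
      rw [if_pos (by omega : t - ((l : ℕ) + 1) < R)]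
    have h3 : ∑ t ∈ Finset.range R, vfilter Φ (tr R) t ⬝ᵥ vfilter Φ (tr R) t =
        ∑ t ∈ Finset.range K, vfilter Φ y t ⬝ᵥ vfilter Φ y t := by
      rw [Finset.sum_congr rfl fun t ht => by rw [h2 t (Finset.mem_range.1 ht)]]
      symm
      refine Finset.sum_subset (Finset.range_mono hRK) fun t _ ht => ?_
      rw [hK t (by simpa using ht), zero_dotProduct]
    have h4 : ∑ t ∈ Finset.range M, y t ⬝ᵥ y t ≤
        ∑ t ∈ Finset.range R, tr R t ⬝ᵥ tr R t := by
      have h5 : ∀ t ∈ Finset.range M, y t ⬝ᵥ y t = tr R t ⬝ᵥ tr R t := fun t ht => by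
        rw [show tr R t = y t from if_pos ((Finset.mem_range.1 ht).trans_le hRM)]
      rw [Finset.sum_congr rfl h5]
      exact Finset.sum_le_sum_of_subset_of_nonneg (Finset.range_mono hRM) fun t _ _ =>
        dotProduct_star_self_nonneg _
    rw [h3] at h1
    refine le_trans (mul_le_mul_of_nonneg_left ?_ hμ) h1
    exact h4.trans (le_add_of_nonneg_right (Finset.sum_nonneg fun i _ =>
      dotProduct_star_self_nonneg _))
  refine le_of_tendsto_of_tendsto tendsto_const_nhds
    ((tendsto_const_nhds (x := ∑ t ∈ Finset.range K, vfilter Φ y t ⬝ᵥ vfilter Φ y t)).add hg)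
    (eventually_atTop.2 ⟨max M K, hmain⟩) |>.trans (by simp)

end Energy

section Powers

variable {n : Type*} [Fintype n] [DecidableEq n] [Nonempty n]

attribute [local instance] Matrix.linftyOpNormedRing Matrix.linftyOpNormedAlgebra in
-- A nonzero eigenvalue `x` of `A` gives the root `x⁻¹` of `det (I - z A)`, so stability means
-- spectral radius below one, and Gelfand's formula then forces geometric decay of the powers.
lemma tendsto_norm_pow_of_isStable {A : Matrix n n ℝ} (hA : IsStable fun _ : Fin 1 => A) :
    Tendsto (fun k => A ^ k) atTop (𝓝 0) := by
  set B : Matrix n n ℂ := A.map Complex.ofReal with hB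
  have hρ : spectralRadius ℂ B < 1 := by
    have h := spectrum.spectralRadius_lt_of_forall_lt B (r := 1) ?_
    · simpa using h
    intro x hx
    rcases eq_or_ne x 0 with rfl | hx0
    · simp
    by_contra hcon
    have hx1 : 1 ≤ ‖x‖ := by exact_mod_cast not_lt.1 hcon
    rw [spectrum.mem_iff, Matrix.isUnit_iff_isUnit_det, isUnit_iff_ne_zero, not_not] at hx
    have h1 : charPoly (fun _ : Fin 1 => A) x⁻¹ = x⁻¹ • (algebraMap ℂ (Matrix n n ℂ) x - B) := by
      simp [charPoly, smul_sub, Algebra.algebraMap_eq_smul_one, smul_smul, hx0, hB]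
    have h2 := hA x⁻¹ (by rw [h1, det_smul, hx, mul_zero])
    rw [norm_inv] at h2
    exact absurd (inv_le_one_of_one_le₀ hx1) (not_le.2 h2)
  have hlim := spectrum.pow_nnnorm_pow_one_div_tendsto_nhds_spectralRadius B
  obtain ⟨r, hr1, hr2⟩ := exists_between hρ
  have hr : Tendsto (fun k : ℕ => r ^ k) atTop (𝓝 0) :=
    ENNReal.tendsto_pow_atTop_nhds_zero_of_lt_one hr2
  have hBk : Tendsto (fun k => (‖B ^ k‖₊ : ENNReal)) atTop (𝓝 0) := by
    refine tendsto_of_tendsto_of_tendsto_of_le_of_le' tendsto_const_nhds hr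
      (Eventually.of_forall fun k => zero_le) ?_
    filter_upwards [hlim.eventually (gt_mem_nhds hr1), eventually_gt_atTop 0] with k hk hk0
    calc (‖B ^ k‖₊ : ENNReal) = ((‖B ^ k‖₊ : ENNReal) ^ (1 / (k : ℝ))) ^ k := by
          rw [← ENNReal.rpow_natCast, ← ENNReal.rpow_mul, one_div,
            inv_mul_cancel₀ (by positivity), ENNReal.rpow_one]
      _ ≤ r ^ k := by gcongr
  have hB0 : Tendsto (fun k => B ^ k) atTop (𝓝 0) := by
    refine (tendsto_zero_iff_norm_tendsto_zero (E := Matrix n n ℂ)).2 ?_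
    have := (ENNReal.tendsto_toReal ENNReal.zero_ne_top).comp hBk
    exact this.congr fun k => by simp
  have hre := ((continuous_id.matrix_map Complex.continuous_re).tendsto (0 : Matrix n n ℂ)).comp hB0
  have h0 : (id (0 : Matrix n n ℂ)).map Complex.re = 0 := by ext; simp
  rw [h0] at hre
  refine hre.congr fun k => ?_
  have : B ^ k = (A ^ k).map Complex.ofRealHom := (Matrix.map_pow A Complex.ofRealHom k).symm
  ext i j
  simp [this]

lemma tendsto_zero_of_vfilter_one {A : Matrix n n ℝ} (hA : IsStable fun _ : Fin 1 => A)
    {z : ℕ → n → ℝ} {K : ℕ} (hz : ∀ t, K ≤ t → vfilter (fun _ : Fin 1 => A) z t = 0) :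
    Tendsto z atTop (𝓝 0) := by
  have h1 : ∀ j, z (K + j) = A ^ j *ᵥ z K := by
    intro j
    induction j with
    | zero => simp
    | succ j ih =>
      have h := hz (K + (j + 1)) (by omega)
      simp only [vfilter, Finset.univ_unique, Fin.default_eq_zero, Fin.val_zero, zero_add,
        Finset.sum_singleton, show 1 ≤ K + (j + 1) by omega, if_true,
        show K + (j + 1) - 1 = K + j by omega, ih, mulVec_mulVec, ← pow_succ'] at h
      exact sub_eq_zero.1 h
  have h2 : Tendsto (fun j => A ^ j *ᵥ z K) atTop (𝓝 (0 *ᵥ z K)) :=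
    ((continuous_id.matrix_mulVec continuous_const).tendsto (0 : Matrix n n ℝ)).comp
      (tendsto_norm_pow_of_isStable hA)
  rw [zero_mulVec] at h2
  rw [← tendsto_add_atTop_iff_nat K]
  exact h2.congr fun j => by rw [← h1, add_comm]

end Powers

section Companion

variable {m p : ℕ}

lemma companion_map_mulVec_zero {K : Type*} [CommRing K] (f : ℝ →+* K)
    (Φ : Fin p → Matrix (Fin m) (Fin m) ℝ) (v : Fin p × Fin m → K) {l : Fin p} (hl : (l : ℕ) = 0)
    (s : Fin m) :
    ((companion Φ).map f *ᵥ v) (l, s) =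
      ∑ l', ((Φ l').map f *ᵥ fun s' => v (l', s')) s := by
  simp [mulVec, dotProduct, Fintype.sum_prod_type, companion, hl]

lemma companion_map_mulVec_succ {K : Type*} [CommRing K] (f : ℝ →+* K)
    (Φ : Fin p → Matrix (Fin m) (Fin m) ℝ) (v : Fin p × Fin m → K) {l l' : Fin p}
    (hl : (l : ℕ) = l' + 1) (s : Fin m) :
    ((companion Φ).map f *ᵥ v) (l, s) = v (l', s) := by
  rw [mulVec, dotProduct, Finset.sum_eq_single (l', s)]
  · simp [companion, hl]
  · rintro ⟨j, s'⟩ _ hj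
    have : ¬ ((l' : ℕ) = j ∧ s = s') := by
      rintro ⟨h1, h2⟩
      exact hj (by rw [Prod.mk.injEq]; exact ⟨(Fin.ext h1).symm, h2.symm⟩)
    simp [companion, hl, this]
  · simp

/-- A vector killed by `I - z Φ̃` has blocks `z ^ k • v0`, by the identity blocks below the
diagonal. The first block row then says that `v0` is killed by `charPoly Φ z`, so the companion form
has no new roots. -/
lemma isStable_companion {Φ : Fin p → Matrix (Fin m) (Fin m) ℝ} (hΦ : IsStable Φ) :
    IsStable fun _ : Fin 1 => companion Φ := by
  intro z hz
  obtain ⟨v, hv0, hv⟩ := Matrix.exists_mulVec_eq_zero_iff.2 hz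
  have hv1 : v = z • ((companion Φ).map Complex.ofReal *ᵥ v) := by
    have : v - z • ((companion Φ).map Complex.ofReal *ᵥ v) = 0 := by
      simpa [charPoly, sub_mulVec, smul_mulVec] using hv
    exact sub_eq_zero.1 this
  have hp : 0 < p := by
    by_contra h
    obtain rfl : p = 0 := by omega
    exact hv0 (Subsingleton.elim _ _)
  set v0 : Fin m → ℂ := fun s => v (⟨0, hp⟩, s)
  have hpow : ∀ k (hk : k < p) s, v (⟨k, hk⟩, s) = z ^ k * v0 s := by
    intro k
    induction k with
    | zero => intro hk s; simp [v0]
    | succ k ih =>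
      intro hk s
      rw [hv1, Pi.smul_apply, smul_eq_mul]
      have := companion_map_mulVec_succ Complex.ofRealHom Φ v (l := ⟨k + 1, hk⟩)
        (l' := ⟨k, by omega⟩) rfl s
      rw [show ((companion Φ).map Complex.ofReal *ᵥ v) (⟨k + 1, hk⟩, s) = _ from this, ih]
      ring
  refine hΦ z (Matrix.exists_mulVec_eq_zero_iff.1 ⟨v0, fun h => hv0 ?_, ?_⟩)
  · ext ⟨l, s⟩
    rw [hpow l l.2 s, h]
    simp
  · rw [charPoly, sub_mulVec, one_mulVec, sub_eq_zero, sum_mulVec]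
    ext s
    have h1 : v0 s = z * ((companion Φ).map Complex.ofReal *ᵥ v) (⟨0, hp⟩, s) :=
      congrFun hv1 (⟨0, hp⟩, s)
    have h2 := companion_map_mulVec_zero Complex.ofRealHom Φ v (l := ⟨0, hp⟩) rfl s
    rw [h1, show ((companion Φ).map Complex.ofReal *ᵥ v) (⟨0, hp⟩, s) = _ from h2,
      Finset.sum_apply, Finset.mul_sum]
    refine Finset.sum_congr rfl fun l _ => ?_
    have h3 : (fun s' => v (l, s')) = z ^ (l : ℕ) • v0 := funext fun s' => hpow l l.2 s'
    rw [h3, mulVec_smul, smul_mulVec, Pi.smul_apply, Pi.smul_apply, smul_eq_mul, smul_eq_mul,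
      pow_succ]
    exact (mul_left_comm _ _ _).trans (mul_assoc _ _ _).symm

/-- The stacked vector `(y_t, …, y_{t-p+1})`, with zeros at negative times. -/
def stack (p : ℕ) {m : ℕ} (y : ℕ → Fin m → ℝ) (t : ℕ) (i : Fin p × Fin m) : ℝ :=
  if (i.1 : ℕ) ≤ t then y (t - i.1) i.2 else 0

/-- A vector placed in the first block, with zeros in the other blocks. -/
def firstBlock (p : ℕ) {m : ℕ} (v : Fin m → ℝ) (i : Fin p × Fin m) : ℝ :=
  if (i.1 : ℕ) = 0 then v i.2 else 0

/-- The stacked path is a VAR(1) path whose inputs live in the first block. The zero padding in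
`stack` agrees with the zero history in `vfilter`, so this holds from time `0` on. -/
lemma vfilter_stack (Φ : Fin p → Matrix (Fin m) (Fin m) ℝ) (y : ℕ → Fin m → ℝ) (t : ℕ) :
    vfilter (fun _ : Fin 1 => companion Φ) (stack p y) t = firstBlock p (vfilter Φ y t) := by
  ext ⟨l, s⟩
  have hid : (companion Φ) = (companion Φ).map (RingHom.id ℝ) := by ext; simp
  simp only [vfilter, Finset.univ_unique, Fin.default_eq_zero, Fin.val_zero, zero_add,
    Finset.sum_singleton, Pi.sub_apply, firstBlock]
  split_ifs with ht h0 h0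
  · rw [hid, companion_map_mulVec_zero _ _ _ h0, Finset.sum_apply]
    congr 1
    · simp [stack, h0]
    · refine Finset.sum_congr rfl fun l' _ => ?_
      have : (Φ l').map (RingHom.id ℝ) = Φ l' := by ext; simp
      rw [this]
      split_ifs with hl'
      · congr 1
        ext s'
        simp only [stack]
        rw [if_pos (by omega), show t - 1 - (l' : ℕ) = t - (l' + 1) by omega]
      · have h2 : (fun s' => stack p y (t - 1) (l', s')) = 0 := by
          ext s'
          simp only [stack]
          rw [if_neg (by omega)]
          rfl
        rw [h2, mulVec_zero]
  · obtain ⟨l', hl'⟩ : ∃ l' : Fin p, (l : ℕ) = l' + 1 :=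
      ⟨⟨l - 1, by omega⟩, by simp; omega⟩
    rw [hid, companion_map_mulVec_succ _ _ _ hl']
    simp only [stack, hl']
    split_ifs with h1 h2 h2
    · rw [show t - ((l' : ℕ) + 1) = t - 1 - l' by omega, sub_self]
    · omega
    · omega
    · simp
  · rw [Finset.sum_eq_zero fun (l' : Fin p) _ =>
      if_neg (show ¬ (l' : ℕ) + 1 ≤ t by omega)]
    simp [stack, h0]
  · simp only [stack]
    rw [if_neg (by omega)]
    simp

lemma firstBlock_dotProduct_self (hp : 0 < p) (v : Fin m → ℝ) :
    firstBlock p v ⬝ᵥ firstBlock p v = v ⬝ᵥ v := by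
  rw [dotProduct, Fintype.sum_prod_type, Finset.sum_eq_single ⟨0, hp⟩]
  · simp [firstBlock, dotProduct]
  · intro l _ hl
    have : (l : ℕ) ≠ 0 := fun h => hl (Fin.ext h)
    simp [firstBlock, this]
  · simp

variable {Φ : Fin p → Matrix (Fin m) (Fin m) ℝ}

lemma tendsto_stack_zero (hm : 0 < m) (hp : 0 < p) (hΦ : IsStable Φ) {y : ℕ → Fin m → ℝ} {K : ℕ}
    (hK : ∀ t, K ≤ t → vfilter Φ y t = 0) : Tendsto (stack p y) atTop (𝓝 0) := by
  have : Nonempty (Fin p × Fin m) := ⟨(⟨0, hp⟩, ⟨0, hm⟩)⟩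
  refine tendsto_zero_of_vfilter_one (isStable_companion hΦ) (K := K) fun t ht => ?_
  rw [vfilter_stack, hK t ht]
  ext
  simp [firstBlock]

lemma tendsto_zero_of_vfilter (hm : 0 < m) (hp : 0 < p) (hΦ : IsStable Φ) {y : ℕ → Fin m → ℝ}
    {K : ℕ} (hK : ∀ t, K ≤ t → vfilter Φ y t = 0) : Tendsto y atTop (𝓝 0) := by
  have h := tendsto_stack_zero hm hp hΦ hK
  rw [tendsto_pi_nhds] at h ⊢
  intro s
  refine (h (⟨0, hp⟩, s)).congr fun t => ?_
  simp [stack]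

lemma muMin_mul_sum_solve_le (hm : 0 < m) (hp : 0 < p) (hΦ : IsStable Φ) {y : ℕ → Fin m → ℝ}
    {K : ℕ} (hK : ∀ t, K ≤ t → vfilter Φ y t = 0) (M : ℕ) :
    muMin Φ * ∑ t ∈ Finset.range M, y t ⬝ᵥ y t ≤
      ∑ t ∈ Finset.range K, vfilter Φ y t ⬝ᵥ vfilter Φ y t := by
  have : Nonempty (Fin m) := ⟨⟨0, hm⟩⟩
  exact muMin_mul_sum_le Φ hK (tendsto_zero_of_vfilter hm hp hΦ hK) (muMin_pos hΦ).le M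

/-- Controls all lags jointly, hence every linear combination of regressors; this is the source of
`μ_min(Φ̃)` in `ω`. A single coordinate needs only `muMin_mul_sum_solve_le`, which is why `Q`
involves `μ_min(Φ)`. -/
lemma muMin_companion_mul_sum_stack_le (hm : 0 < m) (hp : 0 < p) (hΦ : IsStable Φ)
    {y : ℕ → Fin m → ℝ} {K : ℕ} (hK : ∀ t, K ≤ t → vfilter Φ y t = 0) (M : ℕ) :
    muMin (fun _ : Fin 1 => companion Φ) *
        ∑ t ∈ Finset.range M, stack p y t ⬝ᵥ stack p y t ≤
      ∑ t ∈ Finset.range K, vfilter Φ y t ⬝ᵥ vfilter Φ y t := by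
  have : Nonempty (Fin p × Fin m) := ⟨(⟨0, hp⟩, ⟨0, hm⟩)⟩
  have h := muMin_mul_sum_le (fun _ : Fin 1 => companion Φ) (y := stack p y) (K := K)
    (fun t ht => by rw [vfilter_stack, hK t ht]; ext; simp [firstBlock])
    (tendsto_stack_zero hm hp hΦ hK) (muMin_pos (isStable_companion hΦ)).le M
  simpa only [vfilter_stack, firstBlock_dotProduct_self hp] using h

end Companion

end SparseVAR

/-! ### Concentration of Gaussian quadratic forms. -/

namespace SparseVAR

section ChiSquare

/-- The multiplicative form of `-log (1 - v) ≤ v + v²`. -/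
lemma one_le_one_sub_mul_exp {v : ℝ} (hv : v ≤ 1 / 2) : 1 ≤ (1 - v) * Real.exp (v + v ^ 2) := by
  rcases le_total 0 v with h0 | h0
  · have h1 := Real.quadratic_le_exp_of_nonneg (x := v + v ^ 2) (by positivity)
    have h2 : v + v ^ 2 + v ^ 3 ≤ 1 := by nlinarith [mul_nonneg h0 h0, mul_nonneg h0 (sq_nonneg v)]
    calc (1 : ℝ) ≤ (1 - v) * (1 + (v + v ^ 2) + (v + v ^ 2) ^ 2 / 2) := by
          nlinarith [mul_nonneg (sq_nonneg v) (sub_nonneg.2 h2)]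
      _ ≤ _ := mul_le_mul_of_nonneg_left h1 (by linarith)
  · have h1 := Real.add_one_le_exp (v + v ^ 2)
    calc (1 : ℝ) ≤ (1 - v) * (v + v ^ 2 + 1) := by
          nlinarith [mul_nonneg (neg_nonneg.2 h0) (sq_nonneg v)]
      _ ≤ _ := mul_le_mul_of_nonneg_left h1 (by linarith)

lemma gaussianPDFReal_mul_exp (u x : ℝ) :
    gaussianPDFReal 0 1 x * Real.exp (u * (x ^ 2 - 1)) =
      (√(2 * Real.pi))⁻¹ * Real.exp (-u) * Real.exp (-(1 / 2 - u) * x ^ 2) := by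
  simp only [gaussianPDFReal, mul_assoc, ← Real.exp_add]
  congr 2
  · simp
  · simp
    ring

lemma integrable_exp_mul_sq_sub_one {u : ℝ} (hu : u ≤ 1 / 4) :
    Integrable (fun x => Real.exp (u * (x ^ 2 - 1))) (gaussianReal 0 1) := by
  rw [gaussianReal_of_var_ne_zero _ one_ne_zero, gaussianPDF_def]
  rw [integrable_withDensity_iff_integrable_smul' (by fun_prop) (by simp)]
  simp only [ENNReal.toReal_ofReal (gaussianPDFReal_nonneg _ _ _), smul_eq_mul,
    gaussianPDFReal_mul_exp]
  exact (integrable_exp_neg_mul_sq (by linarith)).const_mul _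

/-- The integral equals `(1 - 2u)^(-1/2) e^(-u)`, and the preceding inequality at `v = 2u` applies.
Negative `u` is allowed, so the same estimate serves the lower tail. -/
lemma integral_exp_mul_sq_sub_one_le {u : ℝ} (hu : u ≤ 1 / 4) :
    ∫ x, Real.exp (u * (x ^ 2 - 1)) ∂(gaussianReal 0 1) ≤ Real.exp (2 * u ^ 2) := by
  rw [integral_gaussianReal_eq_integral_smul one_ne_zero]
  simp only [smul_eq_mul, gaussianPDFReal_mul_exp]
  rw [integral_const_mul, integral_gaussian]
  have hpos : 0 < 1 - 2 * u := by linarith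
  have h1 : (√(2 * Real.pi))⁻¹ * √(Real.pi / (1 / 2 - u)) = √((1 - 2 * u)⁻¹) := by
    rw [← Real.sqrt_inv, ← Real.sqrt_mul (by positivity)]
    congr 1
    have : (1 / 2 - u) ≠ 0 := by linarith
    field_simp
  have h2 : √((1 - 2 * u)⁻¹) ≤ Real.exp (u + 2 * u ^ 2) := by
    rw [Real.sqrt_le_left (Real.exp_pos _).le, ← Real.exp_nat_mul, inv_le_iff_one_le_mul₀ hpos]
    have h := one_le_one_sub_mul_exp (v := 2 * u) (by linarith)
    rw [mul_comm] at h
    rw [show ((2 : ℕ) : ℝ) * (u + 2 * u ^ 2) = 2 * u + (2 * u) ^ 2 by push_cast; ring]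
    exact h
  calc _ = √((1 - 2 * u)⁻¹) * Real.exp (-u) := by rw [← h1]; ring
    _ ≤ Real.exp (u + 2 * u ^ 2) * Real.exp (-u) := by gcongr
    _ = _ := by rw [← Real.exp_add]; ring_nf

variable {ι : Type*} [Fintype ι]

/-- The standard Gaussian measure on `ι → ℝ`. -/
noncomputable abbrev stdNormal (ι : Type*) [Fintype ι] : Measure (ι → ℝ) :=
  Measure.pi fun _ => gaussianReal 0 1

lemma chiSquare_tail {lam : ι → ℝ} {κ N x : ℝ} (hκ : 0 < κ) (h0 : ∀ i, 0 ≤ lam i)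
    (h1 : ∀ i, lam i ≤ κ) (hN : ∑ i, lam i ≤ N * κ) (hx : 0 ≤ x) {σ : ℝ} (hσ : |σ| = 1) :
    (stdNormal ι).real {g | x * N * κ ≤ σ * ∑ i, lam i * (g i ^ 2 - 1)} ≤
      Real.exp (-(N * (x * min x 1) / 8)) := by
  -- The Chernoff parameter: `t κ ≤ 1/4` keeps every factor in the range of the moment bound, and
  -- the exponent becomes `-N x min(x,1)/4 + N min(x,1)²/8`.
  set t : ℝ := min x 1 / (4 * κ) with ht
  have hm0 : 0 ≤ min x 1 := le_min hx zero_le_one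
  have ht0 : 0 ≤ t := by positivity
  have htκ : t * κ = min x 1 / 4 := by rw [ht]; field_simp
  have hu : ∀ i, t * σ * lam i ≤ 1 / 4 := fun i => by
    have h2 : σ ≤ 1 := (le_abs_self σ).trans hσ.le
    calc t * σ * lam i = σ * (t * lam i) := by ring
      _ ≤ 1 * (t * κ) := by
        have := h1 i
        have := h0 i
        gcongr
      _ ≤ 1 / 4 := by rw [htκ]; linarith [min_le_right x 1]
  have hfun : (fun g : ι → ℝ => Real.exp (t * (σ * ∑ i, lam i * (g i ^ 2 - 1)))) =
      fun g => ∏ i, Real.exp (t * σ * lam i * (g i ^ 2 - 1)) := by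
    ext g
    rw [← Real.exp_sum, Finset.mul_sum, Finset.mul_sum]
    congr 1
    exact Finset.sum_congr rfl fun i _ => by ring
  have hint : Integrable (fun g : ι → ℝ => Real.exp (t * (σ * ∑ i, lam i * (g i ^ 2 - 1))))
      (stdNormal ι) := by
    rw [hfun]
    exact Integrable.fintype_prod (f := fun i y => Real.exp (t * σ * lam i * (y ^ 2 - 1)))
      fun i => integrable_exp_mul_sq_sub_one (hu i)
  refine (measure_ge_le_exp_mul_mgf _ ht0 hint).trans ?_
  have hmgf : mgf (fun g : ι → ℝ => σ * ∑ i, lam i * (g i ^ 2 - 1)) (stdNormal ι) t ≤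
      Real.exp (2 * t ^ 2 * κ * (N * κ)) := by
    rw [mgf, hfun, integral_fintype_prod_eq_prod
      (f := fun i y => Real.exp (t * σ * lam i * (y ^ 2 - 1)))]
    calc _ ≤ ∏ i, Real.exp (2 * (t * σ * lam i) ^ 2) :=
          Finset.prod_le_prod (fun i _ => integral_nonneg fun y => (Real.exp_pos _).le)
            fun i _ => integral_exp_mul_sq_sub_one_le (hu i)
      _ = Real.exp (2 * t ^ 2 * ∑ i, lam i ^ 2) := by
          rw [← Real.exp_sum, Finset.mul_sum]
          congr 1
          refine Finset.sum_congr rfl fun i _ => ?_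
          have : σ ^ 2 = 1 := by rw [← sq_abs, hσ, one_pow]
          rw [mul_pow, mul_pow, this]
          ring
      _ ≤ _ := by
          rw [mul_assoc (2 * t ^ 2)]
          refine Real.exp_le_exp.2 (mul_le_mul_of_nonneg_left ?_ (by positivity))
          calc ∑ i, lam i ^ 2 ≤ ∑ i, κ * lam i := Finset.sum_le_sum fun i _ => by
                rw [sq]; exact mul_le_mul_of_nonneg_right (h1 i) (h0 i)
            _ ≤ κ * (N * κ) := by
                rw [← Finset.mul_sum]; exact mul_le_mul_of_nonneg_left hN hκ.le
  calc _ ≤ Real.exp (-t * (x * N * κ)) * Real.exp (2 * t ^ 2 * κ * (N * κ)) := by gcongr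
    _ = Real.exp (-(t * κ) * x * N + 2 * (t * κ) ^ 2 * N) := by rw [← Real.exp_add]; ring_nf
    _ ≤ _ := by
      refine Real.exp_le_exp.2 ?_
      rw [htκ]
      have hN0 : 0 ≤ N := by
        have := (Finset.sum_nonneg fun i _ => h0 i).trans hN
        exact nonneg_of_mul_nonneg_left this hκ
      have : min x 1 ^ 2 ≤ x * min x 1 := by
        rw [sq]; exact mul_le_mul_of_nonneg_right (min_le_left _ _) hm0
      nlinarith [mul_le_mul_of_nonneg_left this hN0]

end ChiSquare

section Quadratic

variable {ι τ : Type*} [Fintype ι] [Fintype τ]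

/-- The squared Frobenius norm. -/
def frobSq (A : Matrix τ ι ℝ) : ℝ := ∑ i, A i ⬝ᵥ A i

/-- Testing the operator bound on a row of `A` shows that its squared norm is at most `κ`. The
result counts rows only; the number of columns, which grows with the burn-in, does not enter. -/
lemma frobSq_le {A : Matrix τ ι ℝ} {κ : ℝ} (hκ : 0 ≤ κ)
    (hA : ∀ g, (A *ᵥ g) ⬝ᵥ (A *ᵥ g) ≤ κ * (g ⬝ᵥ g)) : frobSq A ≤ Fintype.card τ * κ := by
  rw [frobSq, ← nsmul_eq_mul, ← Finset.card_univ]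
  refine Finset.sum_le_card_nsmul _ _ _ fun i _ => ?_
  have h1 : (A i ⬝ᵥ A i) ^ 2 ≤ κ * (A i ⬝ᵥ A i) := by
    refine le_trans ?_ (hA (A i))
    rw [sq]
    exact Finset.single_le_sum (f := fun j => (A *ᵥ A i) j * (A *ᵥ A i) j)
      (fun j _ => mul_self_nonneg _) (Finset.mem_univ i)
  have h0 : 0 ≤ A i ⬝ᵥ A i := dotProduct_star_self_nonneg _
  rcases h0.eq_or_lt with h | h
  · rw [← h]; exact hκ
  · rw [sq] at h1
    exact le_of_mul_le_mul_right h1 h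

lemma map_stdNormal_orthonormalBasis (b : OrthonormalBasis ι ℝ (EuclideanSpace ℝ ι)) :
    (stdNormal ι).map (fun x => (∑ i, x i • b i : EuclideanSpace ℝ ι).ofLp) = stdNormal ι := by
  have h1 : (stdNormal ι).map (WithLp.toLp 2) =
      (stdNormal ι).map (fun x => ∑ i, x i • b i) := by
    rw [map_pi_eq_stdGaussian, ← stdGaussian_eq_map_pi_orthonormalBasis b]
  have h2 := congrArg (Measure.map WithLp.ofLp) h1
  rw [Measure.map_map (by fun_prop) (by fun_prop), Measure.map_map (by fun_prop) (by fun_prop)]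
    at h2
  rw [show (fun x : ι → ℝ => (∑ i, x i • b i : EuclideanSpace ℝ ι).ofLp) =
    WithLp.ofLp ∘ fun x => ∑ i, x i • b i from rfl, ← h2]
  exact Measure.map_id

/-- Tail bound for Gaussian quadratic forms. -/
lemma gaussian_quadratic_tail [DecidableEq ι] (A : Matrix τ ι ℝ) {κ x : ℝ} (hκ : 0 < κ)
    (hA : ∀ g, (A *ᵥ g) ⬝ᵥ (A *ᵥ g) ≤ κ * (g ⬝ᵥ g)) (hx : 0 ≤ x) {σ : ℝ} (hσ : |σ| = 1) :
    (stdNormal ι).real {g | x * Fintype.card τ * κ ≤ σ * ((A *ᵥ g) ⬝ᵥ (A *ᵥ g) - frobSq A)} ≤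
      Real.exp (-(Fintype.card τ * (x * min x 1) / 8)) := by
  -- In an eigenbasis of `AᵀA` the form is a weighted sum of squares with weights in `[0, κ]`, and
  -- the standard normal law is invariant under this change of basis.
  have hC : (Aᵀ * A).IsHermitian := by
    simpa [conjTranspose_eq_transpose_of_trivial] using isHermitian_conjTranspose_mul_self A
  set b := hC.eigenvectorBasis
  set lam := hC.eigenvalues with hlam
  have hq : ∀ u v : ι → ℝ, (A *ᵥ u) ⬝ᵥ (A *ᵥ v) = u ⬝ᵥ ((Aᵀ * A) *ᵥ v) := fun u v => by
    rw [← mulVec_mulVec, dotProduct_mulVec u, vecMul_transpose]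
  have hb : ∀ i j, (b i).ofLp ⬝ᵥ (b j).ofLp = if i = j then 1 else 0 := fun i j => by
    have := orthonormal_iff_ite.1 b.orthonormal j i
    rw [EuclideanSpace.inner_eq_star_dotProduct] at this
    simpa [eq_comm] using this
  have hbl : ∀ i j, (A *ᵥ (b i).ofLp) ⬝ᵥ (A *ᵥ (b j).ofLp) = if i = j then lam j else 0 := by
    intro i j
    rw [hq, hC.mulVec_eigenvectorBasis, dotProduct_smul, hb]
    simp [hlam]
  have h0 : ∀ i, 0 ≤ lam i := fun i => by
    have := hbl i i
    rw [if_pos rfl] at this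
    rw [← this]
    exact dotProduct_star_self_nonneg _
  have h1 : ∀ i, lam i ≤ κ := fun i => by
    have h2 := hA (b i).ofLp
    rwa [hbl, hb, if_pos rfl, if_pos rfl, mul_one] at h2
  have htr : frobSq A = ∑ i, lam i := by
    have h2 : (Aᵀ * A).trace = ∑ i, lam i := by simpa using hC.trace_eq_sum_eigenvalues
    rw [← h2, Matrix.trace_mul_comm]
    rfl
  have hdiag : ∀ g : ι → ℝ, (A *ᵥ (∑ i, g i • b i : EuclideanSpace ℝ ι).ofLp) ⬝ᵥ
      (A *ᵥ (∑ i, g i • b i : EuclideanSpace ℝ ι).ofLp) - frobSq A =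
      ∑ i, lam i * (g i ^ 2 - 1) := by
    intro g
    have h2 : A *ᵥ (∑ i, g i • b i : EuclideanSpace ℝ ι).ofLp =
        ∑ i, g i • (A *ᵥ (b i).ofLp) := by
      rw [WithLp.ofLp_sum, mulVec_sum]
      exact Finset.sum_congr rfl fun i _ => by rw [WithLp.ofLp_smul, mulVec_smul]
    rw [h2, sum_dotProduct, htr, ← Finset.sum_sub_distrib]
    refine Finset.sum_congr rfl fun i _ => ?_
    rw [dotProduct_sum, Finset.sum_eq_single i]
    · rw [smul_dotProduct, dotProduct_smul, hbl, if_pos rfl, smul_eq_mul, smul_eq_mul]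
      ring
    · intro j _ hj
      rw [smul_dotProduct, dotProduct_smul, hbl, if_neg hj.symm, smul_zero, smul_zero]
    · simp
  have hmeas : MeasurableSet {g : ι → ℝ | x * Fintype.card τ * κ ≤
      σ * ((A *ᵥ g) ⬝ᵥ (A *ᵥ g) - frobSq A)} := by
    refine measurableSet_le measurable_const (Continuous.measurable ?_)
    have : Continuous fun g : ι → ℝ => A *ᵥ g := continuous_const.matrix_mulVec continuous_id
    exact continuous_const.mul ((this.dotProduct this).sub continuous_const)
  have hmap := map_stdNormal_orthonormalBasis b
  have hmb : Measurable fun g : ι → ℝ => (∑ i, g i • b i : EuclideanSpace ℝ ι).ofLp := by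
    fun_prop
  calc _ = (stdNormal ι).real {g | x * Fintype.card τ * κ ≤
          σ * ∑ i, lam i * (g i ^ 2 - 1)} := by
        conv_lhs => rw [← hmap]
        rw [map_measureReal_apply hmb hmeas]
        congr 1
        ext g
        simp only [Set.mem_preimage, Set.mem_ofPred_eq, hdiag]
    _ ≤ _ := chiSquare_tail hκ h0 h1 (by rw [← htr]; exact frobSq_le hκ.le hA) hx hσ

end Quadratic

end SparseVAR

/-! ### Maurey's method, the restricted eigenvalue bound and the deviation bound. -/

namespace SparseVAR

section Maurey

variable {J : Type*} [Fintype J]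

lemma exists_le_of_weighted_sum_le {w G : J → ℝ} {c : ℝ} (hw : ∀ j, 0 ≤ w j) (hw1 : ∑ j, w j = 1)
    (h : ∑ j, w j * G j ≤ c) : ∃ j, G j ≤ c := by
  by_contra! hcon
  have h1 : ∑ j, w j * (G j - c) ≤ 0 := by
    simp only [mul_sub, Finset.sum_sub_distrib, ← Finset.sum_mul, hw1]
    linarith
  have h2 : ∀ j ∈ Finset.univ, 0 ≤ w j * (G j - c) := fun j _ =>
    mul_nonneg (hw j) (sub_nonneg.2 (hcon j).le)
  have h3 := (Finset.sum_eq_zero_iff_of_nonneg h2).1 (le_antisymm h1 (Finset.sum_nonneg h2))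
  have h4 : ∀ j, w j = 0 := fun j =>
    (mul_eq_zero.1 (h3 j (Finset.mem_univ j))).resolve_right (sub_pos.2 (hcon j)).ne'
  simp [h4] at hw1

/-- Derandomized empirical method of Maurey: some sum of `n` atoms does at most as well as the
expectation of a sum of `n` independent atoms with mean `v`. -/
lemma exists_sum_atoms_le {E : Type*} [AddCommGroup E] [Module ℝ E] (B : E →ₗ[ℝ] E →ₗ[ℝ] ℝ)
    {w : J → ℝ} (hw : ∀ j, 0 ≤ w j) (hw1 : ∑ j, w j = 1) (z : J → E) {v : E}
    (hv : ∑ j, w j • z j = v) (n : ℕ) (a : E) :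
    ∃ f : Fin n → J, B (a + ∑ i, z (f i)) (a + ∑ i, z (f i)) ≤
      B a a + n * (B a v + B v a) + n * (n - 1) * B v v + n * ∑ j, w j * B (z j) (z j) := by
  induction n generalizing a with
  | zero => exact ⟨Fin.elim0, by simp⟩
  | succ n ih =>
    have hav : ∀ u, ∑ j, w j * B u (z j) = B u v := fun u => by
      rw [← hv, map_sum]
      simp
    have hva : ∀ u, ∑ j, w j * B (z j) u = B v u := fun u => by
      rw [← hv, map_sum, LinearMap.sum_apply]
      simp
    set D := ∑ j, w j * B (z j) (z j) with hD
    -- Conditional expectations: the `w`-average over `j` of the bound for `n` further atoms started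
    -- at `a + z j` equals the bound for `n + 1` atoms started at `a`, so some `j` does not exceed
    -- it.
    obtain ⟨j, hj⟩ := exists_le_of_weighted_sum_le hw hw1 (G := fun j =>
      B (a + z j) (a + z j) + n * (B (a + z j) v + B v (a + z j)) + n * (n - 1) * B v v + n * D)
      (c := B a a + (n + 1) * (B a v + B v a) + (n + 1) * n * B v v + (n + 1) * D) (by
        have h1 : ∀ j, w j * (B (a + z j) (a + z j) + n * (B (a + z j) v + B v (a + z j)) +
            n * (n - 1) * B v v + n * D) =
            w j * (B a a + n * (B a v + B v a) + n * (n - 1) * B v v + n * D) +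
            w j * B a (z j) + w j * B (z j) a + w j * B (z j) (z j) + n * (w j * B (z j) v) +
            n * (w j * B v (z j)) := fun j => by
          simp only [map_add, LinearMap.add_apply]
          ring
        simp only [h1, Finset.sum_add_distrib, ← Finset.mul_sum, ← Finset.sum_mul, hw1, hav, hva,
          ← hD]
        exact le_of_eq (by ring))
    obtain ⟨f, hf⟩ := ih (a + z j)
    refine ⟨Fin.cons j f, ?_⟩
    rw [Fin.sum_univ_succ]
    simp only [Fin.cons_zero, Fin.cons_succ, ← add_assoc]
    refine hf.trans (hj.trans (le_of_eq ?_))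
    push_cast
    ring

variable [DecidableEq J]

/-- The sum of signed coordinate vectors. -/
def signedSum {n : ℕ} (f : Fin n → J × Bool) : J → ℝ :=
  ∑ i, Pi.single (f i).1 (if (f i).2 then 1 else -1)

/-- Write `v` as the mean of the atoms `ℓ • (± e_j)` with weights `|v j| / ℓ`, where `ℓ` is the l₁
norm. Some sum of `n + 1` atoms has form at most `(n + 1) n vᵀMv + (n + 1) b ℓ²`. Such a sum is `ℓ`
times a signed sum, so this is nonnegative; divide by `n + 1`. -/
lemma quadForm_lower_of_signedSum {M : Matrix J J ℝ} {b : ℝ} {n : ℕ}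
    (h : ∀ f : Fin (n + 1) → J × Bool, 0 ≤ signedSum f ⬝ᵥ (M *ᵥ signedSum f))
    (hb : ∀ j, M j j ≤ b) (v : J → ℝ) :
    -(b * (∑ j, |v j|) ^ 2) ≤ n * (v ⬝ᵥ (M *ᵥ v)) := by
  set ℓ := ∑ j, |v j| with hℓ
  have hℓ0 : 0 ≤ ℓ := Finset.sum_nonneg fun j _ => abs_nonneg _
  rcases hℓ0.eq_or_lt with h0 | hpos
  · have hv : v = 0 := by
      ext j
      have := (Finset.sum_eq_zero_iff_of_nonneg fun j _ => abs_nonneg (v j)).1 h0.symm j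
        (Finset.mem_univ j)
      simpa using this
    rw [← h0, hv]
    simp
  let sg : J → Bool := fun j => decide (0 ≤ v j)
  let z : J → J → ℝ := fun j => ℓ • Pi.single j (if sg j then 1 else -1)
  have hsg : ∀ j, |v j| * (if sg j then 1 else -1) = v j := fun j => by
    by_cases hj : 0 ≤ v j
    · simp [sg, hj, abs_of_nonneg]
    · simp [sg, hj, abs_of_neg (not_le.1 hj)]
  have hz : ∑ j, (|v j| / ℓ) • z j = v := by
    have h1 : ∀ j, (|v j| / ℓ) • z j = Pi.single j (v j) := fun j => by
      simp only [z, smul_smul]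
      rw [div_mul_cancel₀ _ hpos.ne', ← Pi.single_smul, smul_eq_mul, hsg]
    simp only [h1]
    exact Finset.univ_sum_single v
  obtain ⟨f, hf⟩ := exists_sum_atoms_le (Matrix.toLinearMap₂' ℝ M) (w := fun j => |v j| / ℓ)
    (fun j => by positivity) (by rw [← Finset.sum_div, ← hℓ, div_self hpos.ne']) z hz (n + 1) 0
  have hu : ∑ i, z (f i) = ℓ • signedSum fun i => (f i, sg (f i)) := by
    simp only [z, signedSum, Finset.smul_sum]
  have hD : ∀ j, (Matrix.toLinearMap₂' ℝ M) (z j) (z j) = ℓ ^ 2 * M j j := fun j => by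
    simp only [z, Matrix.toLinearMap₂'_apply', smul_dotProduct, mulVec_smul, dotProduct_smul,
      smul_eq_mul, single_dotProduct, mulVec_single]
    split_ifs <;> simp <;> ring
  rw [zero_add, hu] at hf
  simp only [hD, map_zero, LinearMap.zero_apply, add_zero, mul_zero, zero_add,
    Matrix.toLinearMap₂'_apply', mulVec_smul, smul_dotProduct, dotProduct_smul, smul_eq_mul] at hf
  have h1 : 0 ≤ ℓ * (ℓ * ((signedSum fun i => (f i, sg (f i))) ⬝ᵥ
      (M *ᵥ signedSum fun i => (f i, sg (f i))))) :=
    mul_nonneg hℓ0 (mul_nonneg hℓ0 (h _))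
  have h2 : ∑ j, |v j| / ℓ * (ℓ ^ 2 * M j j) ≤ b * ℓ ^ 2 := by
    have h3 : ∀ j, |v j| / ℓ * (ℓ ^ 2 * M j j) = ℓ * (|v j| * M j j) := fun j => by
      field_simp
    simp only [h3, ← Finset.mul_sum]
    calc ℓ * ∑ j, |v j| * M j j ≤ ℓ * ∑ j, |v j| * b := by
          gcongr with j
          exact hb j
      _ = b * ℓ ^ 2 := by rw [← Finset.sum_mul, ← hℓ]; ring
  push_cast at hf
  have h4 : 0 ≤ ((n : ℝ) + 1) * (n * (v ⬝ᵥ (M *ᵥ v)) + b * ℓ ^ 2) := by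
    refine (h1.trans hf).trans ?_
    have := mul_le_mul_of_nonneg_left h2 (by positivity : (0 : ℝ) ≤ (n : ℝ) + 1)
    linarith
  linarith [nonneg_of_mul_nonneg_right h4 (by positivity)]

end Maurey

section RestrictedEigenvalue

variable {ι τ J : Type*} [Fintype ι] [DecidableEq ι] [Fintype τ] [Fintype J]

/-- The matrix whose rows send the noise `g` to the inner products of `u` with `R i *ᵥ g`. -/
def rowProj (R : τ → Matrix J ι ℝ) (u : J → ℝ) : Matrix τ ι ℝ := fun i => u ᵥ* R i

lemma rowProj_mulVec (R : τ → Matrix J ι ℝ) (u : J → ℝ) (g : ι → ℝ) (i : τ) :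
    (rowProj R u *ᵥ g) i = u ⬝ᵥ (R i *ᵥ g) := by
  rw [dotProduct_mulVec]
  rfl

lemma rowProj_tail {R : τ → Matrix J ι ℝ} {κ α : ℝ} (hα : 0 < α) (hακ : α ≤ κ)
    (hκ : ∀ u g, (rowProj R u *ᵥ g) ⬝ᵥ (rowProj R u *ᵥ g) ≤ κ * (u ⬝ᵥ u) * (g ⬝ᵥ g))
    (u : J → ℝ) {σ : ℝ} (hσ : |σ| = 1) :
    (stdNormal ι).real {g | Fintype.card τ * (α * (u ⬝ᵥ u)) <
        σ * ((rowProj R u *ᵥ g) ⬝ᵥ (rowProj R u *ᵥ g) - frobSq (rowProj R u))} ≤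
      Real.exp (-(Fintype.card τ * (α / κ) ^ 2 / 8)) := by
  have hκ0 : 0 < κ := hα.trans_le hακ
  -- The scale `κ * (u ⬝ᵥ u)` must be positive for the tail bound; at `u = 0` the strict inequality
  -- makes the event empty.
  rcases eq_or_ne u 0 with rfl | hu
  · have : rowProj R 0 = 0 := by ext; simp [rowProj]
    simp [this, frobSq, show ∀ x : τ, (0 : Matrix τ ι ℝ) x = 0 from fun _ => rfl,
      Real.exp_nonneg]
  have hpos : 0 < u ⬝ᵥ u := by
    have h : 0 ≤ u ⬝ᵥ u := dotProduct_star_self_nonneg u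
    exact h.lt_of_ne fun h0 => hu (dotProduct_self_eq_zero.1 h0.symm)
  have hx : α / κ ≤ 1 := (div_le_one hκ0).2 hακ
  have h := gaussian_quadratic_tail (rowProj R u) (x := α / κ) (mul_pos hκ0 hpos) (hκ u)
    (by positivity) hσ
  rw [min_eq_left hx, ← sq] at h
  refine le_trans (measureReal_mono fun g hg => ?_) h
  refine le_trans (le_of_eq ?_) (le_of_lt (Set.mem_ofPred_eq ▸ hg))
  field_simp

variable [DecidableEq J]

/-- Restricted eigenvalue condition for a Gaussian design with dependent rows. -/
lemma restrictedEigenvalue_prob [Nonempty τ] {R : τ → Matrix J ι ℝ} {κ α : ℝ} (hα : 0 < α)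
    (hακ : α ≤ κ)
    (hκ : ∀ u g, (rowProj R u *ᵥ g) ⬝ᵥ (rowProj R u *ᵥ g) ≤ κ * (u ⬝ᵥ u) * (g ⬝ᵥ g))
    (hlow : ∀ u i, 2 * α * (u ⬝ᵥ u) ≤ (u ᵥ* R i) ⬝ᵥ (u ᵥ* R i)) {n : ℕ} (hn : 0 < n) :
    (stdNormal ι).real {g | ∀ v, α * (v ⬝ᵥ v) - 2 * α / n * (∑ j, |v j|) ^ 2 ≤
        (Fintype.card τ : ℝ)⁻¹ * ((rowProj R v *ᵥ g) ⬝ᵥ (rowProj R v *ᵥ g))}ᶜ ≤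
      ((2 * Fintype.card J) ^ (n + 1) + Fintype.card J) *
        Real.exp (-(Fintype.card τ * (α / κ) ^ 2 / 8)) := by
  set N : ℝ := (Fintype.card τ : ℝ) with hN
  have hN0 : 0 < N := by rw [hN]; exact_mod_cast Fintype.card_pos
  let Ev : ℝ → (J → ℝ) → Set (ι → ℝ) := fun σ u => {g | N * (α * (u ⬝ᵥ u)) <
        σ * ((rowProj R u *ᵥ g) ⬝ᵥ (rowProj R u *ᵥ g) - frobSq (rowProj R u))}
  have hsub : {g | ∀ v, α * (v ⬝ᵥ v) - 2 * α / n * (∑ j, |v j|) ^ 2 ≤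
        N⁻¹ * ((rowProj R v *ᵥ g) ⬝ᵥ (rowProj R v *ᵥ g))}ᶜ ⊆
      (⋃ f : Fin (n + 1) → J × Bool, Ev (-1) (signedSum f)) ∪
        ⋃ j : J, Ev 1 (Pi.single j 1) := by
    rw [Set.compl_subset_comm]
    intro g hg v
    simp only [Set.mem_compl_iff, Set.mem_union, Set.mem_iUnion, not_or, not_exists,
      Ev, Set.mem_ofPred_eq, not_lt] at hg
    obtain ⟨hg1, hg2⟩ := hg
    -- The centred Gram matrix plus `α I`. Lower tails give nonnegativity at signed sums, and upper
    -- tails at coordinate vectors bound the diagonal by `2α`. As the mean form is at least `2α (v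
    -- ⬝ᵥ v)`, undoing the centring and the shift leaves `α (v ⬝ᵥ v)`.
    let M : Matrix J J ℝ := N⁻¹ • ∑ i, (vecMulVec (R i *ᵥ g) (R i *ᵥ g) - R i * (R i)ᵀ) +
      α • (1 : Matrix J J ℝ)
    have hM : ∀ u, u ⬝ᵥ (M *ᵥ u) = N⁻¹ * ((rowProj R u *ᵥ g) ⬝ᵥ (rowProj R u *ᵥ g) -
        frobSq (rowProj R u)) + α * (u ⬝ᵥ u) := by
      intro u
      simp only [M, add_mulVec, smul_mulVec, one_mulVec, dotProduct_add, dotProduct_smul,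
        smul_eq_mul, sum_mulVec, dotProduct_sum, sub_mulVec, dotProduct_sub]
      congr 2
      rw [frobSq, dotProduct, ← Finset.sum_sub_distrib]
      refine Finset.sum_congr rfl fun i _ => ?_
      congr 1
      · rw [rowProj_mulVec, vecMulVec_mulVec, dotProduct_smul, dotProduct_comm (R i *ᵥ g) u]
        simp
      · rw [← mulVec_mulVec, dotProduct_mulVec, mulVec_transpose]
        rfl
    have h1 : ∀ f : Fin (n + 1) → J × Bool, 0 ≤ signedSum f ⬝ᵥ (M *ᵥ signedSum f) := by
      intro f
      have h := hg1 f
      rw [hM]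
      have h2 : N⁻¹ * (-1 * ((rowProj R (signedSum f) *ᵥ g) ⬝ᵥ (rowProj R (signedSum f) *ᵥ g) -
        frobSq (rowProj R (signedSum f)))) ≤ N⁻¹ * (N * (α * (signedSum f ⬝ᵥ signedSum f))) := by
        gcongr
      rw [inv_mul_cancel_left₀ hN0.ne'] at h2
      linarith
    have h2 : ∀ j, M j j ≤ 2 * α := by
      intro j
      have h := hg2 j
      have h3 : M j j = (Pi.single j 1 : J → ℝ) ⬝ᵥ (M *ᵥ Pi.single j 1) := by simp
      rw [h3, hM]
      have h2 : N⁻¹ * (1 * ((rowProj R (Pi.single j 1) *ᵥ g) ⬝ᵥ (rowProj R (Pi.single j 1) *ᵥ g) -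
        frobSq (rowProj R (Pi.single j 1)))) ≤
          N⁻¹ * (N * (α * ((Pi.single j 1 : J → ℝ) ⬝ᵥ Pi.single j 1))) := by
        gcongr
      rw [inv_mul_cancel_left₀ hN0.ne'] at h2
      have h4 : (Pi.single j 1 : J → ℝ) ⬝ᵥ Pi.single j 1 = 1 := by simp
      rw [h4] at h2 ⊢
      linarith
    have h3 := quadForm_lower_of_signedSum h1 h2 v
    rw [hM] at h3
    have h5 : N * (2 * α * (v ⬝ᵥ v)) ≤ frobSq (rowProj R v) := by
      rw [frobSq, hN, ← nsmul_eq_mul, ← Finset.card_univ]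
      exact Finset.card_nsmul_le_sum _ _ _ fun i _ => hlow v i
    have h6 : 2 * α * (v ⬝ᵥ v) ≤ N⁻¹ * frobSq (rowProj R v) := by
      rw [← inv_mul_cancel_left₀ hN0.ne' (2 * α * (v ⬝ᵥ v))]
      gcongr
    have hn0 : (0 : ℝ) < n := by exact_mod_cast hn
    have h7 : -(2 * α / n * (∑ j, |v j|) ^ 2) ≤ N⁻¹ * ((rowProj R v *ᵥ g) ⬝ᵥ (rowProj R v *ᵥ g) -
        frobSq (rowProj R v)) + α * (v ⬝ᵥ v) := by
      refine le_of_mul_le_mul_left (le_trans (le_of_eq ?_) h3) hn0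
      field_simp
    rw [mul_sub] at h7
    linarith
  refine (measureReal_mono hsub).trans ((measureReal_union_le _ _).trans ?_)
  rw [add_mul]
  refine add_le_add ((measureReal_iUnion_fintype_le _).trans ?_)
    ((measureReal_iUnion_fintype_le _).trans ?_)
  · refine (Finset.sum_le_card_nsmul _ _ _ fun f _ =>
      rowProj_tail hα hακ hκ (signedSum f) (σ := -1) (by simp)).trans (le_of_eq ?_)
    rw [nsmul_eq_mul]
    simp [mul_comm, hN]
  · refine (Finset.sum_le_card_nsmul _ _ _ fun f _ =>
      rowProj_tail hα hακ hκ (Pi.single f 1) (σ := 1) (by simp)).trans (le_of_eq ?_)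
    rw [nsmul_eq_mul]
    simp [hN]

end RestrictedEigenvalue

section Deviation

variable {ι τ : Type*} [Fintype ι] [DecidableEq ι] [Fintype τ]

/-- Tail bound for the sum of products of two Gaussian sequences which are uncorrelated at equal
times. -/
lemma gaussian_product_tail {A B : Matrix τ ι ℝ} {κ κ' x : ℝ} (hκ : 0 < κ + κ')
    (hA : ∀ g, (A *ᵥ g) ⬝ᵥ (A *ᵥ g) ≤ κ * (g ⬝ᵥ g))
    (hB : ∀ g, (B *ᵥ g) ⬝ᵥ (B *ᵥ g) ≤ κ' * (g ⬝ᵥ g)) (hAB : ∀ i, A i ⬝ᵥ B i = 0)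
    (hx : 0 ≤ x) (hx1 : x ≤ 1) :
    (stdNormal ι).real {g | x * Fintype.card τ * (κ + κ') < |(A *ᵥ g) ⬝ᵥ (B *ᵥ g)|} ≤
      4 * Real.exp (-(Fintype.card τ * x ^ 2 / 8)) := by
  -- Polarization: `4 ⟨Ag, Bg⟩ = ‖(A + B) g‖² - ‖(A - B) g‖²`, with both operator bounds from `‖a ±
  -- b‖² ≤ 2‖a‖² + 2‖b‖²`.
  have hbound : ∀ σ : ℝ, |σ| = 1 → ∀ g, ((A + σ • B) *ᵥ g) ⬝ᵥ ((A + σ • B) *ᵥ g) ≤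
      2 * (κ + κ') * (g ⬝ᵥ g) := by
    intro σ hσ g
    have h1 := hA g
    have h2 := hB g
    have hσ2 : σ ^ 2 = 1 := by rw [← sq_abs, hσ, one_pow]
    have h3 : (0 : ℝ) ≤ ((A *ᵥ g) - σ • (B *ᵥ g)) ⬝ᵥ ((A *ᵥ g) - σ • (B *ᵥ g)) :=
      dotProduct_star_self_nonneg _
    simp only [add_mulVec, smul_mulVec, dotProduct_add, add_dotProduct, smul_dotProduct,
      dotProduct_smul, smul_eq_mul, sub_dotProduct, dotProduct_sub,
      dotProduct_comm (B *ᵥ g) (A *ᵥ g), mul_add, mul_sub] at h3 ⊢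
    have h4 : σ * (σ * ((B *ᵥ g) ⬝ᵥ (B *ᵥ g))) = (B *ᵥ g) ⬝ᵥ (B *ᵥ g) := by
      rw [← mul_assoc, ← sq, hσ2, one_mul]
    rw [h4] at h3 ⊢
    linarith
  -- Orthogonality of corresponding rows makes the two expectations equal, so they cancel in the
  -- difference.
  have hfrob : ∀ σ : ℝ, |σ| = 1 → frobSq (A + σ • B) = frobSq A + frobSq B := by
    intro σ hσ
    have hσ2 : σ ^ 2 = 1 := by rw [← sq_abs, hσ, one_pow]
    rw [frobSq, frobSq, frobSq, ← Finset.sum_add_distrib]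
    refine Finset.sum_congr rfl fun i _ => ?_
    have h1 : (A + σ • B) i = A i + σ • B i := rfl
    rw [h1]
    simp only [dotProduct_add, add_dotProduct, smul_dotProduct, dotProduct_smul, smul_eq_mul,
      dotProduct_comm (B i) (A i), hAB i, mul_zero, add_zero]
    linear_combination (B i ⬝ᵥ B i) * hσ2
  let Ev : ℝ → ℝ → Set (ι → ℝ) := fun σ ρ => {g | x * Fintype.card τ * (2 * (κ + κ')) ≤
    ρ * (((A + σ • B) *ᵥ g) ⬝ᵥ ((A + σ • B) *ᵥ g) - frobSq (A + σ • B))}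
  have hev : ∀ σ ρ : ℝ, |σ| = 1 → |ρ| = 1 → (stdNormal ι).real (Ev σ ρ) ≤
      Real.exp (-(Fintype.card τ * x ^ 2 / 8)) := by
    intro σ ρ hσ hρ
    have h := gaussian_quadratic_tail (A + σ • B) (by positivity : 0 < 2 * (κ + κ')) (hbound σ hσ)
      hx hρ
    rwa [min_eq_left hx1, ← sq] at h
  have hsub : {g | x * Fintype.card τ * (κ + κ') < |(A *ᵥ g) ⬝ᵥ (B *ᵥ g)|} ⊆
      (Ev 1 1 ∪ Ev 1 (-1)) ∪ (Ev (-1) 1 ∪ Ev (-1) (-1)) := by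
    intro g hg
    by_contra hcon
    simp only [Set.mem_union, not_or, Ev, Set.mem_ofPred_eq, not_le, hfrob 1 (by simp),
      hfrob (-1) (by simp), add_mulVec, smul_mulVec, dotProduct_add, add_dotProduct,
      smul_dotProduct, dotProduct_smul, smul_eq_mul, dotProduct_comm (B *ᵥ g) (A *ᵥ g)] at hcon
    obtain ⟨⟨h1, h2⟩, h3, h4⟩ := hcon
    rw [Set.mem_ofPred_eq, lt_abs] at hg
    rcases hg with hg | hg <;> linarith
  refine (measureReal_mono hsub).trans ((measureReal_union_le _ _).trans ?_)
  have h1 := (measureReal_union_le (μ := stdNormal ι) (Ev 1 1) (Ev 1 (-1)))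
  have h2 := (measureReal_union_le (μ := stdNormal ι) (Ev (-1) 1) (Ev (-1) (-1)))
  linarith [hev 1 1 (by simp) (by simp), hev 1 (-1) (by simp) (by simp),
    hev (-1) 1 (by simp) (by simp), hev (-1) (-1) (by simp) (by simp)]

end Deviation

end SparseVAR

/-! ### The deterministic lasso argument and the block structure of the least-squares problem. -/

namespace SparseVAR

section Lasso

variable {ι : Type*} [Fintype ι]

lemma l2Norm_eq_sqrt (v : ι → ℝ) : l2Norm v = √(v ⬝ᵥ v) := by
  simp [l2Norm, dotProduct, sq]

lemma dotProduct_le_mul_l1Norm {v d : ι → ℝ} {a : ℝ} (hd : ∀ j, |d j| ≤ a) :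
    v ⬝ᵥ d ≤ a * l1Norm v := by
  rw [l1Norm, Finset.mul_sum]
  refine Finset.sum_le_sum fun j _ => ?_
  calc v j * d j ≤ |v j * d j| := le_abs_self _
    _ = |d j| * |v j| := by rw [abs_mul, mul_comm]
    _ ≤ a * |v j| := by gcongr; exact hd j

lemma ncard_mul_le_sum {s : Set ι} {t : Finset ι} {v : ι → ℝ} {c : ℝ} (hst : ∀ j ∈ s, j ∈ t)
    (hc : ∀ j ∈ s, c ≤ |v j|) : s.ncard * c ≤ ∑ j ∈ t, |v j| := by
  classical
  rw [Set.ncard_eq_toFinset_card' s, ← nsmul_eq_mul]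
  refine (Finset.card_nsmul_le_sum _ _ _ fun j hj => hc j (by simpa using hj)).trans ?_
  exact Finset.sum_le_sum_of_subset_of_nonneg (fun j hj => hst j (by simpa using hj))
    fun j _ _ => abs_nonneg _

/-- Deterministic error bounds for the weighted `l₁` penalized quadratic program. -/
lemma weighted_lasso_bounds {G : Matrix ι ι ℝ} (hG : G.IsSymm) {γ βs βh w : ι → ℝ}
    {r s₀ lam α τ : ℝ} (hw0 : ∀ j, 0 ≤ w j)
    (hw : ∀ j, βs j = 0 → 1 ≤ w j) (hwr : ∀ j, βs j ≠ 0 → w j ≤ r)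
    (hr : 0 ≤ r) (hs₀ : 0 < s₀) (hs : ∀ j, βs j ≠ 0 → s₀ ≤ |βs j|) (hα : 0 < α) (hlam : 0 < lam)
    (hpsd : ∀ v, 0 ≤ v ⬝ᵥ (G *ᵥ v)) (hτ : 0 ≤ τ)
    (hRE : ∀ v, α * (v ⬝ᵥ v) - τ * l1Norm v ^ 2 ≤ v ⬝ᵥ (G *ᵥ v))
    (hτk : 4 * (1 + r) ^ 2 * (Function.support βs).ncard * τ ≤ α / 2)
    (hdev : ∀ j, |(γ - G *ᵥ βs) j| ≤ lam / 4)
    (hopt : -2 * (βh ⬝ᵥ γ) + βh ⬝ᵥ (G *ᵥ βh) + lam * ∑ j, w j * |βh j| ≤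
      -2 * (βs ⬝ᵥ γ) + βs ⬝ᵥ (G *ᵥ βs) + lam * ∑ j, w j * |βs j|) :
    l2Norm (βh - βs) ≤ (1 + 2 * r) / α * √((Function.support βs).ncard) * lam ∧
    l1Norm (βh - βs) ≤ (2 + 6 * r + 4 * r ^ 2) / α * (Function.support βs).ncard * lam ∧
    (βh - βs) ⬝ᵥ (G *ᵥ (βh - βs)) ≤
      (1 + 2 * r) ^ 2 / (2 * α) * (Function.support βs).ncard * lam ^ 2 ∧
    ((Function.support βs \ Function.support βh).ncard : ℝ) ≤
      (2 + 6 * r + 4 * r ^ 2) / (s₀ * α) * (Function.support βs).ncard * lam ∧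
    ((Function.support (hardThreshold lam βh) \ Function.support βs).ncard : ℝ) ≤
      (1 + 2 * r) ^ 2 * ((Function.support βs).ncard / α) := by
  classical
  set k : ℝ := ((Function.support βs).ncard : ℝ) with hk
  have hk0 : 0 ≤ k := Nat.cast_nonneg _
  set v := βh - βs with hv
  have hβh : βh = βs + v := by rw [hv]; abel
  set J : Finset ι := Finset.univ.filter fun j => βs j ≠ 0 with hJ
  have hkJ : k = J.card := by
    rw [hk, Set.ncard_eq_toFinset_card']
    congr 2
    ext j
    simp [hJ]
  set a := ∑ j ∈ J, |v j| with ha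
  set b := ∑ j ∈ Jᶜ, |v j| with hb
  have ha0 : 0 ≤ a := Finset.sum_nonneg fun j _ => abs_nonneg _
  have hb0 : 0 ≤ b := Finset.sum_nonneg fun j _ => abs_nonneg _
  have hl1 : l1Norm v = a + b := (Finset.sum_add_sum_compl J _).symm
  have hn0 : 0 ≤ v ⬝ᵥ v := dotProduct_star_self_nonneg v
  have ha2 : a ^ 2 ≤ k * (v ⬝ᵥ v) := by
    calc a ^ 2 ≤ J.card * ∑ j ∈ J, |v j| ^ 2 := sq_sum_le_card_mul_sum_sq
      _ ≤ k * (v ⬝ᵥ v) := by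
        rw [hkJ]
        refine mul_le_mul_of_nonneg_left ?_ (Nat.cast_nonneg _)
        simp only [sq_abs, dotProduct, ← sq]
        exact Finset.sum_le_sum_of_subset_of_nonneg (Finset.subset_univ _)
          fun j _ _ => sq_nonneg _
  set ν := √(v ⬝ᵥ v) with hν
  have hν0 : 0 ≤ ν := Real.sqrt_nonneg _
  have hν2 : ν ^ 2 = v ⬝ᵥ v := Real.sq_sqrt hn0
  have haν : a ≤ √k * ν := by
    rw [hν, ← Real.sqrt_mul hk0]
    exact Real.le_sqrt_of_sq_le ha2
  have hpen : ∑ j, w j * |βs j| - ∑ j, w j * |βh j| ≤ r * a - b := by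
    rw [← Finset.sum_sub_distrib, ← Finset.sum_add_sum_compl J, sub_eq_add_neg, ha, hb,
      Finset.mul_sum, ← Finset.sum_neg_distrib]
    refine add_le_add (Finset.sum_le_sum fun j hj => ?_) (Finset.sum_le_sum fun j hj => ?_)
    · have hj' : βs j ≠ 0 := by simpa [hJ] using hj
      have h1 := hwr j hj'
      rw [← mul_sub]
      refine (mul_le_mul_of_nonneg_left ?_ (hw0 j)).trans
        (mul_le_mul_of_nonneg_right h1 (abs_nonneg (v j)))
      rw [hv, Pi.sub_apply, abs_sub_comm]
      exact abs_sub_abs_le_abs_sub _ _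
    · have hj' : βs j = 0 := by simpa [hJ] using hj
      have h1 := hw j hj'
      rw [hβh, Pi.add_apply, hj', abs_zero, zero_add]
      nlinarith [abs_nonneg (v j)]
  have hnoise : v ⬝ᵥ (γ - G *ᵥ βs) ≤ lam / 4 * (a + b) := by
    rw [← hl1]
    exact dotProduct_le_mul_l1Norm hdev
  have hsymm : βs ⬝ᵥ (G *ᵥ v) = v ⬝ᵥ (G *ᵥ βs) := by
    rw [dotProduct_mulVec, ← mulVec_transpose, hG.eq, dotProduct_comm]
  -- The noise enters the objective difference with factor `2`, costing `lam / 2 * (a + b)`. Against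
  -- the penalty gain `lam * (r a - b)` this leaves half of the `b` term, whence the cone `b ≤ (1 +
  -- 2r) a`.
  have hbasic : v ⬝ᵥ (G *ᵥ v) ≤ lam / 2 * ((1 + 2 * r) * a - b) := by
    have h1 := mul_le_mul_of_nonneg_left hpen hlam.le
    rw [hβh] at hopt h1
    simp only [mulVec_add, dotProduct_add, add_dotProduct, dotProduct_sub, hsymm] at hopt hnoise
    linarith
  have hcone : b ≤ (1 + 2 * r) * a := by
    have h1 : 0 ≤ (1 + 2 * r) * a - b :=
      nonneg_of_mul_nonneg_right ((hpsd v).trans hbasic) (by positivity)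
    linarith
  have hl1' : l1Norm v ≤ 2 * (1 + r) * a := by rw [hl1]; linarith
  have hbasic' : v ⬝ᵥ (G *ᵥ v) ≤ lam / 2 * ((1 + 2 * r) * (√k * ν)) := by
    refine hbasic.trans (mul_le_mul_of_nonneg_left ?_ (by positivity))
    have := mul_le_mul_of_nonneg_left haν (by positivity : 0 ≤ 1 + 2 * r)
    linarith
  -- On the cone `‖v‖₁² ≤ 4 (1 + r)² k ‖v‖₂²`, so by `hτk` the l₁ term uses up at most half of the
  -- curvature.
  have hcurv : α / 2 * ν ^ 2 ≤ v ⬝ᵥ (G *ᵥ v) := by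
    refine le_trans ?_ (hRE v)
    have h1 : l1Norm v ^ 2 ≤ (2 * (1 + r) * a) ^ 2 :=
      pow_le_pow_left₀ (by rw [hl1]; positivity) hl1' 2
    have h2 : l1Norm v ^ 2 ≤ 4 * (1 + r) ^ 2 * (k * (v ⬝ᵥ v)) := by
      refine h1.trans ?_
      calc (2 * (1 + r) * a) ^ 2 = 4 * (1 + r) ^ 2 * a ^ 2 := by ring
        _ ≤ _ := by gcongr
    have h3 : τ * l1Norm v ^ 2 ≤ α / 2 * (v ⬝ᵥ v) := by
      calc τ * l1Norm v ^ 2 ≤ τ * (4 * (1 + r) ^ 2 * (k * (v ⬝ᵥ v))) := by gcongr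
        _ = (4 * (1 + r) ^ 2 * k * τ) * (v ⬝ᵥ v) := by ring
        _ ≤ _ := by gcongr
    rw [hν2]
    linarith
  have hνle : ν ≤ (1 + 2 * r) / α * √k * lam := by
    rcases hν0.eq_or_lt with h | h
    · rw [← h]; positivity
    · have h1 : ν * (α * ν) ≤ ν * ((1 + 2 * r) * √k * lam) := by
        have := hcurv.trans hbasic'
        nlinarith
      have h2 := le_of_mul_le_mul_left h1 h
      rw [div_mul_eq_mul_div, div_mul_eq_mul_div, le_div_iff₀ hα]
      linarith
  have hkk : √k * √k = k := Real.mul_self_sqrt hk0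
  have hale : a ≤ (1 + 2 * r) / α * k * lam := by
    calc a ≤ √k * ((1 + 2 * r) / α * √k * lam) :=
          haν.trans (mul_le_mul_of_nonneg_left hνle (Real.sqrt_nonneg _))
      _ = (1 + 2 * r) / α * (√k * √k) * lam := by ring
      _ = _ := by rw [hkk]
  have hl1le : l1Norm v ≤ (2 + 6 * r + 4 * r ^ 2) / α * k * lam := by
    calc l1Norm v ≤ 2 * (1 + r) * ((1 + 2 * r) / α * k * lam) :=
          hl1'.trans (mul_le_mul_of_nonneg_left hale (by positivity))
      _ = _ := by ring
  refine ⟨by rw [l2Norm_eq_sqrt]; exact hνle, hl1le, ?_, ?_, ?_⟩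
  · calc v ⬝ᵥ (G *ᵥ v) ≤ lam / 2 * ((1 + 2 * r) * (√k * ((1 + 2 * r) / α * √k * lam))) := by
          refine hbasic'.trans ?_
          gcongr
      _ = (1 + 2 * r) ^ 2 / (2 * α) * (√k * √k) * lam ^ 2 := by ring
      _ = _ := by rw [hkk]
  · have h1 : ((Function.support βs \ Function.support βh).ncard : ℝ) * s₀ ≤ l1Norm v := by
      refine ncard_mul_le_sum (fun j _ => Finset.mem_univ j) fun j hj => ?_
      have h2 : βh j = 0 := by simpa using hj.2
      rw [hv, Pi.sub_apply, h2, zero_sub, abs_neg]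
      exact hs j hj.1
    rw [← le_div_iff₀ hs₀] at h1
    refine h1.trans ?_
    calc l1Norm v / s₀ ≤ ((2 + 6 * r + 4 * r ^ 2) / α * k * lam) / s₀ := by gcongr
      _ = _ := by rw [div_mul_eq_div_div_swap]; ring
  · have h1 : ((Function.support (hardThreshold lam βh) \ Function.support βs).ncard : ℝ) * lam ≤
        b := by
      refine ncard_mul_le_sum (fun j hj => ?_) fun j hj => ?_
      · simpa [hJ] using hj.2
      · have h2 : βs j = 0 := by simpa using hj.2
        have h3 : hardThreshold lam βh j ≠ 0 := hj.1
        rw [hv, Pi.sub_apply, h2, sub_zero]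
        by_contra h4
        exact h3 (if_neg fun h5 => h4 h5.le)
    rw [← le_div_iff₀ hlam] at h1
    refine h1.trans ?_
    rw [div_le_iff₀ hlam]
    calc b ≤ (1 + 2 * r) * ((1 + 2 * r) / α * k * lam) :=
          hcone.trans (mul_le_mul_of_nonneg_left hale (by positivity))
      _ = _ := by ring

end Lasso

section Model

variable {m p T : ℕ}

lemma GammaHat_isSymm (x : ℤ → EuclideanSpace ℝ (Fin m)) : (GammaHat p T x).IsSymm := by
  rw [Matrix.IsSymm, GammaHat, transpose_smul, ← kroneckerMap_transpose, transpose_one,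
    transpose_mul, transpose_transpose]

lemma vec_of_curry (v : CoefIdx m p → ℝ) : vec (Matrix.of fun j s => v (s, j)) = v := rfl

lemma GammaHat_mulVec (x : ℤ → EuclideanSpace ℝ (Fin m)) (v : CoefIdx m p → ℝ) (s : Fin m)
    (j : Fin p × Fin m) :
    (GammaHat p T x *ᵥ v) (s, j) = ((T - p : ℕ) : ℝ)⁻¹ *
      ∑ i, design p T x i j * (design p T x i ⬝ᵥ fun j => v (s, j)) := by
  rw [GammaHat, smul_mulVec, Pi.smul_apply, smul_eq_mul]
  conv_lhs => rw [← vec_of_curry v]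
  rw [kronecker_mulVec_vec, transpose_one, Matrix.mul_one, Matrix.mul_assoc]
  rfl

lemma GammaHat_quadForm (x : ℤ → EuclideanSpace ℝ (Fin m)) (v : CoefIdx m p → ℝ) :
    v ⬝ᵥ (GammaHat p T x *ᵥ v) = ∑ s, ((T - p : ℕ) : ℝ)⁻¹ *
      ∑ i, (design p T x i ⬝ᵥ fun j => v (s, j)) ^ 2 := by
  rw [dotProduct, Fintype.sum_prod_type]
  refine Finset.sum_congr rfl fun s _ => ?_
  simp only [GammaHat_mulVec, Finset.mul_sum]
  rw [Finset.sum_comm]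
  refine Finset.sum_congr rfl fun i _ => ?_
  have h1 : (design p T x i ⬝ᵥ fun j => v (s, j)) = ∑ j, design p T x i j * v (s, j) := rfl
  rw [sq]
  nth_rw 2 [h1]
  rw [Finset.sum_mul, Finset.mul_sum]
  exact Finset.sum_congr rfl fun j _ => by ring

/-- The matrix is block diagonal with `m` equal blocks, and squared l₁ norms of blocks add up to at
most the squared total. The covering argument therefore needs dimension `p m` only. -/
lemma GammaHat_restrictedEigenvalue {x : ℤ → EuclideanSpace ℝ (Fin m)} {α τ : ℝ} (hτ : 0 ≤ τ)
    (h : ∀ u : Fin p × Fin m → ℝ, α * (u ⬝ᵥ u) - τ * l1Norm u ^ 2 ≤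
      ((T - p : ℕ) : ℝ)⁻¹ * ∑ i, (design p T x i ⬝ᵥ u) ^ 2) (v : CoefIdx m p → ℝ) :
    α * (v ⬝ᵥ v) - τ * l1Norm v ^ 2 ≤ v ⬝ᵥ (GammaHat p T x *ᵥ v) := by
  rw [GammaHat_quadForm]
  refine le_trans ?_ (Finset.sum_le_sum fun s _ => h fun j => v (s, j))
  have h1 : v ⬝ᵥ v = ∑ s, (fun j => v (s, j)) ⬝ᵥ fun j => v (s, j) := by
    rw [dotProduct, Fintype.sum_prod_type]
    rfl
  have h2 : l1Norm v = ∑ s, l1Norm fun j => v (s, j) := by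
    rw [l1Norm, Fintype.sum_prod_type]
    rfl
  rw [Finset.sum_sub_distrib, ← Finset.mul_sum, ← Finset.mul_sum, ← h1, h2]
  have h3 : ∑ s, l1Norm (fun j => v (s, j)) ^ 2 ≤ (∑ s, l1Norm fun j => v (s, j)) ^ 2 :=
    Finset.sum_sq_le_sq_sum_of_nonneg fun s _ => Finset.sum_nonneg fun j _ => abs_nonneg _
  have := mul_le_mul_of_nonneg_left h3 hτ
  linarith

/-- The score at the true coefficients: each entry is an average of a regressor times the residual
of one equation. -/
lemma gammaHat_sub_mulVec (Φ : Fin p → Matrix (Fin m) (Fin m) ℝ)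
    (x : ℤ → EuclideanSpace ℝ (Fin m)) (s : Fin m) (j : Fin p × Fin m) :
    (gammaHat p T x - GammaHat p T x *ᵥ vec (coefMatrix Φ)) (s, j) =
      ((T - p : ℕ) : ℝ)⁻¹ * ∑ i, design p T x i j *
        (response p T x i s - (∑ l : Fin p, Φ l *ᵥ (x ((T : ℤ) - (i : ℤ) - ((l : ℤ) + 1))).ofLp) s) := by
  rw [Pi.sub_apply, GammaHat_mulVec, gammaHat, Pi.smul_apply, smul_eq_mul, kronecker_mulVec_vec,
    transpose_one, Matrix.mul_one, ← mul_sub]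
  congr 1
  simp only [vec, Matrix.mul_apply, transpose_apply, ← Finset.sum_sub_distrib, ← mul_sub]
  refine Finset.sum_congr rfl fun i _ => ?_
  congr 2
  rw [dotProduct, Fintype.sum_prod_type, Finset.sum_apply]
  refine Finset.sum_congr rfl fun l _ => ?_
  rw [mulVec, dotProduct]
  refine Finset.sum_congr rfl fun s' _ => ?_
  rw [mul_comm]
  rfl

end Model

end SparseVAR

/-! ### The simulated path as a linear function of Gaussian noise. -/

namespace SparseVAR

section Noise

variable {m : ℕ}

/-- The input sequence `H g_0, …, H g_{M-1}, 0, 0, …`. -/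
def noise (H : Matrix (Fin m) (Fin m) ℝ) (M : ℕ) (g : Fin M × Fin m → ℝ) (t : ℕ) : Fin m → ℝ :=
  if h : t < M then H *ᵥ fun s => g (⟨t, h⟩, s) else 0

/-- `noise` as a linear map. -/
def noiseLin (H : Matrix (Fin m) (Fin m) ℝ) (M : ℕ) :
    (Fin M × Fin m → ℝ) →ₗ[ℝ] (ℕ → Fin m → ℝ) where
  toFun := noise H M
  map_add' g g' := by
    ext1 t
    by_cases h : t < M
    · simp only [noise, h, dite_true, Pi.add_apply, ← mulVec_add]
      rfl
    · simp [noise, h]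
  map_smul' c g := by
    ext1 t
    by_cases h : t < M
    · simp only [noise, h, dite_true, Pi.smul_apply, RingHom.id_apply, ← mulVec_smul]
      rfl
    · simp [noise, h]

lemma noise_of_le (H : Matrix (Fin m) (Fin m) ℝ) {M t : ℕ} (g : Fin M × Fin m → ℝ) (h : M ≤ t) :
    noise H M g t = 0 := by
  simp [noise, not_lt.2 h]

lemma sum_noise (H : Matrix (Fin m) (Fin m) ℝ) (M : ℕ) (g : Fin M × Fin m → ℝ) :
    ∑ t ∈ Finset.range M, noise H M g t ⬝ᵥ noise H M g t =
      ∑ t : Fin M, (H *ᵥ fun s => g (t, s)) ⬝ᵥ (H *ᵥ fun s => g (t, s)) := by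
  rw [Finset.sum_range]
  refine Finset.sum_congr rfl fun t _ => ?_
  simp [noise]

lemma dotProduct_self_prod {ι κ : Type*} [Fintype ι] [Fintype κ] (g : ι × κ → ℝ) :
    g ⬝ᵥ g = ∑ t, (fun s => g (t, s)) ⬝ᵥ (fun s => g (t, s)) := by
  rw [dotProduct, Fintype.sum_prod_type]
  rfl

lemma sum_noise_le {H : Matrix (Fin m) (Fin m) ℝ} {b : ℝ}
    (hH : ∀ v, (H *ᵥ v) ⬝ᵥ (H *ᵥ v) ≤ b * (v ⬝ᵥ v)) (M : ℕ) (g : Fin M × Fin m → ℝ) :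
    ∑ t ∈ Finset.range M, noise H M g t ⬝ᵥ noise H M g t ≤ b * (g ⬝ᵥ g) := by
  rw [sum_noise, dotProduct_self_prod, Finset.mul_sum]
  exact Finset.sum_le_sum fun t _ => hH _

/-- The lower bound makes the square matrix `H` injective, hence onto, so any inputs are realised by
some noise of controlled energy. -/
lemma exists_noise_eq {H : Matrix (Fin m) (Fin m) ℝ} {b : ℝ} (hb : 0 < b)
    (hH : ∀ v, b * (v ⬝ᵥ v) ≤ (H *ᵥ v) ⬝ᵥ (H *ᵥ v)) (M : ℕ) (e : ℕ → Fin m → ℝ) :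
    ∃ g : Fin M × Fin m → ℝ, (∀ t < M, noise H M g t = e t) ∧
      b * (g ⬝ᵥ g) ≤ ∑ t ∈ Finset.range M, e t ⬝ᵥ e t := by
  have hinj : Function.Injective H.mulVec := by
    intro v w hvw
    have h1 := hH (v - w)
    rw [mulVec_sub, show H *ᵥ v = H *ᵥ w from hvw, sub_self, zero_dotProduct] at h1
    have h2 : (0 : ℝ) ≤ (v - w) ⬝ᵥ (v - w) := dotProduct_star_self_nonneg _
    have h3 : (v - w) ⬝ᵥ (v - w) = 0 := le_antisymm (nonpos_of_mul_nonpos_right h1 hb) h2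
    exact sub_eq_zero.1 (dotProduct_self_eq_zero.1 h3)
  have hsurj : Function.Surjective H.mulVec :=
    LinearMap.injective_iff_surjective (f := H.mulVecLin).1 hinj
  choose f hf using hsurj
  have h1 : ∀ t < M, noise H M (fun i => f (e i.1) i.2) t = e t := fun t ht => by
    simp only [noise, ht, dite_true]
    exact hf (e t)
  refine ⟨fun i => f (e i.1) i.2, h1, ?_⟩
  have h2 : ∑ t ∈ Finset.range M, e t ⬝ᵥ e t = ∑ t ∈ Finset.range M,
      noise H M (fun i => f (e i.1) i.2) t ⬝ᵥ noise H M (fun i => f (e i.1) i.2) t :=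
    Finset.sum_congr rfl fun t ht => by rw [h1 t (Finset.mem_range.1 ht)]
  rw [h2, sum_noise, dotProduct_self_prod, Finset.mul_sum]
  exact Finset.sum_le_sum fun t _ => hH _

end Noise

section Window

variable {m p T : ℕ}

lemma sum_comp_le_sum_range {τ : Type*} [Fintype τ] {f : ℕ → ℝ} (hf : ∀ t, 0 ≤ f t) {M : ℕ}
    {φ : τ → ℕ} (hφ : Function.Injective φ) (hM : ∀ i, φ i < M) :
    ∑ i, f (φ i) ≤ ∑ t ∈ Finset.range M, f t := by
  refine (Finset.sum_map Finset.univ ⟨φ, hφ⟩ f).symm.trans_le ?_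
  refine Finset.sum_le_sum_of_subset_of_nonneg (fun t ht => ?_) fun t _ _ => hf t
  obtain ⟨i, -, rfl⟩ := Finset.mem_map.1 ht
  exact Finset.mem_range.2 (hM i)

lemma sq_dotProduct_le {ι : Type*} [Fintype ι] (u v : ι → ℝ) :
    (u ⬝ᵥ v) ^ 2 ≤ (u ⬝ᵥ u) * (v ⬝ᵥ v) := by
  simpa only [dotProduct, sq] using Finset.sum_mul_sq_le_sq_mul_sq Finset.univ u v

lemma sq_apply_le_dotProduct_self {ι : Type*} [Fintype ι] (v : ι → ℝ) (i : ι) :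
    v i * v i ≤ v ⬝ᵥ v :=
  Finset.single_le_sum (f := fun i => v i * v i) (fun j _ => mul_self_nonneg _)
    (Finset.mem_univ i)

/-- The time, shifted by `n`, at which the regressors of the `i`-th observation end. -/
def lagTime (T n : ℕ) (i : ℕ) : ℕ := n + (T - i - 2)

/-- Regressors of the `i`-th observation as a linear function of the noise. -/
noncomputable def regressor (Φ : Fin p → Matrix (Fin m) (Fin m) ℝ)
    (H : Matrix (Fin m) (Fin m) ℝ) (n : ℕ) (i : Fin (T - p)) :
    Matrix (Fin p × Fin m) (Fin (n + T) × Fin m) ℝ :=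
  LinearMap.toMatrix' (LinearMap.pi fun j : Fin p × Fin m =>
    (LinearMap.proj j.2).comp ((LinearMap.proj (lagTime T n i - j.1)).comp
      ((solveLin Φ).comp (noiseLin H (n + T)))))

/-- From `i < T - p` one gets `T - i - 2 ≥ p - 1`, so even with `n = 0` all `p` lags have
nonnegative time and the truncated subtractions are genuine. -/
lemma le_lagTime {n : ℕ} (i : Fin (T - p)) (l : Fin p) : (l : ℕ) ≤ lagTime T n i := by
  have := i.2
  have := l.2
  unfold lagTime
  omega

lemma lagTime_lt {n : ℕ} (hp : 0 < p) (i : Fin (T - p)) : lagTime T n i + 1 < n + T := by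
  have := i.2
  unfold lagTime
  omega

lemma lagTime_sub_injective {n : ℕ} (hp : 0 < p) {l : ℕ} (hl : l < p) :
    Function.Injective fun i : Fin (T - p) => lagTime T n i - l := by
  intro i j hij
  have := i.2
  have := j.2
  simp only [lagTime] at hij
  exact Fin.ext (by omega)

lemma lagTime_succ_injective {n : ℕ} (hp : 0 < p) :
    Function.Injective fun i : Fin (T - p) => lagTime T n i + 1 := by
  intro i j hij
  have := i.2
  have := j.2
  simp only [lagTime] at hij
  exact Fin.ext (by omega)

variable (Φ : Fin p → Matrix (Fin m) (Fin m) ℝ) (H : Matrix (Fin m) (Fin m) ℝ) (n : ℕ)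

lemma regressor_mulVec (i : Fin (T - p)) (g : Fin (n + T) × Fin m → ℝ) :
    regressor Φ H n i *ᵥ g = stack p (solve Φ (noise H (n + T) g)) (lagTime T n i) := by
  rw [regressor, LinearMap.toMatrix'_mulVec]
  ext j
  rw [stack, if_pos (le_lagTime i j.1)]
  rfl

variable {Φ H n}

lemma vfilter_solve_noise_of_le {M t : ℕ} (g : Fin M × Fin m → ℝ) (h : M ≤ t) :
    vfilter Φ (solve Φ (noise H M g)) t = 0 := by
  rw [vfilter_solve, noise_of_le H g h]

/-- Cauchy–Schwarz at each time, then the total energy of the stacked path against that of its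
inputs. -/
lemma rowProj_regressor_le (hm : 0 < m) (hp : 0 < p) (hΦ : IsStable Φ) {b : ℝ}
    (hH : ∀ v, (H *ᵥ v) ⬝ᵥ (H *ᵥ v) ≤ b * (v ⬝ᵥ v)) (u : Fin p × Fin m → ℝ)
    (g : Fin (n + T) × Fin m → ℝ) :
    (rowProj (regressor (T := T) Φ H n) u *ᵥ g) ⬝ᵥ (rowProj (regressor (T := T) Φ H n) u *ᵥ g) ≤
      b / muMin (fun _ : Fin 1 => companion Φ) * (u ⬝ᵥ u) * (g ⬝ᵥ g) := by
  have : Nonempty (Fin p × Fin m) := ⟨(⟨0, hp⟩, ⟨0, hm⟩)⟩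
  have hμ : 0 < muMin (fun _ : Fin 1 => companion Φ) := muMin_pos (isStable_companion hΦ)
  set y := solve Φ (noise H (n + T) g) with hy
  have hu : 0 ≤ u ⬝ᵥ u := dotProduct_star_self_nonneg u
  have h1 := muMin_companion_mul_sum_stack_le hm hp hΦ (y := y) (K := n + T)
    (fun t ht => vfilter_solve_noise_of_le g ht) (n + T)
  simp only [hy, vfilter_solve] at h1
  have h2 := h1.trans (sum_noise_le hH (n + T) g)
  calc _ = ∑ i : Fin (T - p), (u ⬝ᵥ stack p y (lagTime T n i)) ^ 2 := by
        rw [dotProduct]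
        refine Finset.sum_congr rfl fun i _ => ?_
        rw [rowProj_mulVec, regressor_mulVec, sq]
    _ ≤ ∑ i : Fin (T - p), (u ⬝ᵥ u) *
          (stack p y (lagTime T n i) ⬝ᵥ stack p y (lagTime T n i)) :=
        Finset.sum_le_sum fun i _ => sq_dotProduct_le _ _
    _ ≤ (u ⬝ᵥ u) * ∑ t ∈ Finset.range (n + T), stack p y t ⬝ᵥ stack p y t := by
        rw [← Finset.mul_sum]
        refine mul_le_mul_of_nonneg_left ?_ hu
        refine sum_comp_le_sum_range (f := fun t => stack p y t ⬝ᵥ stack p y t)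
          (fun t => dotProduct_star_self_nonneg _) (φ := fun i : Fin (T - p) => lagTime T n i)
          (lagTime_sub_injective (l := 0) hp hp) fun i => ?_
        have := lagTime_lt (n := n) hp i
        omega
    _ ≤ (u ⬝ᵥ u) * (b * (g ⬝ᵥ g) / muMin (fun _ : Fin 1 => companion Φ)) := by
        refine mul_le_mul_of_nonneg_left ?_ hu
        rw [le_div_iff₀ hμ, mul_comm]
        exact h2
    _ = _ := by ring

/-- A variance lower bound by duality. The path equal to `u` on the `p` lag times and zero elsewhere
is driven by some noise `g` with `b ‖g‖² ≤ μ_max ‖u‖²`. Since `R g = u`, one has `⟨uᵀR, g⟩ = ‖u‖²`,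
and Cauchy–Schwarz bounds `‖uᵀR‖` from below. -/
lemma regressor_lower (hm : 0 < m) (hΦ : IsStable Φ) (hp : 0 < p) {b : ℝ} (hb : 0 < b)
    (hH : ∀ v, b * (v ⬝ᵥ v) ≤ (H *ᵥ v) ⬝ᵥ (H *ᵥ v)) (u : Fin p × Fin m → ℝ)
    (i : Fin (T - p)) :
    b / muMax Φ * (u ⬝ᵥ u) ≤ (u ᵥ* regressor Φ H n i) ⬝ᵥ (u ᵥ* regressor Φ H n i) := by
  have : Nonempty (Fin m) := ⟨⟨0, hm⟩⟩
  have hμ : 0 < muMax Φ := muMax_pos hΦ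
  set t₀ := lagTime T n i with ht₀
  have ht₀M : t₀ + 1 < n + T := lagTime_lt hp i
  let x : ℕ → Fin m → ℝ := fun t =>
    if h : t ≤ t₀ ∧ t₀ - t < p then fun s => u (⟨t₀ - t, h.2⟩, s) else 0
  have hxl : ∀ l : Fin p, x (t₀ - l) = fun s => u (l, s) := by
    intro l
    have h1 := le_lagTime (n := n) i l
    have h2 := l.2
    have h3 : t₀ - (t₀ - (l : ℕ)) = l := by omega
    have h4 : t₀ - (l : ℕ) ≤ t₀ ∧ t₀ - (t₀ - (l : ℕ)) < p := by omega
    have h5 : (⟨t₀ - (t₀ - (l : ℕ)), h4.2⟩ : Fin p) = l := Fin.ext h3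
    simp only [x]
    rw [dif_pos h4, h5]
  have hstack : stack p x t₀ = u := by
    ext ⟨l, s⟩
    rw [stack, if_pos (le_lagTime i l)]
    exact congrFun (hxl l) s
  obtain ⟨g, hg, hgn⟩ := exists_noise_eq hb hH (n + T) (vfilter Φ x)
  have hRg : regressor Φ H n i *ᵥ g = u := by
    rw [regressor_mulVec, ← ht₀]
    refine Eq.trans ?_ hstack
    ext j
    simp only [stack]
    split_ifs
    · rw [solve_congr Φ (e' := vfilter Φ x) fun s hs => hg s (by omega), solve_vfilter]
    · rfl
  have hxsum : ∑ t ∈ Finset.range (n + T + p), x t ⬝ᵥ x t = u ⬝ᵥ u := by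
    rw [dotProduct_self_prod]
    have hinj : Function.Injective fun l : Fin p => t₀ - (l : ℕ) := by
      intro l l' hll
      have h1 := le_lagTime (n := n) i l
      have h2 := le_lagTime (n := n) i l'
      simp only at hll
      exact Fin.ext (by omega)
    have h1 : ∑ l : Fin p, (fun s => u (l, s)) ⬝ᵥ (fun s => u (l, s)) =
        ∑ l : Fin p, x (t₀ - l) ⬝ᵥ x (t₀ - l) :=
      Finset.sum_congr rfl fun l _ => by rw [hxl]
    rw [h1]
    refine Eq.symm ((Finset.sum_map Finset.univ ⟨fun l : Fin p => t₀ - (l : ℕ), hinj⟩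
      fun t => x t ⬝ᵥ x t).symm.trans ?_)
    refine Finset.sum_subset (fun t ht => ?_) fun t _ ht => ?_
    · obtain ⟨l, -, rfl⟩ := Finset.mem_map.1 ht
      refine Finset.mem_range.2 ?_
      change t₀ - (l : ℕ) < _
      omega
    · have hn : ¬ (t ≤ t₀ ∧ t₀ - t < p) := by
        rintro ⟨h1, h2⟩
        refine ht (Finset.mem_map.2 ⟨⟨t₀ - t, h2⟩, Finset.mem_univ _, ?_⟩)
        change t₀ - (t₀ - t) = t
        omega
      simp only [x, hn, dite_false, zero_dotProduct]
  have hsq := sq_dotProduct_le (u ᵥ* regressor Φ H n i) g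
  rw [← dotProduct_mulVec, hRg] at hsq
  have henergy : b * (g ⬝ᵥ g) ≤ muMax Φ * (u ⬝ᵥ u) := by
    refine hgn.trans ?_
    rw [← hxsum]
    refine le_trans ?_ (vfilter_bounds Φ x (K := n + T) (M := n + T + p) (fun t ht => ?_) le_rfl).2
    · exact Finset.sum_le_sum_of_subset_of_nonneg (Finset.range_mono (by omega))
        fun t _ _ => dotProduct_star_self_nonneg _
    · have hn : ¬ (t ≤ t₀ ∧ t₀ - t < p) := by omega
      simp only [x, hn, dite_false]
  set w := (u ᵥ* regressor Φ H n i) ⬝ᵥ (u ᵥ* regressor Φ H n i)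
  have hw : 0 ≤ w := dotProduct_star_self_nonneg _
  have hu : 0 ≤ u ⬝ᵥ u := dotProduct_star_self_nonneg u
  rw [div_mul_eq_mul_div, div_le_iff₀ hμ]
  rcases hu.eq_or_lt with h | h
  · rw [← h, mul_zero]
    positivity
  · refine le_of_mul_le_mul_right ?_ h
    calc b * (u ⬝ᵥ u) * (u ⬝ᵥ u) = b * (u ⬝ᵥ u) ^ 2 := by ring
      _ ≤ b * (w * (g ⬝ᵥ g)) := by gcongr
      _ = w * (b * (g ⬝ᵥ g)) := by ring
      _ ≤ w * (muMax Φ * (u ⬝ᵥ u)) := by gcongr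
      _ = _ := by ring

/-- The innovation of the `i`-th observation as a linear function of the noise. -/
noncomputable def innovation (p T : ℕ) (H : Matrix (Fin m) (Fin m) ℝ) (n : ℕ) (s : Fin m) :
    Matrix (Fin (T - p)) (Fin (n + T) × Fin m) ℝ :=
  LinearMap.toMatrix' (LinearMap.pi fun i : Fin (T - p) =>
    (LinearMap.proj s).comp ((LinearMap.proj (lagTime T n i + 1)).comp (noiseLin H (n + T))))

lemma innovation_mulVec (s : Fin m) (g : Fin (n + T) × Fin m → ℝ) (i : Fin (T - p)) :
    (innovation p T H n s *ᵥ g) i = noise H (n + T) g (lagTime T n i + 1) s := by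
  rw [innovation, LinearMap.toMatrix'_mulVec]
  rfl

lemma innovation_le (hp : 0 < p) {b : ℝ} (hH : ∀ v, (H *ᵥ v) ⬝ᵥ (H *ᵥ v) ≤ b * (v ⬝ᵥ v))
    (s : Fin m) (g : Fin (n + T) × Fin m → ℝ) :
    (innovation p T H n s *ᵥ g) ⬝ᵥ (innovation p T H n s *ᵥ g) ≤ b * (g ⬝ᵥ g) := by
  refine le_trans ?_ (sum_noise_le hH (n + T) g)
  rw [dotProduct]
  refine le_trans (Finset.sum_le_sum fun i _ => ?_) (sum_comp_le_sum_range
    (f := fun t => noise H (n + T) g t ⬝ᵥ noise H (n + T) g t)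
    (fun t => dotProduct_star_self_nonneg _)
    (φ := fun i : Fin (T - p) => lagTime T n i + 1) (lagTime_succ_injective hp)
    fun i => lagTime_lt hp i)
  rw [innovation_mulVec]
  exact sq_apply_le_dotProduct_self _ s

lemma rowProj_regressor_single_le (hm : 0 < m) (hp : 0 < p) (hΦ : IsStable Φ) {b : ℝ}
    (hH : ∀ v, (H *ᵥ v) ⬝ᵥ (H *ᵥ v) ≤ b * (v ⬝ᵥ v)) (j : Fin p × Fin m)
    (g : Fin (n + T) × Fin m → ℝ) :
    (rowProj (regressor (T := T) Φ H n) (Pi.single j 1) *ᵥ g) ⬝ᵥ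
      (rowProj (regressor (T := T) Φ H n) (Pi.single j 1) *ᵥ g) ≤
      b / muMin Φ * (g ⬝ᵥ g) := by
  have : Nonempty (Fin m) := ⟨⟨0, hm⟩⟩
  have hμ : 0 < muMin Φ := muMin_pos hΦ
  set y := solve Φ (noise H (n + T) g) with hy
  have h1 := muMin_mul_sum_solve_le hm hp hΦ (y := y) (K := n + T)
    (fun t ht => vfilter_solve_noise_of_le g ht) (n + T)
  simp only [hy, vfilter_solve] at h1
  have h2 := h1.trans (sum_noise_le hH (n + T) g)
  rw [div_mul_eq_mul_div, le_div_iff₀ hμ, mul_comm]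
  refine le_trans (mul_le_mul_of_nonneg_left ?_ hμ.le) h2
  rw [dotProduct]
  refine le_trans (Finset.sum_le_sum fun i _ => ?_) (sum_comp_le_sum_range
    (f := fun t => y t ⬝ᵥ y t) (fun t => dotProduct_star_self_nonneg _)
    (φ := fun i : Fin (T - p) => lagTime T n i - j.1) (lagTime_sub_injective hp j.1.2)
    fun i => ?_)
  · rw [rowProj_mulVec, regressor_mulVec, single_one_dotProduct, stack, if_pos (le_lagTime i j.1)]
    exact sq_apply_le_dotProduct_self _ j.2
  · have := lagTime_lt (n := n) hp i
    omega

/-- Causality: the innovation depends only on the noise at time `lagTime + 1`, the regressors only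
on earlier noise, so the two rows have disjoint supports. -/
lemma rowProj_regressor_dotProduct_innovation (j : Fin p × Fin m) (s : Fin m) (i : Fin (T - p)) :
    rowProj (regressor (T := T) Φ H n) (Pi.single j 1) i ⬝ᵥ innovation p T H n s i = 0 := by
  refine Finset.sum_eq_zero fun k _ => ?_
  have hcol : ∀ A : Matrix (Fin (T - p)) (Fin (n + T) × Fin m) ℝ,
      A i k = (A *ᵥ Pi.single k 1) i := fun A => by simp
  rw [hcol (rowProj _ _), hcol (innovation _ _ _ _ _), rowProj_mulVec, regressor_mulVec,
    innovation_mulVec, single_one_dotProduct]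
  have hnoise : ∀ t, t ≠ (k.1 : ℕ) → noise H (n + T) (Pi.single k 1) t = 0 := by
    intro t ht
    by_cases h : t < n + T
    · simp only [noise, h, dite_true]
      have : (fun s => (Pi.single k 1 : Fin (n + T) × Fin m → ℝ) (⟨t, h⟩, s)) = 0 := by
        ext s'
        refine Pi.single_eq_of_ne (fun h2 => ht ?_) _
        rw [← h2]
      rw [this, mulVec_zero]
    · exact noise_of_le _ _ (not_lt.1 h)
  by_cases hk : lagTime T n i + 1 = k.1
  · have h1 : ∀ t ≤ lagTime T n i, solve Φ (noise H (n + T) (Pi.single k 1)) t = 0 := by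
      intro t ht
      rw [solve_congr Φ (e' := 0) fun t' ht' => hnoise t' (by omega)]
      exact congrFun (map_zero (solveLin Φ)) t
    rw [stack, if_pos (le_lagTime i j.1), h1 _ (by omega)]
    simp
  · rw [hnoise _ hk]
    simp

/-- Observed paths for which the restricted eigenvalue condition and the deviation bound hold. -/
def goodPaths (T : ℕ) (Φ : Fin p → Matrix (Fin m) (Fin m) ℝ) (α τ δ : ℝ) :
    Set (ℤ → EuclideanSpace ℝ (Fin m)) :=
  {x | (∀ u : Fin p × Fin m → ℝ, α * (u ⬝ᵥ u) - τ * l1Norm u ^ 2 ≤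
      ((T - p : ℕ) : ℝ)⁻¹ * ∑ i, (design p T x i ⬝ᵥ u) ^ 2) ∧
    ∀ j, |(gammaHat p T x - GammaHat p T x *ᵥ vec (coefMatrix Φ)) j| ≤ δ}

/-- A path on `ℕ`, delayed by `n - 1` time steps. -/
noncomputable def pathOf (n : ℕ) (y : ℕ → Fin m → ℝ) (t : ℤ) : EuclideanSpace ℝ (Fin m) :=
  WithLp.toLp 2 (y ((n : ℤ) + t - 1).toNat)

lemma design_pathOf (y : ℕ → Fin m → ℝ) (i : Fin (T - p)) :
    design p T (pathOf n y) i = stack p y (lagTime T n i) := by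
  ext j
  have h1 := i.2
  have h2 := j.1.2
  have h3 : ((n : ℤ) + ((T : ℤ) - (i : ℤ) - ((j.1 : ℤ) + 1)) - 1).toNat =
      lagTime T n i - j.1 := by
    unfold lagTime
    omega
  rw [stack, if_pos (le_lagTime i j.1), design, pathOf, h3]

lemma residual_pathOf (hp : 0 < p) (y : ℕ → Fin m → ℝ) (i : Fin (T - p)) (s : Fin m) :
    response p T (pathOf n y) i s - (∑ l : Fin p,
      Φ l *ᵥ (pathOf n y ((T : ℤ) - (i : ℤ) - ((l : ℤ) + 1))).ofLp) s =
      vfilter Φ y (lagTime T n i + 1) s := by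
  have h1 := i.2
  rw [vfilter, Pi.sub_apply]
  congr 1
  · have h3 : ((n : ℤ) + ((T : ℤ) - (i : ℤ)) - 1).toNat = lagTime T n i + 1 := by
      unfold lagTime
      omega
    rw [response, pathOf, h3]
  · rw [Finset.sum_apply, Finset.sum_apply]
    refine Finset.sum_congr rfl fun l _ => ?_
    have h2 := l.2
    have h3 := le_lagTime (n := n) i l
    have h4 : ((n : ℤ) + ((T : ℤ) - (i : ℤ) - ((l : ℤ) + 1)) - 1).toNat =
        lagTime T n i + 1 - (l + 1) := by
      unfold lagTime
      omega
    rw [if_pos (by omega), pathOf, h4]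

/-- The simulated path is good with high probability. -/
lemma stdNormal_goodPaths (hm : 0 < m) (hp : 0 < p) (hpT : p < T) (hΦ : IsStable Φ)
    {b b' : ℝ} (hb : 0 < b) (hb' : 0 < b') (hH : ∀ v, b * (v ⬝ᵥ v) ≤ (H *ᵥ v) ⬝ᵥ (H *ᵥ v))
    (hH' : ∀ v, (H *ᵥ v) ⬝ᵥ (H *ᵥ v) ≤ b' * (v ⬝ᵥ v)) {κ x : ℝ}
    (hκ : b' / muMin (fun _ : Fin 1 => companion Φ) ≤ κ) (hακ : b / (2 * muMax Φ) ≤ κ)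
    (hx : 0 ≤ x) (hx1 : x ≤ 1) {ν : ℕ} (hν : 0 < ν) (n : ℕ) :
    (stdNormal (Fin (n + T) × Fin m)).real {g | pathOf n (solve Φ (noise H (n + T) g)) ∈
      goodPaths T Φ (b / (2 * muMax Φ)) (2 * (b / (2 * muMax Φ)) / ν) (x * (b' / muMin Φ + b'))}ᶜ ≤
      ((2 * (p * m : ℕ)) ^ (ν + 1) + (p * m : ℕ)) *
          Real.exp (-((T - p : ℕ) * (b / (2 * muMax Φ) / κ) ^ 2 / 8)) +
        (m * (p * m) : ℕ) * (4 * Real.exp (-((T - p : ℕ) * x ^ 2 / 8))) := by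
  have : Nonempty (Fin m) := ⟨⟨0, hm⟩⟩
  have hne : Nonempty (Fin (T - p)) := ⟨⟨0, by omega⟩⟩
  have hμ : 0 < muMax Φ := muMax_pos hΦ
  have hμ' : 0 < muMin Φ := muMin_pos hΦ
  set α := b / (2 * muMax Φ) with hα
  have hα0 : 0 < α := by positivity
  have hN0 : (0 : ℝ) < (T - p : ℕ) := by exact_mod_cast Nat.sub_pos_of_lt hpT
  let R := regressor (T := T) Φ H n
  let A₁ : Set (Fin (n + T) × Fin m → ℝ) :=
    {g | ∀ v, α * (v ⬝ᵥ v) - 2 * α / ν * (∑ j, |v j|) ^ 2 ≤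
      (Fintype.card (Fin (T - p)) : ℝ)⁻¹ * ((rowProj R v *ᵥ g) ⬝ᵥ (rowProj R v *ᵥ g))}
  let A₂ : Fin m × (Fin p × Fin m) → Set (Fin (n + T) × Fin m → ℝ) := fun j =>
    {g | x * Fintype.card (Fin (T - p)) * (b' / muMin Φ + b') <
      |(rowProj R (Pi.single j.2 1) *ᵥ g) ⬝ᵥ (innovation p T H n j.1 *ᵥ g)|}
  have hsub : {g | pathOf n (solve Φ (noise H (n + T) g)) ∈
      goodPaths T Φ α (2 * α / ν) (x * (b' / muMin Φ + b'))}ᶜ ⊆ A₁ᶜ ∪ ⋃ j, A₂ j := by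
    rw [Set.compl_subset_comm]
    intro g hg
    simp only [Set.compl_union, compl_compl, Set.mem_inter_iff, Set.mem_compl_iff, Set.mem_iUnion,
      not_exists, A₁, A₂, Set.mem_ofPred_eq, not_lt, Fintype.card_fin] at hg
    obtain ⟨hg1, hg2⟩ := hg
    constructor
    · intro u
      refine (hg1 u).trans (le_of_eq ?_)
      congr 1
      rw [dotProduct]
      refine Finset.sum_congr rfl fun i _ => ?_
      rw [rowProj_mulVec, regressor_mulVec, design_pathOf, sq, dotProduct_comm]
    · rintro ⟨s, j⟩
      rw [gammaHat_sub_mulVec]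
      have h1 : ∑ i, design p T (pathOf n (solve Φ (noise H (n + T) g))) i j *
          (response p T (pathOf n (solve Φ (noise H (n + T) g))) i s - (∑ l : Fin p,
          Φ l *ᵥ (pathOf n (solve Φ (noise H (n + T) g))
            ((T : ℤ) - (i : ℤ) - ((l : ℤ) + 1))).ofLp) s) =
          (rowProj R (Pi.single j 1) *ᵥ g) ⬝ᵥ (innovation p T H n s *ᵥ g) := by
        rw [dotProduct]
        refine Finset.sum_congr rfl fun i _ => ?_
        rw [residual_pathOf hp, vfilter_solve, innovation_mulVec, rowProj_mulVec,
          regressor_mulVec, single_one_dotProduct, design_pathOf]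
      rw [h1, abs_mul, abs_of_pos (inv_pos.2 hN0), inv_mul_le_iff₀ hN0]
      refine (hg2 (s, j)).trans (le_of_eq (by ring))
  refine (measureReal_mono hsub).trans ((measureReal_union_le _ _).trans ?_)
  refine add_le_add ?_ ((measureReal_iUnion_fintype_le _).trans ?_)
  -- Here `2α = b / μ_max` is the variance bound of `regressor_lower`; `κ` may exceed the operator
  -- bound so that `α ≤ κ` holds as well.
  · have h := restrictedEigenvalue_prob (R := R) hα0 hακ (fun u g =>
      (rowProj_regressor_le hm hp hΦ hH' u g).trans (by
        have h1 : 0 ≤ u ⬝ᵥ u := dotProduct_star_self_nonneg u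
        have h2 : 0 ≤ g ⬝ᵥ g := dotProduct_star_self_nonneg g
        gcongr)) (fun u i => by
        refine le_trans (le_of_eq ?_) (regressor_lower hm hΦ hp hb hH u i)
        rw [hα]
        field_simp) hν
    simpa [A₁] using h
  · refine (Finset.sum_le_card_nsmul _ _ (4 * Real.exp (-((T - p : ℕ) * x ^ 2 / 8))) fun j _ =>
      ?_).trans (le_of_eq ?_)
    · have h := gaussian_product_tail (A := rowProj R (Pi.single j.2 1))
        (B := innovation p T H n j.1) (κ := b' / muMin Φ) (κ' := b') (by positivity)
        (rowProj_regressor_single_le hm hp hΦ hH' j.2) (innovation_le hp hH' j.1)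
        (rowProj_regressor_dotProduct_innovation j.2 j.1) hx hx1
      simpa [A₂] using h
    · rw [nsmul_eq_mul]
      simp

end Window

end SparseVAR

/-! ### From the simulated path to the stationary process. -/

namespace SparseVAR

open Filter Topology
open scoped MatrixOrder

section Law

variable {m : ℕ}

lemma map_curry_stdNormal (ι κ : Type*) [Fintype ι] [Fintype κ] :
    (stdNormal (ι × κ)).map (fun g t s => g (t, s)) = Measure.pi fun _ : ι => stdNormal κ := by
  have h : (Measure.pi fun _ : ι => stdNormal κ).map (fun f i => f i.1 i.2) =
      stdNormal (ι × κ) := by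
    refine (Measure.pi_eq fun s hs => ?_).symm
    have hm : Measurable fun (f : ι → κ → ℝ) (i : ι × κ) => f i.1 i.2 := by fun_prop
    rw [Measure.map_apply hm (MeasurableSet.univ_pi hs)]
    have : (fun (f : ι → κ → ℝ) (i : ι × κ) => f i.1 i.2) ⁻¹' (Set.univ.pi s) =
        Set.univ.pi fun t => Set.univ.pi fun r => s (t, r) := by
      ext f
      simp
    rw [this, Measure.pi_pi]
    simp only [Measure.pi_pi]
    exact (Fintype.prod_prod_type fun i => gaussianReal 0 1 (s i)).symm
  rw [← h, Measure.map_map (by fun_prop) (by fun_prop)]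
  exact Measure.map_id

lemma map_ofLp_multivariateGaussian (S : Matrix (Fin m) (Fin m) ℝ) :
    (multivariateGaussian 0 S).map WithLp.ofLp =
      (stdNormal (Fin m)).map fun v => CFC.sqrt S *ᵥ v := by
  rw [multivariateGaussian, ← map_pi_eq_stdGaussian, Measure.map_map (by fun_prop) (by fun_prop),
    Measure.map_map (by fun_prop) (by fun_prop)]
  congr 1
  ext1 v
  simp

lemma measurable_mulVec (H : Matrix (Fin m) (Fin m) ℝ) : Measurable fun v : Fin m → ℝ => H *ᵥ v :=
  (continuous_const.matrix_mulVec continuous_id).measurable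

lemma pi_multivariateGaussian (S : Matrix (Fin m) (Fin m) ℝ) (M : ℕ) :
    (Measure.pi fun _ : Fin M => (multivariateGaussian 0 S).map WithLp.ofLp) =
      (stdNormal (Fin M × Fin m)).map fun g t => CFC.sqrt S *ᵥ fun s => g (t, s) := by
  have hH := measurable_mulVec (CFC.sqrt S)
  simp only [map_ofLp_multivariateGaussian]
  rw [← Measure.pi_map_pi fun _ => hH.aemeasurable, ← map_curry_stdNormal,
    Measure.map_map (by fun_prop) (by fun_prop)]
  rfl

end Law

section Sqrt

variable {m : ℕ} {S : Matrix (Fin m) (Fin m) ℝ}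

lemma sqrt_mulVec_dotProduct (hS : S.PosDef) (v : Fin m → ℝ) :
    (CFC.sqrt S *ᵥ v) ⬝ᵥ (CFC.sqrt S *ᵥ v) = v ⬝ᵥ (S *ᵥ v) := by
  have h1 : (CFC.sqrt S)ᵀ = CFC.sqrt S := by
    have := (CFC.sqrt_nonneg S).isSelfAdjoint.star_eq
    rwa [star_eq_conjTranspose, conjTranspose_eq_transpose_of_trivial] at this
  have h2 : CFC.sqrt S * CFC.sqrt S = S := CFC.sqrt_mul_sqrt_self S hS.posSemidef.nonneg
  nth_rw 3 [← h2]
  rw [← mulVec_mulVec, dotProduct_mulVec v, ← mulVec_transpose, h1]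

lemma lambdaMin_mul_le_sqrt (hS : S.PosDef) (v : Fin m → ℝ) :
    lambdaMin S * (v ⬝ᵥ v) ≤ (CFC.sqrt S *ᵥ v) ⬝ᵥ (CFC.sqrt S *ᵥ v) := by
  have h := lambdaMin_mul_le hS.1 v
  rw [sqrt_mulVec_dotProduct hS]
  simpa [dotProduct, sq] using h

lemma sqrt_le_lambdaMax_mul (hS : S.PosDef) (v : Fin m → ℝ) :
    (CFC.sqrt S *ᵥ v) ⬝ᵥ (CFC.sqrt S *ᵥ v) ≤ lambdaMax S * (v ⬝ᵥ v) := by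
  have h := le_lambdaMax_mul hS.1 v
  rw [sqrt_mulVec_dotProduct hS]
  simpa [dotProduct, sq] using h

end Sqrt

section Observation

variable {m p T : ℕ}

/-- The observed stretch `x_1, …, x_T` of a path. -/
def observe {E : Type*} (T : ℕ) (x : ℤ → E) (i : Fin T) : E := x ((i : ℤ) + 1)

/-- A path with prescribed observed stretch. -/
def extend {E : Type*} [Zero E] {T : ℕ} (z : Fin T → E) (t : ℤ) : E :=
  if h : 1 ≤ t ∧ t ≤ T then z ⟨(t - 1).toNat, by omega⟩ else 0

lemma extend_observe {E : Type*} [Zero E] (x : ℤ → E) {t : ℤ} (h1 : 1 ≤ t) (h2 : t ≤ T) :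
    extend (observe T x) t = x t := by
  rw [extend, dif_pos ⟨h1, h2⟩, observe]
  congr 1
  simp only
  omega

lemma design_congr {x x' : ℤ → EuclideanSpace ℝ (Fin m)}
    (h : ∀ t : ℤ, 1 ≤ t → t ≤ T → x t = x' t) : design p T x = design p T x' := by
  ext i j
  have h1 := i.2
  have h2 := j.1.2
  rw [design, design, h _ (by omega) (by omega)]

lemma response_congr {x x' : ℤ → EuclideanSpace ℝ (Fin m)}
    (h : ∀ t : ℤ, 1 ≤ t → t ≤ T → x t = x' t) : response p T x = response p T x' := by
  ext i s
  have h1 := i.2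
  rw [response, response, h _ (by omega) (by omega)]

lemma mem_goodPaths_congr {Φ : Fin p → Matrix (Fin m) (Fin m) ℝ} {α τ δ : ℝ}
    {x x' : ℤ → EuclideanSpace ℝ (Fin m)} (h : ∀ t : ℤ, 1 ≤ t → t ≤ T → x t = x' t) :
    x ∈ goodPaths T Φ α τ δ ↔ x' ∈ goodPaths T Φ α τ δ := by
  simp only [goodPaths, Set.mem_ofPred_eq, gammaHat, GammaHat, design_congr h, response_congr h]

lemma continuous_extend (t : ℤ) :
    Continuous fun z : Fin T → EuclideanSpace ℝ (Fin m) => extend z t := by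
  unfold extend
  split_ifs
  · exact continuous_apply _
  · exact continuous_const

/-- Nonstrict inequalities between continuous functions of the observed stretch. Closedness yields
measurability despite the uncountable quantifier over `u`, and lets the probability bound pass to
the limit. -/
lemma isClosed_goodPaths (Φ : Fin p → Matrix (Fin m) (Fin m) ℝ) (α τ δ : ℝ) :
    IsClosed {z : Fin T → EuclideanSpace ℝ (Fin m) | extend z ∈ goodPaths T Φ α τ δ} := by
  have hx : ∀ (t : ℤ) (s : Fin m),
      Continuous fun z : Fin T → EuclideanSpace ℝ (Fin m) => extend z t s := fun t s =>
    (PiLp.continuous_apply 2 _ s).comp (continuous_extend t)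
  have hd : ∀ i j, Continuous fun z : Fin T → EuclideanSpace ℝ (Fin m) =>
      design p T (extend z) i j := fun i j => hx _ _
  have hr : ∀ i s, Continuous fun z : Fin T → EuclideanSpace ℝ (Fin m) =>
      response p T (extend z) i s := fun i j => hx _ _
  simp only [goodPaths, Set.mem_ofPred_eq]
  rw [Set.ofPred_and, Set.ofPred_forall, Set.ofPred_forall]
  refine IsClosed.inter (isClosed_iInter fun u => ?_) (isClosed_iInter fun j => ?_)
  · refine isClosed_le continuous_const ?_
    simp only [dotProduct]
    exact continuous_const.mul (continuous_finsetSum _ fun i _ =>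
      (continuous_finsetSum _ fun j _ => (hd i j).mul continuous_const).pow 2)
  · refine isClosed_le (Continuous.abs ?_) continuous_const
    obtain ⟨s, j⟩ := j
    simp only [gammaHat_sub_mulVec]
    refine continuous_const.mul (continuous_finsetSum _ fun i _ => (hd i j).mul
      ((hr i s).sub ?_))
    simp only [Finset.sum_apply, mulVec, dotProduct]
    exact continuous_finsetSum _ fun l _ => continuous_finsetSum _ fun s' _ =>
      continuous_const.mul (hx _ _)

end Observation

section ClosedSet

/-- If a process with the law of `Z` at every time is approximated almost surely by `W n`, and
each `W n` lies in a closed set with probability at least `c`, then so does `Z`. -/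
lemma le_measureReal_of_approx {Ω V : Type*} [MeasurableSpace Ω] {P : Measure Ω}
    [IsProbabilityMeasure P] [NormedAddCommGroup V] [MeasurableSpace V] [BorelSpace V]
    [SecondCountableTopology V] {Z : Ω → V} {Y W : ℕ → Ω → V} (hZ : Measurable Z)
    (hY : ∀ n, Measurable (Y n)) (hW : ∀ n, Measurable (W n))
    (hlaw : ∀ n, P.map (Y n) = P.map Z)
    (hlim : ∀ ω, Tendsto (fun n => Y n ω - W n ω) atTop (𝓝 0)) {F : Set V} (hF : IsClosed F)
    {c : ℝ} (hc : ∀ n, c ≤ P.real (W n ⁻¹' F)) : c ≤ P.real (Z ⁻¹' F) := by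
  -- If `W n` lies in `F` and `Y n` is within `ρ` of it, then `Y n` lies in the closed
  -- `ρ`-thickening. The mass of that set under `Y n` does not depend on `n`, so `n → ∞` removes the
  -- error, and afterwards `ρ → 0`.
  have hstep : ∀ ρ : ℝ, 0 < ρ → c ≤ (P.map Z).real (Metric.cthickening ρ F) := by
    intro ρ hρ
    have hmeas : TendstoInMeasure P (fun n ω => Y n ω - W n ω) atTop (fun _ => (0 : V)) :=
      tendstoInMeasure_of_tendsto_ae
        (fun n => ((hY n).sub (hW n)).aestronglyMeasurable) (Eventually.of_forall hlim)
    rw [tendstoInMeasure_iff_measureReal_norm] at hmeas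
    have h1 := hmeas ρ hρ
    have h2 : ∀ n, c - P.real {ω | ρ ≤ ‖Y n ω - W n ω - 0‖} ≤
        (P.map Z).real (Metric.cthickening ρ F) := by
      intro n
      rw [← hlaw n, map_measureReal_apply (hY n) Metric.isClosed_cthickening.measurableSet,
        sub_le_iff_le_add]
      refine (hc n).trans ((measureReal_mono fun ω hω => ?_).trans (measureReal_union_le _ _))
      by_cases h : ρ ≤ ‖Y n ω - W n ω - 0‖
      · exact Or.inr h
      · left
        refine Metric.mem_cthickening_of_dist_le (Y n ω) (W n ω) ρ F hω ?_
        rw [dist_eq_norm]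
        simpa using (not_le.1 h).le
    have h3 := (tendsto_const_nhds (x := c)).sub h1
    rw [sub_zero] at h3
    exact le_of_tendsto h3 (Eventually.of_forall h2)
  have : IsProbabilityMeasure (P.map Z) := Measure.isProbabilityMeasure_map hZ.aemeasurable
  rw [← map_measureReal_apply hZ hF.measurableSet]
  have hlim2 := tendsto_measure_cthickening_of_isClosed (μ := P.map Z) (s := F)
    ⟨1, one_pos, measure_ne_top _ _⟩ hF
  have hlim3 := ((ENNReal.tendsto_toReal (measure_ne_top (P.map Z) F)).comp hlim2).mono_left
    (nhdsWithin_le_nhds (s := Set.Ioi 0))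
  exact ge_of_tendsto hlim3 (eventually_nhdsWithin_of_forall fun ρ hρ => hstep ρ hρ)

end ClosedSet

section StationaryPath

variable {m p T : ℕ}

lemma continuous_solve (Φ : Fin p → Matrix (Fin m) (Fin m) ℝ) (t : ℕ) :
    Continuous fun e : ℕ → Fin m → ℝ => solve Φ e t := by
  induction t using Nat.strong_induction_on with
  | _ t ih =>
    have h : (fun e : ℕ → Fin m → ℝ => solve Φ e t) = fun e => e t + ∑ l : Fin p,
        if (l : ℕ) + 1 ≤ t then Φ l *ᵥ solve Φ e (t - (l + 1)) else 0 := by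
      ext1 e
      rw [solve]
    rw [h]
    refine (continuous_apply t).add (continuous_finsetSum _ fun l _ => ?_)
    split_ifs with hl
    · exact continuous_const.matrix_mulVec (ih _ (by omega))
    · exact continuous_const

variable {Ω : Type*} [MeasurableSpace Ω] {P : Measure Ω}

/-- The innovations of a process, with the time index shifted by one. -/
noncomputable def innov (Φ : Fin p → Matrix (Fin m) (Fin m) ℝ)
    (X : ℤ → Ω → EuclideanSpace ℝ (Fin m)) (x : Ω) (t : ℕ) : Fin m → ℝ :=
  (X (t + 1) x).ofLp - ∑ l : Fin p, Φ l *ᵥ (X (t + 1 - ((l : ℤ) + 1)) x).ofLp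

variable {Φ : Fin p → Matrix (Fin m) (Fin m) ℝ} {S : Matrix (Fin m) (Fin m) ℝ}
  {X ε : ℤ → Ω → EuclideanSpace ℝ (Fin m)}

lemma IsStationaryVAR.measurable_innov (h : IsStationaryVAR P Φ S X ε) (t : ℕ) :
    Measurable fun x => innov Φ X x t := by
  have hX : ∀ t, Measurable fun x => (X t x).ofLp := fun t =>
    (PiLp.continuous_ofLp 2 _).measurable.comp (h.measurable t)
  exact (hX _).sub (Finset.measurable_sum _ fun l _ => (measurable_mulVec (Φ l)).comp (hX _))

lemma IsStationaryVAR.innov_ae_eq (h : IsStationaryVAR P Φ S X ε) (t : ℕ) :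
    (fun x => (ε (t + 1) x).ofLp) =ᵐ[P] fun x => innov Φ X x t := by
  filter_upwards [h.recursion (t + 1)] with x hx
  ext s
  rw [innov, Pi.sub_apply, hx s, Finset.sum_apply]
  ring

lemma IsStationaryVAR.map_innov [IsProbabilityMeasure P] (h : IsStationaryVAR P Φ S X ε) (M : ℕ) :
    P.map (fun x (t : Fin M) => innov Φ X x t) =
      (stdNormal (Fin M × Fin m)).map fun g t => CFC.sqrt S *ᵥ fun s => g (t, s) := by
  have hinj : Function.Injective fun t : Fin M => ((t : ℕ) : ℤ) + 1 := by
    intro a b hab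
    simp only at hab
    exact Fin.ext (by omega)
  have hofLp : Measurable (WithLp.ofLp : EuclideanSpace ℝ (Fin m) → Fin m → ℝ) :=
    (PiLp.continuous_ofLp 2 _).measurable
  have h1 := (h.noise_indep.precomp hinj).comp (fun _ => WithLp.ofLp) fun _ => hofLp
  have h2 : iIndepFun (fun (t : Fin M) x => innov Φ X x t) P :=
    (iIndepFun_congr fun t : Fin M => h.innov_ae_eq t).1 h1
  rw [h2.map_fun_eq_pi_map (fun t : Fin M => (h.measurable_innov t).aemeasurable),
    ← pi_multivariateGaussian]
  congr 1
  ext1 t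
  rw [← Measure.map_congr (h.innov_ae_eq t), ← (h.noise_law (t + 1)).map_eq,
    AEMeasurable.map_map_of_aemeasurable hofLp.aemeasurable (h.noise_law (t + 1)).aemeasurable]
  rfl

/-- As `innov` is computed from `X` itself, the recursion holds for every outcome, and the
difference solves the homogeneous equation once `t ≥ p`; earlier, the filter truncates the history.
Stability makes it decay surely. -/
lemma IsStationaryVAR.tendsto_sub_solve (hm : 0 < m) (hp : 0 < p) (hΦ : IsStable Φ) (x : Ω) :
    Tendsto (fun t : ℕ => (X (t + 1) x).ofLp - solve Φ (innov Φ X x) t) atTop (𝓝 0) := by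
  refine tendsto_zero_of_vfilter hm hp hΦ (K := p) fun t ht => ?_
  have h1 := vfilter_add Φ (fun t : ℕ => (X (t + 1) x).ofLp) ((-1 : ℝ) • solve Φ (innov Φ X x)) t
  rw [vfilter_smul, vfilter_solve] at h1
  have h2 : (fun t : ℕ => (X (t + 1) x).ofLp - solve Φ (innov Φ X x) t) =
      (fun t : ℕ => (X (t + 1) x).ofLp) + (-1 : ℝ) • solve Φ (innov Φ X x) := by
    ext1 t
    simp [sub_eq_add_neg]
  rw [h2, h1, neg_one_smul, ← sub_eq_add_neg, sub_eq_zero, vfilter, innov]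
  congr 1
  refine Finset.sum_congr rfl fun l _ => ?_
  have hl := l.2
  rw [if_pos (by omega)]
  congr 3
  push_cast [show (l : ℕ) + 1 ≤ t by omega]
  ring_nf

/-- Good observed paths of a stationary process are at least as likely as good simulated paths. -/
lemma IsStationaryVAR.le_measureReal_goodPaths [IsProbabilityMeasure P] (hm : 0 < m) (hp : 0 < p)
    (hΦ : IsStable Φ) (h : IsStationaryVAR P Φ S X ε) {α τ δ c : ℝ}
    (hc : ∀ n, c ≤ (stdNormal (Fin (n + T) × Fin m)).real
      {g | pathOf n (solve Φ (noise (CFC.sqrt S) (n + T) g)) ∈ goodPaths T Φ α τ δ}) :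
    MeasurableSet {x | (fun t => X t x) ∈ goodPaths T Φ α τ δ} ∧
      c ≤ P.real {x | (fun t => X t x) ∈ goodPaths T Φ α τ δ} := by
  set F : Set (Fin T → EuclideanSpace ℝ (Fin m)) := {z | extend z ∈ goodPaths T Φ α τ δ} with hFdef
  have hF : IsClosed F := isClosed_goodPaths Φ α τ δ
  have hobs : ∀ x : ℤ → EuclideanSpace ℝ (Fin m),
      observe T x ∈ F ↔ x ∈ goodPaths T Φ α τ δ := fun x =>
    mem_goodPaths_congr fun t h1 h2 => extend_observe x h1 h2
  let Z : Ω → Fin T → EuclideanSpace ℝ (Fin m) := fun x => observe T fun t => X t x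
  have hZ : Measurable Z := measurable_pi_lambda _ fun i => h.measurable _
  have hset : {x | (fun t => X t x) ∈ goodPaths T Φ α τ δ} = Z ⁻¹' F := by
    ext x
    exact (hobs _).symm
  rw [hset]
  refine ⟨hF.measurableSet.preimage hZ, ?_⟩
  -- The window moved `n` steps to the right: it has the law of `Z`, and its distance to the path
  -- simulated from the innovations tends to zero.
  let Y : ℕ → Ω → Fin T → EuclideanSpace ℝ (Fin m) := fun n x => observe T fun t => X (t + n) x
  let pathMap : ∀ n : ℕ, (ℕ → Fin m → ℝ) → Fin T → EuclideanSpace ℝ (Fin m) := fun n e =>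
    observe T (pathOf n (solve Φ e))
  have hpath : ∀ n, Continuous (pathMap n) := fun n => continuous_pi fun i =>
    (PiLp.continuous_toLp 2 _).comp (continuous_solve Φ _)
  have hinnov : Measurable fun x => innov Φ X x := measurable_pi_lambda _ h.measurable_innov
  have hpm : ∀ n, Measurable (pathMap n) := fun n => (hpath n).measurable
  refine le_measureReal_of_approx (Y := Y) (W := fun n x => pathMap n (innov Φ X x)) hZ
    (fun n => measurable_pi_lambda _ fun i => h.measurable _)
    (fun n => (hpm n).comp hinnov) (fun n => ?_) (fun x => ?_) hF fun n => ?_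
  · have hXall : Measurable fun x t => X t x := measurable_pi_lambda _ h.measurable
    have hXn : Measurable fun x t => X (t + n) x := measurable_pi_lambda _ fun t => h.measurable _
    have hom : Measurable (observe T : (ℤ → EuclideanSpace ℝ (Fin m)) → _) :=
      measurable_pi_lambda _ fun i => measurable_pi_apply _
    have := congrArg (Measure.map (observe T)) (h.stationary n)
    rwa [Measure.map_map hom hXn, Measure.map_map hom hXall] at this
  · rw [tendsto_pi_nhds]
    intro i
    have h1 : Tendsto (fun n : ℕ => n + (i : ℕ)) atTop atTop := tendsto_add_atTop_nat _
    have h2 := (IsStationaryVAR.tendsto_sub_solve (X := X) hm hp hΦ x).comp h1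
    have h3 := ((PiLp.continuous_toLp 2 fun _ : Fin m => ℝ).tendsto 0).comp h2
    refine h3.congr fun n => ?_
    simp only [Y, pathMap, observe, pathOf, Function.comp_apply, Pi.sub_apply]
    have h4 : ((n : ℤ) + ((i : ℤ) + 1) - 1).toNat = n + i := by omega
    have h5 : ((n + (i : ℕ) : ℕ) : ℤ) + 1 = (i : ℤ) + 1 + n := by push_cast; ring
    rw [h4, h5]
    rfl
  -- By causality the window sees only the first `n + T` innovations, whose joint law is that of the
  -- finite noise vector.
  · let zext : (Fin (n + T) → Fin m → ℝ) → ℕ → Fin m → ℝ := fun v t =>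
      if ht : t < n + T then v ⟨t, ht⟩ else 0
    have hzext : Measurable zext := by
      refine measurable_pi_lambda _ fun t => ?_
      by_cases ht : t < n + T
      · simp only [zext, ht, dite_true]
        exact measurable_pi_apply _
      · simp only [zext, ht, dite_false]
        exact measurable_const
    have hcongr : ∀ e e' : ℕ → Fin m → ℝ, (∀ t < n + T, e t = e' t) →
        pathMap n e = pathMap n e' := by
      intro e e' hee
      ext1 i
      have hi := i.2
      simp only [pathMap, observe, pathOf]
      rw [solve_congr Φ fun s hs => hee s (by omega)]
    have hW : (fun x => pathMap n (innov Φ X x)) = (fun v => pathMap n (zext v)) ∘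
        fun x (t : Fin (n + T)) => innov Φ X x t := by
      ext1 x
      refine hcongr _ _ fun t ht => ?_
      simp [zext, ht]
    have hmeas1 : Measurable fun x (t : Fin (n + T)) => innov Φ X x t :=
      measurable_pi_lambda _ fun t => h.measurable_innov t
    have hmeas2 : Measurable fun (g : Fin (n + T) × Fin m → ℝ) (t : Fin (n + T)) =>
        CFC.sqrt S *ᵥ fun s => g (t, s) :=
      measurable_pi_lambda _ fun t => (measurable_mulVec (CFC.sqrt S)).comp (by fun_prop)
    have hset2 : MeasurableSet ((fun v => pathMap n (zext v)) ⁻¹' F) :=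
      hF.measurableSet.preimage ((hpm n).comp hzext)
    change c ≤ P.real ((fun x => pathMap n (innov Φ X x)) ⁻¹' F)
    rw [hW, Set.preimage_comp, ← map_measureReal_apply hmeas1 hset2, h.map_innov,
      map_measureReal_apply hmeas2 hset2]
    refine (hc n).trans (le_of_eq ?_)
    congr 1
    ext g
    rw [Set.mem_ofPred_eq, ← hobs]
    have : (zext fun t => CFC.sqrt S *ᵥ fun s => g (t, s)) = noise (CFC.sqrt S) (n + T) g := rfl
    simp only [Set.mem_preimage, this, pathMap]

end StationaryPath

end SparseVAR

/-! ### Choice of constants and conclusion. -/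

namespace SparseVAR

section Constants

/-- The covering factor of the restricted eigenvalue bound is absorbed by half of its exponent. -/
lemma covering_mul_exp_le {d q ν : ℕ} (hd : 1 ≤ d) (hdq : d ≤ q) (hq : 2 ≤ q) {A D N : ℝ}
    (hD : 0 < D) (hν : (ν : ℝ) + 1 ≤ 18 * A) (hN : 2304 * (A * D * Real.log q) ≤ N) :
    ((2 * (d : ℝ)) ^ (ν + 1) + d) * Real.exp (-(N / (32 * D))) ≤ 2 * Real.exp (-(N / (64 * D))) := by
  have hd' : (1 : ℝ) ≤ d := by exact_mod_cast hd
  have hdq' : (d : ℝ) ≤ q := by exact_mod_cast hdq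
  have hq' : (2 : ℝ) ≤ q := by exact_mod_cast hq
  have hL : 0 < Real.log q := Real.log_pos (by linarith)
  have h1 : (2 * (d : ℝ)) ≤ Real.exp (2 * Real.log q) := by
    rw [two_mul (Real.log q), Real.exp_add, Real.exp_log (by linarith)]
    nlinarith
  -- As `2d ≤ q²`, the logarithm is at most `2 (ν + 1) log q ≤ 36 A log q`, and `2304 = 64 · 36`.
  have h2 : (2 * (d : ℝ)) ^ (ν + 1) ≤ Real.exp (N / (64 * D)) := by
    refine (pow_le_pow_left₀ (by linarith) h1 _).trans ?_
    rw [← Real.exp_nat_mul, Real.exp_le_exp, le_div_iff₀ (by positivity)]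
    push_cast
    have := mul_le_mul_of_nonneg_right hν (by positivity : 0 ≤ 128 * (D * Real.log q))
    linarith
  have h3 : (d : ℝ) ≤ (2 * (d : ℝ)) ^ (ν + 1) :=
    (by linarith : (d : ℝ) ≤ 2 * d).trans (le_self_pow₀ (by linarith) (by omega))
  calc ((2 * (d : ℝ)) ^ (ν + 1) + d) * Real.exp (-(N / (32 * D)))
      ≤ (2 * Real.exp (N / (64 * D))) * Real.exp (-(N / (32 * D))) := by
        gcongr
        linarith
    _ = 2 * Real.exp (-(N / (64 * D))) := by
        rw [mul_assoc, ← Real.exp_add]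
        congr 2
        field_simp
        ring

lemma min_inv_one (x : ℝ) (hx : 0 < x) : min x⁻¹ 1 = (max x 1)⁻¹ := by
  rcases le_total x 1 with h | h
  · rw [max_eq_right h, min_eq_right ((one_le_inv₀ hx).2 h), inv_one]
  · rw [max_eq_left h, min_eq_left (inv_le_one_of_one_le₀ h)]

end Constants

section Probability

open scoped MatrixOrder

variable {m p T : ℕ} {Φ : Fin p → Matrix (Fin m) (Fin m) ℝ} {S : Matrix (Fin m) (Fin m) ℝ}
  {Ω : Type*} [MeasurableSpace Ω] {P : Measure Ω} {X ε : ℤ → Ω → EuclideanSpace ℝ (Fin m)}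

/-- The restricted eigenvalue condition and the deviation bound hold with high probability. -/
lemma IsStationaryVAR.goodPaths_probability [IsProbabilityMeasure P] (hm : 0 < m) (hp : 0 < p)
    (hpT : p < T) (hΦ : IsStable Φ) (hS : S.PosDef) (h : IsStationaryVAR P Φ S X ε)
    {L N A : ℝ} (hq : 2 ≤ m * (p * m)) (hL : L = Real.log (m * (p * m) : ℕ))
    (hN : N = (T - p : ℕ)) (hA : 1 ≤ A)
    (hNA : 2304 * (A * max (omegaConst 1 Φ S ^ 2) 1 * L) ≤ N) {ν : ℕ} (hν : 0 < ν)
    (hνA : (ν : ℝ) + 1 ≤ 18 * A) {δ : ℝ} (hδ : qConst 4 Φ S * √(L / N) ≤ δ) :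
    MeasurableSet {x | (fun t => X t x) ∈ goodPaths T Φ (alphaConst Φ S)
        (2 * alphaConst Φ S / ν) δ} ∧
      1 - 2 * Real.exp (-(1 / 64) * N * min ((omegaConst 1 Φ S ^ 2)⁻¹) 1) -
          4 * Real.exp (-1 * L) ≤
        P.real {x | (fun t => X t x) ∈ goodPaths T Φ (alphaConst Φ S)
          (2 * alphaConst Φ S / ν) δ} := by
  have : Nonempty (Fin m) := ⟨⟨0, hm⟩⟩
  have : Nonempty (Fin p) := ⟨⟨0, hp⟩⟩
  have hb := lambdaMin_pos hS
  have hb' := lambdaMax_pos hS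
  have hμ : 0 < muMax Φ := muMax_pos hΦ
  have hμ' : 0 < muMin Φ := muMin_pos hΦ
  have hμc : 0 < muMin (fun _ : Fin 1 => companion Φ) := muMin_pos (isStable_companion hΦ)
  have hα : 0 < alphaConst Φ S := by rw [alphaConst]; positivity
  set α := alphaConst Φ S with hαdef
  set ω := omegaConst 1 Φ S with hωdef
  have hωα : lambdaMax S / muMin (fun _ : Fin 1 => companion Φ) = 2 * α * ω := by
    rw [hωdef, hαdef, omegaConst, alphaConst]
    field_simp
  have hω : 0 < ω := by rw [hωdef, omegaConst]; positivity
  have hD : 1 ≤ max (ω ^ 2) 1 := le_max_right _ _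
  have hDsq : max (ω ^ 2) 1 = max ω 1 ^ 2 := by
    rcases le_total ω 1 with h1 | h1
    · rw [max_eq_right h1, max_eq_right (by nlinarith), one_pow]
    · rw [max_eq_left h1, max_eq_left (by nlinarith)]
  have hL0 : 0 < L := by
    rw [hL]
    exact Real.log_pos (by exact_mod_cast (by omega : 1 < m * (p * m)))
  have hLN : 2304 * L ≤ N := by
    refine le_trans ?_ hNA
    have : 1 ≤ A * max (ω ^ 2) 1 := one_le_mul_of_one_le_of_one_le hA hD
    nlinarith
  have hN0 : 0 < N := by linarith
  -- Then `N x² / 8 = 2 L`: one factor `e^(-L)` absorbs the union over the `m² p = e^L` coordinates,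
  -- the other is the stated probability.
  set x := 4 * √(L / N) with hxdef
  have hx2 : x ^ 2 = 16 * (L / N) := by
    rw [hxdef, mul_pow, Real.sq_sqrt (by positivity)]
    norm_num
  have hx1 : x ≤ 1 := by
    have : L / N ≤ 1 / 16 := by
      rw [div_le_iff₀ hN0]
      linarith
    nlinarith
  have hx0 : 0 ≤ x := by positivity
  -- With `κ = 2α max(ω, 1)` the exponent `N (α/κ)² / 8` is `N / (32 max(ω², 1))`; half of it pays
  -- for the covering.
  have hκ : lambdaMax S / muMin (fun _ : Fin 1 => companion Φ) ≤ 2 * α * max ω 1 := by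
    rw [hωα]
    gcongr
    exact le_max_left _ _
  have hακ : lambdaMin S / (2 * muMax Φ) ≤ 2 * α * max ω 1 := by
    have : α * 1 ≤ α * max ω 1 := mul_le_mul_of_nonneg_left (le_max_right _ _) hα.le
    have h0 : lambdaMin S / (2 * muMax Φ) = α := rfl
    rw [h0]
    nlinarith
  have hδ' : x * (lambdaMax S / muMin Φ + lambdaMax S) ≤ δ := by
    refine le_trans ?_ hδ
    rw [hxdef, qConst]
    have : 0 ≤ lambdaMax S * muMax Φ / muMin Φ * √(L / N) := by positivity
    nlinarith
  have hmono : goodPaths T Φ α (2 * α / ν) (x * (lambdaMax S / muMin Φ + lambdaMax S)) ⊆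
      goodPaths T Φ α (2 * α / ν) δ := fun y hy => ⟨hy.1, fun j => (hy.2 j).trans hδ'⟩
  refine h.le_measureReal_goodPaths hm hp hΦ fun n => ?_
  have hmain := stdNormal_goodPaths (T := T) (H := CFC.sqrt S) hm hp hpT hΦ hb hb'
    (lambdaMin_mul_le_sqrt hS) (sqrt_le_lambdaMax_mul hS) hκ hακ hx0 hx1 hν n
  have h0 : lambdaMin S / (2 * muMax Φ) = α := rfl
  rw [h0, ← hN] at hmain
  set G := {g | pathOf n (solve Φ (noise (CFC.sqrt S) (n + T) g)) ∈
    goodPaths T Φ α (2 * α / ν) (x * (lambdaMax S / muMin Φ + lambdaMax S))} with hG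
  have hone : 1 ≤ (stdNormal (Fin (n + T) × Fin m)).real G +
      (stdNormal (Fin (n + T) × Fin m)).real Gᶜ := by
    have := measureReal_union_le (μ := stdNormal (Fin (n + T) × Fin m)) G Gᶜ
    rwa [Set.union_compl_self, probReal_univ] at this
  have hGsub : (stdNormal (Fin (n + T) × Fin m)).real G ≤
      (stdNormal (Fin (n + T) × Fin m)).real {g | pathOf n (solve Φ (noise (CFC.sqrt S) (n + T) g)) ∈
        goodPaths T Φ α (2 * α / ν) δ} := measureReal_mono fun g hg => hmono hg
  have hpm : p * m ≤ m * (p * m) := Nat.le_mul_of_pos_left _ hm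
  have hcov := covering_mul_exp_le (Nat.mul_pos hp hm) hpm hq (by linarith) hνA (hL ▸ hNA)
  have he1 : N * (α / (2 * α * max ω 1)) ^ 2 / 8 = N / (32 * max (ω ^ 2) 1) := by
    rw [hDsq]
    have : 0 < max ω 1 := lt_max_of_lt_left hω
    field_simp
    norm_num
  have he2 : -(1 / 64) * N * min ((ω ^ 2)⁻¹) 1 = -(N / (64 * max (ω ^ 2) 1)) := by
    rw [min_inv_one _ (by positivity)]
    field_simp
  have he3 : ((m * (p * m) : ℕ) : ℝ) * (4 * Real.exp (-(N * x ^ 2 / 8))) =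
      4 * Real.exp (-1 * L) := by
    have hexp : ((m * (p * m) : ℕ) : ℝ) = Real.exp L := by
      rw [hL, Real.exp_log (by exact_mod_cast (by omega : 0 < m * (p * m)))]
    rw [hexp, hx2, mul_left_comm, ← Real.exp_add]
    congr 2
    field_simp
    ring
  rw [he1, he3] at hmain
  rw [he2]
  linarith

end Probability

section Estimation

variable {m p T : ℕ} {Φ : Fin p → Matrix (Fin m) (Fin m) ℝ}

/-- On good paths every weighted lasso estimate obeys the estimation and selection bounds. -/
lemma estimate_bounds_of_mem_goodPaths {x : ℤ → EuclideanSpace ℝ (Fin m)} {α τ lam r s₀ : ℝ}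
    {βs βh w : CoefIdx m p → ℝ} (hβs : βs = vec (coefMatrix Φ))
    (hx : x ∈ goodPaths T Φ α τ (lam / 4)) (hw0 : ∀ j, 0 ≤ w j)
    (hw : ∀ j, βs j = 0 → 1 ≤ w j) (hwr : ∀ j, βs j ≠ 0 → w j ≤ r)
    (hr : 0 ≤ r) (hs₀ : 0 < s₀) (hs : ∀ j, βs j ≠ 0 → s₀ ≤ |βs j|) (hα : 0 < α) (hlam : 0 < lam)
    (hτ : 0 ≤ τ) (hτk : 4 * (1 + r) ^ 2 * (Function.support βs).ncard * τ ≤ α / 2)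
    (hβh : IsEstimate p T x w lam βh) :
    l2Norm (βh - βs) ≤ (1 + 2 * r) / α * √((Function.support βs).ncard) * lam ∧
    l1Norm (βh - βs) ≤ (2 + 6 * r + 4 * r ^ 2) / α * (Function.support βs).ncard * lam ∧
    (βh - βs) ⬝ᵥ (GammaHat p T x *ᵥ (βh - βs)) ≤
      (1 + 2 * r) ^ 2 / (2 * α) * (Function.support βs).ncard * lam ^ 2 ∧
    ((Function.support βs \ Function.support βh).ncard : ℝ) ≤
      (2 + 6 * r + 4 * r ^ 2) / (s₀ * α) * (Function.support βs).ncard * lam ∧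
    ((Function.support (hardThreshold lam βh) \ Function.support βs).ncard : ℝ) ≤
      (1 + 2 * r) ^ 2 * ((Function.support βs).ncard / α) := by
  refine weighted_lasso_bounds (GammaHat_isSymm x) (γ := gammaHat p T x) hw0 hw hwr hr hs₀ hs hα
    hlam (fun v => ?_) hτ (GammaHat_restrictedEigenvalue hτ hx.1) hτk (hβs ▸ hx.2) (hβh βs)
  rw [GammaHat_quadForm]
  positivity

end Estimation

end SparseVAR

theorem theorem1 :
    ∃ a₁ a₂ c b₁ b₂ b₃ b₄ : ℝ,
      0 < a₁ ∧ 0 < a₂ ∧ 0 < c ∧ 0 < b₁ ∧ 0 < b₂ ∧ 0 < b₃ ∧ 0 < b₄ ∧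
      ∀ (Ω : Type*) [MeasurableSpace Ω] (P : Measure Ω) [IsProbabilityMeasure P]
        (m p T : ℕ), 0 < m → 0 < p → p < T →
      ∀ (Φ : Fin p → Matrix (Fin m) (Fin m) ℝ) (S : Matrix (Fin m) (Fin m) ℝ)
        (X ε : ℤ → Ω → EuclideanSpace ℝ (Fin m)),
        SparseVAR.IsStable Φ → S.PosDef → SparseVAR.IsStationaryVAR P Φ S X ε →
      ∀ (βs : SparseVAR.CoefIdx m p → ℝ) (k : ℕ) (w : SparseVAR.CoefIdx m p → ℝ)
        (r s₀ lam N L ω α Q : ℝ),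
        βs = Matrix.vec (SparseVAR.coefMatrix Φ) →
        k = (Function.support βs).ncard →
        (∀ j, 0 ≤ w j) →
        IsLeast (w '' (Function.support βs)ᶜ) 1 →
        IsGreatest (w '' Function.support βs) r →
        IsLeast ((fun j => |βs j|) '' Function.support βs) s₀ →
        N = ((T - p : ℕ) : ℝ) →
        L = Real.log p + 2 * Real.log m →
        ω = SparseVAR.omegaConst a₁ Φ S →
        α = SparseVAR.alphaConst Φ S →
        Q = SparseVAR.qConst a₂ Φ S →
        c * ((1 + r) ^ 2 * max (ω ^ 2) 1 * k * L) ≤ N →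
        4 * Q * √(L / N) ≤ lam →
        ∃ E : Set Ω, MeasurableSet E ∧
          1 - b₁ * Real.exp (-b₂ * N * min ((ω ^ 2)⁻¹) 1) - b₃ * Real.exp (-b₄ * L) ≤ P.real E ∧
          ∀ x ∈ E, ∀ βh : SparseVAR.CoefIdx m p → ℝ,
            SparseVAR.IsEstimate p T (fun t => X t x) w lam βh →
            SparseVAR.l2Norm (βh - βs) ≤ (1 + 2 * r) / α * √k * lam ∧
            SparseVAR.l1Norm (βh - βs) ≤ (2 + 6 * r + 4 * r ^ 2) / α * k * lam ∧
            (βh - βs) ⬝ᵥ (SparseVAR.GammaHat p T (fun t => X t x) *ᵥ (βh - βs)) ≤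
              (1 + 2 * r) ^ 2 / (2 * α) * k * lam ^ 2 ∧
            ((Function.support βs \ Function.support βh).ncard : ℝ) ≤
              (2 + 6 * r + 4 * r ^ 2) / (s₀ * α) * k * lam ∧
            ((Function.support (SparseVAR.hardThreshold lam βh) \ Function.support βs).ncard : ℝ) ≤
              (1 + 2 * r) ^ 2 * (k / α) := by
  refine ⟨1, 4, 2304, 2, 1 / 64, 4, 1, by norm_num, by norm_num, by norm_num, by norm_num,
    by norm_num, by norm_num, by norm_num, ?_⟩
  intro Ω _ P _ m p T hm hp hpT Φ S X ε hΦ hS hX βs k w r s₀ lam N L ω α Q hβs hk hw0 hw1 hwr hs₀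
    hN hL hω hα hQ hNk hlam
  subst hω hα hQ
  have : Nonempty (Fin m) := ⟨⟨0, hm⟩⟩
  obtain ⟨⟨j₀, hj₀, hj₀w⟩, hwr⟩ := hwr
  obtain ⟨⟨j₁, hj₁, -⟩, hw1⟩ := hw1
  obtain ⟨⟨j₂, hj₂, hj₂s⟩, hs₀⟩ := hs₀
  -- Support and complement are both nonempty, so there are at least two coefficients and the
  -- logarithm is positive.
  have hq : 2 ≤ m * (p * m) := by
    have h1 : 1 < Fintype.card (SparseVAR.CoefIdx m p) :=
      Fintype.one_lt_card_iff.2 ⟨j₀, j₁, fun h => hj₁ (h ▸ hj₀)⟩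
    rwa [Fintype.card_prod, Fintype.card_prod, Fintype.card_fin, Fintype.card_fin] at h1
  have hLq : L = Real.log (m * (p * m) : ℕ) := by
    have hm' : (m : ℝ) ≠ 0 := by exact_mod_cast hm.ne'
    have hp' : (p : ℝ) ≠ 0 := by exact_mod_cast hp.ne'
    push_cast
    rw [hL, Real.log_mul hm' (mul_ne_zero hp' hm'), Real.log_mul hp' hm']
    ring
  have hr : 0 ≤ r := hj₀w ▸ hw0 j₀
  have hk1 : (1 : ℝ) ≤ k := by
    rw [hk]
    exact_mod_cast (Set.ncard_pos (Set.toFinite _)).2 ⟨j₀, hj₀⟩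
  have hA : 1 ≤ (1 + r) ^ 2 * k := one_le_mul_of_one_le_of_one_le (by nlinarith) hk1
  set A := (1 + r) ^ 2 * k with hAdef
  have hNA : 2304 * (A * max (SparseVAR.omegaConst 1 Φ S ^ 2) 1 * L) ≤ N := by
    refine le_trans (le_of_eq ?_) hNk
    ring
  -- The sparsity level of Maurey's sums. With `τ = 2α/ν` the condition `4 (1 + r)² k τ ≤ α/2` reads
  -- `ν ≥ 16 A`; rounding up gives `ν + 1 ≤ 16 A + 2 ≤ 18 A`.
  have hν : 0 < ⌈16 * A⌉₊ := Nat.ceil_pos.2 (by linarith)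
  have hν1 : 16 * A ≤ ⌈16 * A⌉₊ := Nat.le_ceil _
  have hν2 : (⌈16 * A⌉₊ : ℝ) + 1 ≤ 18 * A := by
    have := Nat.ceil_lt_add_one (by linarith : 0 ≤ 16 * A)
    linarith
  have hL0 : 0 < L := by
    rw [hLq]
    exact Real.log_pos (by exact_mod_cast (by omega : 1 < m * (p * m)))
  have hN0 : 0 < N := by
    rw [hN]
    exact_mod_cast (by omega : 0 < T - p)
  have hb := SparseVAR.lambdaMin_pos hS
  have hb' := SparseVAR.lambdaMax_pos hS
  have hμ : 0 < SparseVAR.muMax Φ := SparseVAR.muMax_pos hΦ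
  have hμ' : 0 < SparseVAR.muMin Φ := SparseVAR.muMin_pos hΦ
  have hα : 0 < SparseVAR.alphaConst Φ S := by
    rw [SparseVAR.alphaConst]
    positivity
  have hlam0 : 0 < lam := by
    refine lt_of_lt_of_le ?_ hlam
    rw [SparseVAR.qConst]
    have := div_pos hL0 hN0
    positivity
  obtain ⟨hmeas, hprob⟩ := hX.goodPaths_probability (δ := lam / 4) hm hp hpT hΦ hS hq hLq hN hA hNA
    hν hν2 (by linarith)
  refine ⟨_, hmeas, hprob, fun x hx βh hβh => ?_⟩
  subst hk
  refine SparseVAR.estimate_bounds_of_mem_goodPaths hβs hx hw0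
    (fun j hj => hw1 ⟨j, by simpa using hj, rfl⟩) (fun j hj => hwr ⟨j, hj, rfl⟩) hr ?_
    (fun j hj => hs₀ ⟨j, hj, rfl⟩) hα hlam0 (by positivity) ?_ hβh
  · rw [← hj₂s]
    exact abs_pos.2 hj₂
  · have hν0 : (0 : ℝ) < ⌈16 * A⌉₊ := by exact_mod_cast hν
    rw [mul_div_assoc', div_le_iff₀ hν0]
    nlinarith
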